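/- **Model.** The world alternates between state $1$ (non-surge) and state $2$ (surge) as a continuous-time Markov chain with rates $\lambda_{1\to2},\lambda_{2\to1}>0$; let $q_{i\to j}(s)$, $j\ne i$, be the probability of being in state $j$ a time $s$ after being in state $i$. While open in state $i$, a driver receives requests at Poisson rate $\lambda_i>0$; trip lengths are i.i.d. from a distribution $F_i$ on $(0,\infty)$ with bounded density $f_i$ and finite mean. A policy $\sigma=\{\sigma_1,\sigma_2\}$ consists of open sets $\sigma_i\subseteq(0,\infty)$: in state $i$ the driver accepts exactly the requests with length in $\sigma_i$. A trip of length $\tau$ accepted in state $i$ keeps the driver busy for time $\tau$ and pays $w_i(\tau)$, where $w_i$ is continuous on $(0,\infty)$ and $F_i$-integrable. If $R(w,\sigma,t)$ denotes the earnings from trips completed by time $t$, the earnings rate is $R(w,\sigma)=\liminf_{t\to\infty}R(w,\sigma,t)/t$, and $\sigma$ is optimal if it maximizes $R(w,\cdot)$ over all policies. State $2$ is the surge state: with $R_i(w_i,\sigma_i)=\dfrac{\lambda_i\int_{\sigma_i}w_i\,dF_i}{1+\lambda_i\int_{\sigma_i}\tau\,dF_i(\tau)}$, some $\sigma_2$ satisfies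 $R_2(w_2,\sigma_2)>R_1(w_1,\sigma_1)$ for all $\sigma_1$. Pricing $w_i$ is multiplicative if $w_i(\tau)=m\tau$, positive affine if $w_i(\tau)=m\tau+a$, negative affine if $w_i(\tau)=m\tau-a$, where $m\ge0$, $a>0$. Pricing is incentive compatible in state $i$ if some optimal policy has $\sigma_i=(0,\infty)$. **Theorem.** Let $w=\{w_1,w_2\}$ be as above. (a) For every policy $\sigma$, $R(w,\sigma,t)/t$ converges almost surely to the constant $R(w,\sigma)$. (b) There is an optimal policy $\sigma$ with all of the following properties. * Non-surge state. If $w_1$ is multiplicative or positive affine, then $\sigma_1=(0,t_1)$ with $t_1\in[0,\infty]$. If $w_1$ is negative affine, then $\sigma_1=(t_2,t_3)$ with $t_2,t_3\in[0,\infty]$. * Surge state. If $w_2$ is multiplicative or negative affine, then $\sigma_2=(t_4,\infty)$ with $t_4\in[0,\infty)$. If $w_2$ is positive affine, then $\sigma_2=(0,t_5)\cup(t_6,\infty)$ with $t_5,t_6\in[0,\infty]$. * Either state $i$. If for every policy $\sigma'$ the derivative of $R(w,\sigma')$ with respect to every upper endpoint $u$, $f_i(u)>0$, of an interval of $\sigma'_i$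 is positive (the derivative being taken as $u$ is moved downwards), then $\sigma_i=(0,\infty)$. (c) Only policies of these forms are optimal: if $\sigma$ is optimal, then for each $i$ the set $\sigma_i$ agrees up to an $F_i$-null set with a set of the form given in (b). (d) There are settings with an optimal policy, with densities $f_1,f_2$ positive on $(0,\infty)$, and such that in every optimal policy, up to null sets, the sets have the forms in (b) with thresholds that are positive and finite: * with $w_1$ and $w_2$ multiplicative, $\sigma_1=(0,t_1)$ and $\sigma_2=(t_4,\infty)$, and pricing is not incentive compatible in either state; * with $w_1$ positive affine and $w_2$ negative affine, $\sigma_1=(0,t_1)$ and $\sigma_2=(t_4,\infty)$; * with $w_1$ negative affine and $w_2$ positive affine, $\sigma_1=(t_2,t_3)$ with $0<t_2<t_3<\infty$ and $\sigma_2=(0,t_5)\cup(t_6,\infty)$ with $0<t_5<t_6<\infty$. -/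

import Mathlib

open Set Filter MeasureTheory Topology
open scoped ENNReal

noncomputable section

/-- The two world states: state 1 (`nonsurge`) and state 2 (`surge`). -/
inductive WorldState where
  | nonsurge : WorldState
  | surge : WorldState
  deriving DecidableEq

instance WorldState.instFintype : Fintype WorldState :=
  ⟨{.nonsurge, .surge}, fun i => by cases i <;> simp⟩

/-- The state `j ≠ i`. -/
def WorldState.other : WorldState → WorldState
  | .nonsurge => .surge
  | .surge => .nonsurge

/-- The primitives of the dynamic model. -/
structure DynamicModel where
  /-- `lam i` is the Poisson rate at which an open driver receives requests in state `i`. -/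
  lam : WorldState → ℝ
  lam_pos : ∀ i, 0 < lam i
  /-- `switch i` is the rate at which the world moves from state `i` to the other state. -/
  switch : WorldState → ℝ
  switch_pos : ∀ i, 0 < switch i
  /-- `density i` is the (bounded) density of the trip length distribution in state `i`. -/
  density : WorldState → ℝ → ℝ
  density_measurable : ∀ i, Measurable (density i)
  density_nonneg : ∀ i τ, 0 ≤ density i τ
  density_bounded : ∀ i, ∃ C : ℝ, ∀ τ, density i τ ≤ C
  density_eq_zero : ∀ i τ, τ ≤ 0 → density i τ = 0
  lintegral_density : ∀ i, ∫⁻ τ, ENNReal.ofReal (density i τ) = 1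
  /-- trip lengths have a finite mean -/
  integrable_length : ∀ i, Integrable (fun τ => τ * density i τ) volume
  /-- the world state at time `0`, when the driver is open -/
  init : WorldState

/-- Payments: `w i τ` is paid for a trip of length `τ > 0` that starts in world state `i`
(values at `τ ≤ 0` are irrelevant). -/
abbrev Pricing := WorldState → ℝ → ℝ

/-- Driver policies: `σ i` is the set of trip lengths accepted in world state `i`. -/
abbrev Policy := WorldState → Set ℝ

/-- Admissible policies: open subsets of `(0, ∞)` in each state. -/
def IsPolicy (σ : Policy) : Prop := ∀ i, IsOpen (σ i) ∧ σ i ⊆ Ioi 0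

namespace DynamicModel

variable (M : DynamicModel)

/-- The trip length distribution `F_i`. -/
def F (i : WorldState) : Measure ℝ :=
  volume.withDensity (fun τ => ENNReal.ofReal (M.density i τ))

instance instIsProbabilityMeasureF (i : WorldState) : IsProbabilityMeasure (M.F i) :=
  ⟨by rw [F, withDensity_apply _ MeasurableSet.univ, Measure.restrict_univ]
      exact M.lintegral_density i⟩

/-- The generator of the two-state continuous-time Markov chain of world states. -/
def generator : Matrix WorldState WorldState ℝ :=
  Matrix.of fun i j => if i = j then - M.switch i else M.switch i

/-- `q_{i→j}(s)`, `j ≠ i`: the probability that the world is in state `j` a time `s` after being in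
state `i`, an entry of the transition matrix `exp (s Q)`. -/
def transitionProb (i : WorldState) (s : ℝ) : ℝ :=
  (NormedSpace.exp (s • M.generator)) i i.other

/-! ### The driver's process

We follow the driver from one decision epoch at which she is open to the next.  Open in state `i`,
she waits for whichever comes first, a request (after an `Exp(λ_i)` time) or a change of the world
state (after an `Exp(λ_{i→j})` time).  If the world changes first, she is open in state `j`.  If a
request of length `τ ∼ F_i` comes first and `τ ∉ σ_i`, she rejects it and is still open in state `i`
(by lack of memory both clocks start afresh).  If `τ ∈ σ_i`, she is busy for a time `τ`, is paid
`w_i(τ)` on completion, and is then open in state `j` with probability `q_{i→j}(τ)` and in state `i`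
otherwise.  The randomness of the `k`-th epoch in state `i` is the coordinate `(i, k)` of `Ω`, and
all coordinates are independent. -/

/-- The random inputs of one decision epoch: the request clock, the world clock, the length of the
request, and a uniform variable that decides the world state at the end of a trip. -/
abbrev Noise := ℝ × ℝ × ℝ × ℝ

/-- The joint law of the inputs of an epoch in state `i`. -/
def noiseLaw (i : WorldState) : Measure Noise :=
  (ProbabilityTheory.expMeasure (M.lam i)).prod
    ((ProbabilityTheory.expMeasure (M.switch i)).prod
      ((M.F i).prod (volume.restrict (Icc (0 : ℝ) 1))))

instance instIsProbabilityMeasureNoiseLaw (i : WorldState) :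
    IsProbabilityMeasure (M.noiseLaw i) := by
  have := ProbabilityTheory.isProbabilityMeasure_expMeasure (M.lam_pos i)
  have := ProbabilityTheory.isProbabilityMeasure_expMeasure (M.switch_pos i)
  have : IsProbabilityMeasure (volume.restrict (Icc (0 : ℝ) 1)) := ⟨by simp⟩
  unfold noiseLaw
  infer_instance

/-- The sample space. -/
abbrev Ω := WorldState × ℕ → Noise

/-- The probability measure on the sample space. -/
def P : Measure Ω := Measure.infinitePi fun p : WorldState × ℕ => M.noiseLaw p.1

open Classical in
/-- The time from an epoch in state `i` with inputs `z` to the next epoch. -/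
def epochLength (σ : Policy) (i : WorldState) (z : Noise) : ℝ :=
  if z.1 < z.2.1 then (if z.2.2.1 ∈ σ i then z.1 + z.2.2.1 else z.1) else z.2.1

open Classical in
/-- The payment collected between an epoch in state `i` with inputs `z` and the next epoch. -/
def epochPay (w : Pricing) (σ : Policy) (i : WorldState) (z : Noise) : ℝ :=
  if z.1 < z.2.1 ∧ z.2.2.1 ∈ σ i then w i z.2.2.1 else 0

open Classical in
/-- The world state at the epoch that follows an epoch in state `i` with inputs `z`. -/
def epochNext (σ : Policy) (i : WorldState) (z : Noise) : WorldState :=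
  if z.1 < z.2.1 then
    (if z.2.2.1 ∈ σ i ∧ z.2.2.2 < M.transitionProb i z.2.2.1 then i.other else i)
  else i.other

/-- The world state at the `n`-th epoch, with the numbers of earlier epochs in each state. -/
def driverState (σ : Policy) (ω : Ω) : ℕ → WorldState × (WorldState → ℕ)
  | 0 => (M.init, fun _ => 0)
  | n + 1 =>
    let s := driverState σ ω n
    (M.epochNext σ s.1 (ω (s.1, s.2 s.1)), Function.update s.2 s.1 (s.2 s.1 + 1))

/-- The world state at the `n`-th epoch. -/
def stateAt (σ : Policy) (ω : Ω) (n : ℕ) : WorldState := (M.driverState σ ω n).1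

/-- The random inputs used at the `n`-th epoch. -/
def noiseAt (σ : Policy) (ω : Ω) (n : ℕ) : Noise :=
  ω ((M.driverState σ ω n).1, (M.driverState σ ω n).2 (M.driverState σ ω n).1)

/-- The time of the `n`-th epoch. -/
def epochTime (σ : Policy) (ω : Ω) (n : ℕ) : ℝ :=
  ∑ k ∈ Finset.range n, epochLength σ (M.stateAt σ ω k) (M.noiseAt σ ω k)

open Classical in
/-- `R(w, σ, t)`: the total payment for trips completed by time `t`. -/
def earnings (w : Pricing) (σ : Policy) (t : ℝ) (ω : Ω) : ℝ :=
  ∑' n : ℕ, if M.epochTime σ ω (n + 1) ≤ t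
    then epochPay w σ (M.stateAt σ ω n) (M.noiseAt σ ω n) else 0

/-- `R(w, σ)`: the lifetime earnings rate `liminf R(w, σ, t) / t`, which is almost surely constant
(the expectation picks that constant). -/
def earningsRate (w : Pricing) (σ : Policy) : ℝ :=
  ∫ ω, liminf (fun t : ℝ => M.earnings w σ t ω / t) atTop ∂M.P

/-! ### Surge, optimality and the forms of policies -/

/-- `R_i(w_i, s) = W_i(s) / T_i(s)`: the earnings rate in the single-state model with primitives
`(λ_i, F_i, w_i)` and policy `s`.  Numerator and denominator are multiplied by `λ_i F_i(s)`, so that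
the rate of a policy that accepts nothing is `0`. -/
def stateRate (w : Pricing) (i : WorldState) (s : Set ℝ) : ℝ :=
  (M.lam i * ∫ τ in s, w i τ ∂M.F i) / (1 + M.lam i * ∫ τ in s, τ ∂M.F i)

/-- State 2 is the surge state: some policy in state 2 has a higher earnings rate than every policy
in state 1. -/
def IsSurge (w : Pricing) : Prop :=
  ∃ s₂ : Set ℝ, IsOpen s₂ ∧ s₂ ⊆ Ioi 0 ∧ ∀ s₁ : Set ℝ, IsOpen s₁ → s₁ ⊆ Ioi 0 →
    M.stateRate w .nonsurge s₁ < M.stateRate w .surge s₂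

/-- The standing assumptions on the pricing function. -/
def IsAdmissible (w : Pricing) : Prop :=
  (∀ i, ContinuousOn (w i) (Ioi 0)) ∧ (∀ i, Integrable (w i) (M.F i)) ∧ M.IsSurge w

/-- `σ` is an optimal policy of the driver. -/
def IsOptimal (w : Pricing) (σ : Policy) : Prop :=
  IsPolicy σ ∧ ∀ σ', IsPolicy σ' → M.earningsRate w σ' ≤ M.earningsRate w σ

/-- `w` is incentive compatible in state `i`: accepting every request in state `i` is optimal. -/
def IsICInState (w : Pricing) (i : WorldState) : Prop :=
  ∃ σ, M.IsOptimal w σ ∧ σ i = Ioi 0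

/-- The reward is increasing in every upper endpoint `u` (with `f_i(u) > 0`) of an interval of
`σ_i`, for all policies `σ`.  Here `σ i \ [v, u]` is `σ i` with the upper endpoint `u` moved down to
`v`, and the derivative is taken in `v ≤ u` at `v = u`, so that it exists also for endpoints that are
limits of further intervals of `σ_i`. -/
def UpperDerivPos (w : Pricing) (i : WorldState) : Prop :=
  ∀ σ, IsPolicy σ → ∀ l u : ℝ, 0 ≤ l → l < u → Ioo l u ⊆ σ i → u ∉ σ i → 0 < M.density i u →
    ∃ d : ℝ, 0 < d ∧ HasDerivWithinAt
      (fun v : ℝ => M.earningsRate w (Function.update σ i (σ i \ Icc v u))) d (Iic u) u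

end DynamicModel

/-- `p(τ) = m τ` with `m ≥ 0`. -/
def IsMultiplicative (p : ℝ → ℝ) : Prop := ∃ m : ℝ, 0 ≤ m ∧ ∀ τ, 0 < τ → p τ = m * τ

/-- `p(τ) = m τ + a` with `m ≥ 0`, `a > 0`. -/
def IsPositiveAffine (p : ℝ → ℝ) : Prop :=
  ∃ m a : ℝ, 0 ≤ m ∧ 0 < a ∧ ∀ τ, 0 < τ → p τ = m * τ + a

/-- `p(τ) = m τ - a` with `m ≥ 0`, `a > 0`. -/
def IsNegativeAffine (p : ℝ → ℝ) : Prop :=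
  ∃ m a : ℝ, 0 ≤ m ∧ 0 < a ∧ ∀ τ, 0 < τ → p τ = m * τ - a

/-- The interval `(a, b)` of trip lengths, for `a, b ∈ [0, ∞) ∪ {∞}`. -/
def tripInterval (a b : ℝ≥0∞) : Set ℝ :=
  {τ : ℝ | 0 < τ ∧ a < ENNReal.ofReal τ ∧ ENNReal.ofReal τ < b}

namespace DynamicModel

variable (M : DynamicModel)

/-- The set `s` has the form that the pricing prescribes for the non-surge state. -/
def NonsurgeForm (w : Pricing) (s : Set ℝ) : Prop :=
  ((IsMultiplicative (w .nonsurge) ∨ IsPositiveAffine (w .nonsurge)) →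
      ∃ t₁ : ℝ≥0∞, s = tripInterval 0 t₁) ∧
  (IsNegativeAffine (w .nonsurge) → ∃ t₂ t₃ : ℝ≥0∞, s = tripInterval t₂ t₃) ∧
  (M.UpperDerivPos w .nonsurge → s = Ioi 0)

/-- The set `s` has the form that the pricing prescribes for the surge state. -/
def SurgeForm (w : Pricing) (s : Set ℝ) : Prop :=
  ((IsMultiplicative (w .surge) ∨ IsNegativeAffine (w .surge)) →
      ∃ t₄ : ℝ≥0∞, t₄ ≠ ⊤ ∧ s = tripInterval t₄ ⊤) ∧
  (IsPositiveAffine (w .surge) →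
      ∃ t₅ t₆ : ℝ≥0∞, s = tripInterval 0 t₅ ∪ tripInterval t₆ ⊤) ∧
  (M.UpperDerivPos w .surge → s = Ioi 0)

/-- A setting in which both states have trip length densities that are positive on all of `(0, ∞)`
(so that every nonempty interval of trip lengths has positive probability), the pricing is
admissible, and there is an optimal policy. -/
def IsRegularSetting (w : Pricing) : Prop :=
  (∀ i τ, 0 < τ → 0 < M.density i τ) ∧ M.IsAdmissible w ∧ ∃ σ, M.IsOptimal w σ

end DynamicModel

end

/-!
Every earnings rate in the model is a ratio of expectations.  Along a trajectory, the inputs used in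
the epochs of state `i` are an i.i.d. sequence, so the strong law of large numbers applies to each of
the two sequences separately; as the world alternates, the numbers of switches in the two directions
differ by at most one, which forces the frequencies of the two states among the epochs
(`tendsto_visits`).  A renewal-reward argument (`tendsto_renewal_reward`) turns averages per epoch into
averages per unit of time, and with `T_i`, `W_i`, `Q_i` the rescaled expected duration, payment and
switching probability of an epoch in state `i`, the earnings rate is almost surely
`(Q_2 W_1 + Q_1 W_2) / (Q_2 T_1 + Q_1 T_2)` (`tendsto_earnings_meanRate`).

Optimality is certified by two numbers, a price `R` of time and an advantage `κ` of the surge state over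
the non-surge state: if the value `W_i - R T_i ± κ Q_i` of an epoch is at most `0` for all sets of
accepted trips and equals `0` for `σ_i`, in both states, then `σ` is optimal with rate `R`
(`Certifies.isOptimal`).  This value is an integral over `σ_i` of the gain
`w_i(τ) - R τ ± κ q_i(τ)` up to a constant, so it is largest when exactly the trips with a positive gain
are accepted; the two equations for `(R, κ)` that result have a solution by monotonicity and continuity
(`exists_isOptimal`).  Conversely every optimal policy has a certificate, with `κ > 0` by the surge
assumption (`IsOptimal.exists_certifies`), and hence accepts almost exactly the trips with positive gain
(`Certifies.ae_mem_iff`).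

Since `q_i` is a saturating exponential, the gain of an affine price is strictly concave in the
non-surge state and strictly convex in the surge state, and its sign at `0` is that of the constant in
the price.  This yields the forms of the sets of positive gain, and shows that break-even trips have
probability zero.  If all upper endpoints carry a positive derivative, the gain is positive wherever the
density is (`gain_pos_of_upperDerivPos`), because the derivative at an endpoint `u` cannot be
positive unless the gain at `u` is, computed for the rate and advantage of the policy at hand.

The settings with nontrivial thresholds have exponential trip lengths, for which the certificate
equations reduce to linear inequalities between `R` and `κ`.
-/

/-! ### Averages along the epochs of a single trajectory -/

theorem WorldState.sum_eq (f : WorldState → ℝ) : ∑ i, f i = f .nonsurge + f .surge :=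
  Finset.sum_pair (by decide)

/-- If `S k ~ p k`, then `S (N n) = p N n + o(n)` for any indices `N n ≤ n`, whether or not `N n`
tends to infinity. -/
theorem tendsto_sub_mul_div_of_le {S : ℕ → ℝ} {p : ℝ} (h0 : S 0 = 0)
    (hS : Tendsto (fun k : ℕ => S k / k) atTop (𝓝 p)) {N : ℕ → ℕ} (hN : ∀ n, N n ≤ n) :
    Tendsto (fun n : ℕ => (S (N n) - p * N n) / n) atTop (𝓝 0) := by
  rw [Metric.tendsto_atTop]
  intro ε hε
  rw [Metric.tendsto_atTop] at hS
  obtain ⟨K, hK⟩ := hS (ε / 2) (by positivity)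
  -- finitely many indices below `K` contribute a constant `C`
  set C := ∑ k ∈ Finset.range K, |S k - p * k| with hC
  have hC0 : 0 ≤ C := Finset.sum_nonneg fun _ _ => abs_nonneg _
  have key : ∀ k : ℕ, |S k - p * k| ≤ ε / 2 * k + C := by
    intro k
    rcases lt_or_ge k K with hk | hk
    · have : |S k - p * k| ≤ C :=
        Finset.single_le_sum (f := fun k : ℕ => |S k - p * k|) (fun _ _ => abs_nonneg _)
          (Finset.mem_range.2 hk)
      have : 0 ≤ ε / 2 * (k : ℝ) := by positivity
      linarith
    · rcases Nat.eq_zero_or_pos k with rfl | hk0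
      · simp [h0, hC0]
      · have hk' : (0 : ℝ) < k := by exact_mod_cast hk0
        have h1 := (hK k hk).le
        rw [Real.dist_eq] at h1
        have h2 : S k - p * k = (S k / k - p) * k := by field_simp
        rw [h2, abs_mul, abs_of_pos hk']
        nlinarith
  obtain ⟨n₀, hn₀⟩ := exists_nat_gt (2 * C / ε)
  refine ⟨n₀ + 1, fun n hn => ?_⟩
  have hn1 : (n₀ : ℝ) + 1 ≤ n := by exact_mod_cast hn
  have hnpos : (0 : ℝ) < n := by have : (0:ℝ) ≤ n₀ := Nat.cast_nonneg _; linarith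
  have h3 : 2 * C < ε * n := by
    rw [div_lt_iff₀ hε] at hn₀
    nlinarith
  have hNn : (N n : ℝ) ≤ n := by exact_mod_cast hN n
  rw [Real.dist_eq, sub_zero, abs_div, abs_of_pos hnpos, div_lt_iff₀ hnpos]
  have := key (N n)
  nlinarith

/-- A deterministic renewal-reward theorem: if the `n`-th renewal happens at time `T n ~ μ n` and the
first `n` rewards add up to `∑ x ~ r n`, then the rewards collected by time `t` are `~ (r / μ) t`. -/
theorem tendsto_renewal_reward {T x : ℕ → ℝ} {μ r : ℝ} (hT0 : T 0 = 0) (hT : Monotone T)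
    (hμ : 0 < μ) (hTlim : Tendsto (fun n : ℕ => T n / n) atTop (𝓝 μ))
    (hx : Tendsto (fun n : ℕ => (∑ k ∈ Finset.range n, x k) / n) atTop (𝓝 r)) :
    Tendsto (fun t : ℝ => (∑' n : ℕ, open Classical in if T (n + 1) ≤ t then x n else 0) / t)
      atTop (𝓝 (r / μ)) := by
  classical
  have hTtop : Tendsto T atTop atTop := by
    have h1 : Tendsto (fun n : ℕ => T n / n * n) atTop atTop :=
      hTlim.pos_mul_atTop hμ tendsto_natCast_atTop_atTop
    refine h1.congr' ?_
    filter_upwards [eventually_gt_atTop 0] with n hn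
    have : (n : ℝ) ≠ 0 := by positivity
    field_simp
  have hex : ∀ t, ∃ n, t < T (n + 1) := fun t =>
    (((tendsto_add_atTop_iff_nat 1).2 hTtop).eventually_gt_atTop t).exists
  -- `N t` renewals have happened by time `t`
  let N : ℝ → ℕ := fun t => Nat.find (hex t)
  have hlt : ∀ t, t < T (N t + 1) := fun t => Nat.find_spec (hex t)
  have hmem : ∀ t n, T (n + 1) ≤ t ↔ n < N t := by
    intro t n
    constructor
    · intro h
      by_contra hc
      have := hT (show N t + 1 ≤ n + 1 by omega)
      linarith [hlt t]
    · intro h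
      exact not_lt.1 (Nat.find_min (hex t) h)
  have hsum : ∀ t, (∑' n : ℕ, if T (n + 1) ≤ t then x n else 0) = ∑ k ∈ Finset.range (N t), x k := by
    intro t
    rw [tsum_eq_sum (s := Finset.range (N t))]
    · exact Finset.sum_congr rfl fun k hk => if_pos ((hmem t k).2 (Finset.mem_range.1 hk))
    · intro k hk
      exact if_neg fun h => hk (Finset.mem_range.2 ((hmem t k).1 h))
  have hle : ∀ t, 0 ≤ t → T (N t) ≤ t := by
    intro t ht
    rcases Nat.eq_zero_or_pos (N t) with h | h
    · rw [h, hT0]; exact ht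
    · have := (hmem t (N t - 1)).2 (by omega)
      rwa [Nat.sub_add_cancel h] at this
  have hNtop : Tendsto N atTop atTop := by
    refine tendsto_atTop.2 fun m => ?_
    filter_upwards [eventually_ge_atTop (T (m + 1))] with t ht
    exact ((hmem t m).1 ht).le
  have hN1 : Tendsto (fun t : ℝ => T (N t) / N t) atTop (𝓝 μ) := hTlim.comp hNtop
  have hN2 : Tendsto (fun t : ℝ => T (N t + 1) / N t) atTop (𝓝 μ) := by
    have h1 : Tendsto (fun n : ℕ => T (n + 1) / ((n + 1 : ℕ) : ℝ) * (((n + 1 : ℕ) : ℝ) / n)) atTop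
        (𝓝 (μ * 1)) := by
      refine ((tendsto_add_atTop_iff_nat 1).2 hTlim).mul ?_
      have h2 : Tendsto (fun n : ℕ => 1 + 1 / (n : ℝ)) atTop (𝓝 (1 + 0)) :=
        tendsto_const_nhds.add tendsto_one_div_atTop_nhds_zero_nat
      rw [add_zero] at h2
      refine h2.congr' ?_
      filter_upwards [eventually_gt_atTop 0] with n hn
      have : (n : ℝ) ≠ 0 := by positivity
      push_cast
      field_simp
    rw [mul_one] at h1
    have h3 : Tendsto (fun n : ℕ => T (n + 1) / (n : ℝ)) atTop (𝓝 μ) := by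
      refine h1.congr' ?_
      filter_upwards [eventually_gt_atTop 0] with n hn
      have : (n : ℝ) ≠ 0 := by positivity
      push_cast
      field_simp
    exact h3.comp hNtop
  have hNt : Tendsto (fun t : ℝ => t / N t) atTop (𝓝 μ) := by
    refine tendsto_of_tendsto_of_tendsto_of_le_of_le' hN1 hN2 ?_ ?_
    · filter_upwards [eventually_ge_atTop 0] with t ht
      exact div_le_div_of_nonneg_right (hle t ht) (by positivity)
    · filter_upwards with t
      exact div_le_div_of_nonneg_right (hlt t).le (by positivity)
  have hfin := (hx.comp hNtop).div hNt hμ.ne'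
  refine hfin.congr' ?_
  filter_upwards [hNtop.eventually_gt_atTop 0] with t ht
  have : (N t : ℝ) ≠ 0 := by positivity
  simp only [Pi.div_apply, Function.comp]
  rw [hsum t]
  exact div_div_div_cancel_right₀ this _ _

namespace DynamicModel

variable (M : DynamicModel)

/-- The number of epochs in state `i` among the first `n`. -/
noncomputable def visits (σ : Policy) (ω : Ω) (n : ℕ) (i : WorldState) : ℕ :=
  (M.driverState σ ω n).2 i

theorem visits_add (σ : Policy) (ω : Ω) (n : ℕ) :
    M.visits σ ω n .nonsurge + M.visits σ ω n .surge = n := by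
  induction n with
  | zero => rfl
  | succ n ih =>
    simp only [visits, driverState] at ih ⊢
    cases (M.driverState σ ω n).1 <;> simp <;> omega

theorem visits_le (σ : Policy) (ω : Ω) (n : ℕ) (i : WorldState) : M.visits σ ω n i ≤ n := by
  have := M.visits_add σ ω n
  cases i <;> omega

/-- A sum along the epochs splits into sums over the independent inputs attached to each state. -/
theorem sum_noiseAt (h : WorldState → Noise → ℝ) (σ : Policy) (ω : Ω) (n : ℕ) :
    ∑ k ∈ Finset.range n, h (M.stateAt σ ω k) (M.noiseAt σ ω k) =
      ∑ i, ∑ k ∈ Finset.range (M.visits σ ω n i), h i (ω (i, k)) := by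
  rw [WorldState.sum_eq]
  induction n with
  | zero => simp [visits, driverState]
  | succ n ih =>
    rw [Finset.sum_range_succ, ih]
    simp only [visits, driverState, stateAt, noiseAt]
    cases (M.driverState σ ω n).1 <;> simp [Finset.sum_range_succ] <;> ring

/-- The change, over an epoch in state `i`, of the indicator of being in the surge state. -/
noncomputable def surgeJump (σ : Policy) (i : WorldState) (z : Noise) : ℝ :=
  (if M.epochNext σ i z = .surge then 1 else 0) - (if i = .surge then 1 else 0)

theorem abs_sum_surgeJump_le (σ : Policy) (ω : Ω) (n : ℕ) :
    |∑ k ∈ Finset.range n, M.surgeJump σ (M.stateAt σ ω k) (M.noiseAt σ ω k)| ≤ 1 := by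
  have h : ∑ k ∈ Finset.range n, M.surgeJump σ (M.stateAt σ ω k) (M.noiseAt σ ω k) =
      (if M.stateAt σ ω n = .surge then 1 else 0) - (if M.stateAt σ ω 0 = .surge then 1 else 0) := by
    rw [← Finset.sum_range_sub (fun k => if M.stateAt σ ω k = .surge then (1 : ℝ) else 0)]
    rfl
  rw [h]
  split_ifs <;> simp

/-- The fraction of epochs spent in each state.  As the world alternates, there are as many switches
into the surge state as out of it, up to one, so the numbers of epochs in the two states are inversely
proportional to the switching frequencies `p`, `p'`. -/
theorem tendsto_visits (σ : Policy) (ω : Ω) {p p' : ℝ} (hp : 0 < p) (hp' : 0 < p')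
    (h : Tendsto (fun n : ℕ => (∑ k ∈ Finset.range n, M.surgeJump σ .nonsurge (ω (.nonsurge, k))) / n)
      atTop (𝓝 p))
    (h' : Tendsto (fun n : ℕ => (∑ k ∈ Finset.range n, M.surgeJump σ .surge (ω (.surge, k))) / n)
      atTop (𝓝 (-p'))) :
    Tendsto (fun n : ℕ => (M.visits σ ω n .nonsurge : ℝ) / n) atTop (𝓝 (p' / (p + p'))) ∧
    Tendsto (fun n : ℕ => (M.visits σ ω n .surge : ℝ) / n) atTop (𝓝 (p / (p + p'))) := by
  have e := tendsto_sub_mul_div_of_le (by simp) h (fun n => M.visits_le σ ω n .nonsurge)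
  have e' := tendsto_sub_mul_div_of_le (by simp) h' (fun n => M.visits_le σ ω n .surge)
  have hJ : Tendsto (fun n : ℕ =>
      (∑ k ∈ Finset.range n, M.surgeJump σ (M.stateAt σ ω k) (M.noiseAt σ ω k)) / n)
      atTop (𝓝 0) := by
    refine squeeze_zero_norm (fun n => ?_) tendsto_one_div_atTop_nhds_zero_nat
    rw [norm_div, Real.norm_eq_abs, Real.norm_natCast]
    exact div_le_div_of_nonneg_right (M.abs_sum_surgeJump_le σ ω n) (by positivity)
  have hd := (hJ.sub e).sub e'
  simp only [M.sum_noiseAt, WorldState.sum_eq] at hd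
  have hpp : p + p' ≠ 0 := by positivity
  have hN : Tendsto (fun n : ℕ => (M.visits σ ω n .nonsurge : ℝ) / n) atTop (𝓝 (p' / (p + p'))) := by
    have := (hd.add_const p').div_const (p + p')
    simp only [sub_zero, zero_add] at this
    refine this.congr' ?_
    filter_upwards [eventually_gt_atTop 0] with n hn
    have hn' : (n : ℝ) ≠ 0 := by positivity
    have hv : (M.visits σ ω n .surge : ℝ) = n - M.visits σ ω n .nonsurge := by
      rw [eq_sub_iff_add_eq']; exact_mod_cast M.visits_add σ ω n
    rw [hv]
    field_simp
    ring
  refine ⟨hN, ?_⟩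
  have := hN.const_sub 1
  have h1 : 1 - p' / (p + p') = p / (p + p') := by field_simp; ring
  rw [h1] at this
  refine this.congr' ?_
  filter_upwards [eventually_gt_atTop 0] with n hn
  have hn' : (n : ℝ) ≠ 0 := by positivity
  have hv : (M.visits σ ω n .surge : ℝ) = n - M.visits σ ω n .nonsurge := by
    rw [eq_sub_iff_add_eq']; exact_mod_cast M.visits_add σ ω n
  rw [hv]
  field_simp

/-- Averages along the epochs converge to the mixture of the averages of the inputs of each state. -/
theorem tendsto_average {h : WorldState → Noise → ℝ} {σ : Policy} {ω : Ω} {π m : WorldState → ℝ}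
    (hπ : ∀ i, Tendsto (fun n : ℕ => (M.visits σ ω n i : ℝ) / n) atTop (𝓝 (π i)))
    (hm : ∀ i, Tendsto (fun n : ℕ => (∑ k ∈ Finset.range n, h i (ω (i, k))) / n) atTop (𝓝 (m i))) :
    Tendsto (fun n : ℕ => (∑ k ∈ Finset.range n, h (M.stateAt σ ω k) (M.noiseAt σ ω k)) / n) atTop
      (𝓝 (π .nonsurge * m .nonsurge + π .surge * m .surge)) := by
  have key : ∀ i, Tendsto (fun n : ℕ =>
      (∑ k ∈ Finset.range (M.visits σ ω n i), h i (ω (i, k))) / n) atTop (𝓝 (π i * m i)) := by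
    intro i
    have e := tendsto_sub_mul_div_of_le (by simp) (hm i) (fun n => M.visits_le σ ω n i)
    have := e.add ((hπ i).mul_const (m i))
    rw [zero_add] at this
    refine this.congr fun n => ?_
    ring
  have := (key .nonsurge).add (key .surge)
  refine this.congr fun n => ?_
  rw [M.sum_noiseAt, WorldState.sum_eq, add_div]

end DynamicModel

/-! ### Exponential clocks -/

theorem expMeasure_Ioi {r : ℝ} (hr : 0 < r) {x : ℝ} (hx : 0 ≤ x) :
    ProbabilityTheory.expMeasure r (Ioi x) = ENNReal.ofReal (Real.exp (-(r * x))) := by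
  have := ProbabilityTheory.isProbabilityMeasure_expMeasure hr
  have h := ProbabilityTheory.cdf_expMeasure_eq hr x
  rw [ProbabilityTheory.cdf_eq_real, if_pos hx] at h
  rw [← compl_Iic, ← ENNReal.ofReal_toReal (measure_ne_top _ _), ← measureReal_def,
    probReal_compl_eq_one_sub measurableSet_Iic, h]
  congr 1
  ring

theorem expMeasure_ae_nonneg {r : ℝ} (hr : 0 < r) :
    ∀ᵐ x ∂ProbabilityTheory.expMeasure r, 0 ≤ x := by
  have := ProbabilityTheory.isProbabilityMeasure_expMeasure hr
  have h := expMeasure_Ioi hr le_rfl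
  rw [mul_zero, neg_zero, Real.exp_zero, ENNReal.ofReal_one] at h
  have h' : ∀ᵐ x ∂ProbabilityTheory.expMeasure r, x ∈ Ioi (0 : ℝ) := by
    rwa [← prob_compl_eq_zero_iff measurableSet_Ioi] at h
  filter_upwards [h'] with x hx
  exact le_of_lt hx

/-- The Laplace transform of the exponential distribution. -/
theorem lintegral_exp_neg_expMeasure {r s : ℝ} (hr : 0 < r) (hs : 0 < s) :
    ∫⁻ x, ENNReal.ofReal (Real.exp (-(s * x))) ∂ProbabilityTheory.expMeasure r =
      ENNReal.ofReal (r / (r + s)) := by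
  have h0 : ProbabilityTheory.expMeasure r =
      volume.withDensity (ProbabilityTheory.exponentialPDF r) := rfl
  have hm : ∀ r, Measurable (ProbabilityTheory.exponentialPDF r) := fun r =>
    (ProbabilityTheory.measurable_exponentialPDFReal r).ennreal_ofReal
  rw [h0, lintegral_withDensity_eq_lintegral_mul _ (hm r) (by fun_prop)]
  -- tilting the density of rate `r` by `exp (-s x)` gives a multiple of the density of rate `r + s`
  have h1 : ∀ x, (ProbabilityTheory.exponentialPDF r *
      fun x => ENNReal.ofReal (Real.exp (-(s * x)))) x =
      ENNReal.ofReal (r / (r + s)) * ProbabilityTheory.exponentialPDF (r + s) x := by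
    intro x
    simp only [Pi.mul_apply, ProbabilityTheory.exponentialPDF_eq]
    split_ifs with hx
    · rw [← ENNReal.ofReal_mul (by positivity), ← ENNReal.ofReal_mul (by positivity)]
      congr 1
      rw [show -((r + s) * x) = -(r * x) + -(s * x) by ring, Real.exp_add]
      field_simp
    · simp
  rw [lintegral_congr h1, lintegral_const_mul _ (hm _),
    ProbabilityTheory.lintegral_exponentialPDF_eq_one (by positivity), mul_one]

/-- Which of two independent exponential clocks rings first. -/
theorem expMeasure_prod_lt {r s : ℝ} (hr : 0 < r) (hs : 0 < s) :
    ((ProbabilityTheory.expMeasure r).prod (ProbabilityTheory.expMeasure s))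
      {p : ℝ × ℝ | p.1 < p.2} = ENNReal.ofReal (r / (r + s)) := by
  have := ProbabilityTheory.isProbabilityMeasure_expMeasure hr
  have := ProbabilityTheory.isProbabilityMeasure_expMeasure hs
  rw [Measure.prod_apply (measurableSet_lt measurable_fst measurable_snd),
    ← lintegral_exp_neg_expMeasure hr hs]
  refine lintegral_congr_ae ?_
  filter_upwards [expMeasure_ae_nonneg hr] with x hx
  exact expMeasure_Ioi hs hx

theorem lintegral_min_expMeasure {r s : ℝ} (hr : 0 < r) (hs : 0 < s) :
    ∫⁻ p, ENNReal.ofReal (min p.1 p.2)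
      ∂((ProbabilityTheory.expMeasure r).prod (ProbabilityTheory.expMeasure s)) =
      ENNReal.ofReal (1 / (r + s)) := by
  have := ProbabilityTheory.isProbabilityMeasure_expMeasure hr
  have := ProbabilityTheory.isProbabilityMeasure_expMeasure hs
  have h0 : 0 ≤ᵐ[(ProbabilityTheory.expMeasure r).prod (ProbabilityTheory.expMeasure s)]
      fun p => min p.1 p.2 := by
    have h1 := Measure.quasiMeasurePreserving_fst
      (μ := ProbabilityTheory.expMeasure r) (ν := ProbabilityTheory.expMeasure s)
    have h2 := Measure.quasiMeasurePreserving_snd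
      (μ := ProbabilityTheory.expMeasure r) (ν := ProbabilityTheory.expMeasure s)
    filter_upwards [h1.ae (expMeasure_ae_nonneg hr), h2.ae (expMeasure_ae_nonneg hs)] with p h3 h4
    exact le_min h3 h4
  rw [lintegral_eq_lintegral_meas_lt _ h0 (by fun_prop)]
  have h1 : ∀ t ∈ Ioi (0 : ℝ),
      ((ProbabilityTheory.expMeasure r).prod (ProbabilityTheory.expMeasure s))
        {p : ℝ × ℝ | t < min p.1 p.2} = ENNReal.ofReal (Real.exp (-(r + s) * t)) := by
    intro t ht
    have h2 : {p : ℝ × ℝ | t < min p.1 p.2} = Ioi t ×ˢ Ioi t := by ext p; simp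
    rw [h2, Measure.prod_prod, expMeasure_Ioi hr (le_of_lt ht), expMeasure_Ioi hs (le_of_lt ht),
      ← ENNReal.ofReal_mul (by positivity), ← Real.exp_add]
    congr 2
    ring
  rw [setLIntegral_congr_fun measurableSet_Ioi h1,
    ← ofReal_integral_eq_lintegral_ofReal (exp_neg_integrableOn_Ioi 0 (by positivity))
      (ae_of_all _ fun _ => (Real.exp_pos _).le), integral_exp_mul_Ioi (by linarith)]
  congr 1
  rw [mul_zero, Real.exp_zero, neg_div_neg_eq]

namespace DynamicModel

variable (M : DynamicModel)

/-! ### The transition probabilities and the trip length distributions -/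

/-- `q_{i→j}(τ)` in closed form: the generator has eigenvalues `0` and minus the total rate. -/
theorem transitionProb_eq (i : WorldState) (τ : ℝ) :
    M.transitionProb i τ = M.switch i / (M.switch .nonsurge + M.switch .surge) *
      (1 - Real.exp (-((M.switch .nonsurge + M.switch .surge) * τ))) := by
  have ha := M.switch_pos .nonsurge
  have hb := M.switch_pos .surge
  set a := M.switch .nonsurge with ha'
  set b := M.switch .surge with hb'
  have hab : a + b ≠ 0 := by positivity
  let A : Matrix WorldState WorldState ℝ := Matrix.of fun i j =>
    match i, j with
    | _, .nonsurge => 1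
    | .nonsurge, .surge => a
    | .surge, .surge => -b
  let B : Matrix WorldState WorldState ℝ := Matrix.of fun i j =>
    match i, j with
    | .nonsurge, .nonsurge => b / (a + b)
    | .nonsurge, .surge => a / (a + b)
    | .surge, .nonsurge => 1 / (a + b)
    | .surge, .surge => -1 / (a + b)
  have hAB : A * B = 1 := by
    ext i j
    rw [Matrix.mul_apply, WorldState.sum_eq]
    cases i <;> cases j <;> simp [A, B] <;> field_simp <;> ring
  have hBA : B * A = 1 := mul_eq_one_comm.1 hAB
  let U : (Matrix WorldState WorldState ℝ)ˣ := ⟨A, B, hAB, hBA⟩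
  let d : WorldState → ℝ := fun i => match i with
    | .nonsurge => 0
    | .surge => -((a + b) * τ)
  have hQ : τ • M.generator = (U : Matrix WorldState WorldState ℝ) * Matrix.diagonal d *
      ((U⁻¹ : (Matrix WorldState WorldState ℝ)ˣ) : Matrix WorldState WorldState ℝ) := by
    change _ = A * Matrix.diagonal d * B
    ext i j
    rw [Matrix.mul_apply, WorldState.sum_eq]
    cases i <;> cases j <;>
      simp [A, B, d, generator, Matrix.mul_diagonal, ← ha', ← hb'] <;> field_simp
  rw [transitionProb, hQ, Matrix.exp_units_conj, Matrix.exp_diagonal]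
  change (A * Matrix.diagonal (NormedSpace.exp d) * B) i i.other = _
  rw [Matrix.mul_apply, WorldState.sum_eq]
  simp only [Matrix.mul_diagonal, Pi.coe_exp, ← Real.exp_eq_exp_ℝ]
  cases i <;> simp [A, B, d, WorldState.other, ← ha', ← hb'] <;> field_simp <;> ring

theorem continuous_transitionProb (i : WorldState) : Continuous (M.transitionProb i) := by
  rw [funext (M.transitionProb_eq i)]
  fun_prop

theorem transitionProb_nonneg (i : WorldState) {τ : ℝ} (hτ : 0 ≤ τ) :
    0 ≤ M.transitionProb i τ := by
  have ha := M.switch_pos .nonsurge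
  have hb := M.switch_pos .surge
  have hi := M.switch_pos i
  rw [transitionProb_eq]
  have : Real.exp (-((M.switch .nonsurge + M.switch .surge) * τ)) ≤ 1 :=
    Real.exp_le_one_iff.2 (by rw [neg_nonpos]; positivity)
  have : 0 ≤ 1 - Real.exp (-((M.switch .nonsurge + M.switch .surge) * τ)) := by linarith
  positivity

theorem transitionProb_le_one (i : WorldState) (τ : ℝ) : M.transitionProb i τ ≤ 1 := by
  have ha := M.switch_pos .nonsurge
  have hb := M.switch_pos .surge
  rw [transitionProb_eq]
  have h1 := Real.exp_pos (-((M.switch .nonsurge + M.switch .surge) * τ))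
  have h2 : M.switch i / (M.switch .nonsurge + M.switch .surge) ≤ 1 := by
    rw [div_le_one (by positivity)]
    cases i <;> linarith
  have h3 : 0 ≤ M.switch i / (M.switch .nonsurge + M.switch .surge) := by
    have := M.switch_pos i
    positivity
  nlinarith

theorem F_absolutelyContinuous (i : WorldState) : M.F i ≪ volume :=
  withDensity_absolutelyContinuous _ _

theorem F_ae_density_pos (i : WorldState) : ∀ᵐ τ ∂M.F i, 0 < M.density i τ := by
  have h := ae_withDensity_iff (μ := volume) (p := fun τ => 0 < M.density i τ)
    ((M.density_measurable i).ennreal_ofReal)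
  refine h.2 (ae_of_all _ fun τ hτ => ?_)
  simpa using hτ

theorem F_ae_pos (i : WorldState) : ∀ᵐ τ ∂M.F i, 0 < τ := by
  filter_upwards [M.F_ae_density_pos i] with τ h
  by_contra hc
  exact h.ne' (M.density_eq_zero i τ (not_lt.1 hc))

theorem integrable_F_iff (i : WorldState) {g : ℝ → ℝ} :
    Integrable g (M.F i) ↔ Integrable (fun τ => g τ * M.density i τ) volume := by
  rw [F, integrable_withDensity_iff (M.density_measurable i).ennreal_ofReal
    (ae_of_all _ fun _ => ENNReal.ofReal_lt_top)]
  simp [ENNReal.toReal_ofReal (M.density_nonneg i _)]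

theorem integral_F (i : WorldState) (g : ℝ → ℝ) :
    ∫ τ, g τ ∂M.F i = ∫ τ, g τ * M.density i τ := by
  rw [F, integral_withDensity_eq_integral_toReal_smul (M.density_measurable i).ennreal_ofReal
    (ae_of_all _ fun _ => ENNReal.ofReal_lt_top)]
  simp [ENNReal.toReal_ofReal (M.density_nonneg i _), mul_comm]

theorem integrable_id_F (i : WorldState) : Integrable (fun τ : ℝ => τ) (M.F i) :=
  (M.integrable_F_iff i).2 (M.integrable_length i)

theorem setIntegral_F_Ioi (i : WorldState) (g : ℝ → ℝ) :
    ∫ τ in Ioi 0, g τ ∂M.F i = ∫ τ, g τ ∂M.F i := by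
  have h : ∀ᵐ τ ∂M.F i, τ ∈ Ioi (0 : ℝ) := M.F_ae_pos i
  rw [Measure.restrict_eq_self_of_ae_mem h]

theorem volume_eq_zero_of_F {i : WorldState} (hpos : ∀ τ, 0 < τ → 0 < M.density i τ) {s : Set ℝ}
    (hs : s ⊆ Ioi 0) (h : M.F i s = 0) : volume s = 0 := by
  rw [F, withDensity_apply_eq_zero (M.density_measurable i).ennreal_ofReal] at h
  refine measure_mono_null (fun τ hτ => mem_inter ?_ hτ) h
  simpa using hpos τ (hs hτ)

theorem integrable_transitionProb (i : WorldState) : Integrable (M.transitionProb i) (M.F i) := by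
  refine Integrable.of_bound (M.continuous_transitionProb i).aestronglyMeasurable 1 ?_
  filter_upwards [M.F_ae_pos i] with τ hτ
  rw [Real.norm_eq_abs, abs_le]
  have := M.transitionProb_nonneg i hτ.le
  have := M.transitionProb_le_one i τ
  constructor <;> linarith

/-! ### Expected time, payment and switching probability of an epoch -/

/-- `T_i(s)`: the expected length of an epoch in state `i`, times `λ_i + λ_{i→j}`. -/
noncomputable def meanTime (i : WorldState) (s : Set ℝ) : ℝ :=
  1 + M.lam i * ∫ τ in s, τ ∂M.F i

/-- `W_i(s)`: the expected payment of an epoch in state `i`, times `λ_i + λ_{i→j}`. -/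
noncomputable def meanPay (w : Pricing) (i : WorldState) (s : Set ℝ) : ℝ :=
  M.lam i * ∫ τ in s, w i τ ∂M.F i

/-- `Q_i(s)`: the probability that an epoch in state `i` ends in the other state, times
`λ_i + λ_{i→j}`. -/
noncomputable def meanSwitch (i : WorldState) (s : Set ℝ) : ℝ :=
  M.switch i + M.lam i * ∫ τ in s, M.transitionProb i τ ∂M.F i

theorem one_le_meanTime (i : WorldState) {s : Set ℝ} (hs : MeasurableSet s) (h0 : s ⊆ Ioi 0) :
    1 ≤ M.meanTime i s := by
  have h : 0 ≤ ∫ τ in s, τ ∂M.F i := setIntegral_nonneg hs fun τ hτ => le_of_lt (h0 hτ)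
  have := mul_nonneg (M.lam_pos i).le h
  rw [meanTime]
  linarith

theorem meanTime_pos (i : WorldState) {s : Set ℝ} (hs : MeasurableSet s) (h0 : s ⊆ Ioi 0) :
    0 < M.meanTime i s :=
  one_pos.trans_le (M.one_le_meanTime i hs h0)

theorem meanSwitch_pos (i : WorldState) {s : Set ℝ} (hs : MeasurableSet s)
    (h0 : s ⊆ Ioi 0) : 0 < M.meanSwitch i s := by
  have h : 0 ≤ ∫ τ in s, M.transitionProb i τ ∂M.F i :=
    setIntegral_nonneg hs fun τ hτ => M.transitionProb_nonneg i (le_of_lt (h0 hτ))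
  have := mul_nonneg (M.lam_pos i).le h
  have := M.switch_pos i
  rw [meanSwitch]
  linarith

/-- The two clocks of an epoch are independent of the length and the destination of the trip. -/
theorem noiseLaw_integral_mul (i : WorldState) (f g : ℝ × ℝ → ℝ) :
    ∫ z, f (z.1, z.2.1) * g z.2.2 ∂M.noiseLaw i =
      (∫ p, f p ∂((ProbabilityTheory.expMeasure (M.lam i)).prod
        (ProbabilityTheory.expMeasure (M.switch i)))) *
      ∫ p, g p ∂((M.F i).prod (volume.restrict (Icc (0 : ℝ) 1))) := by
  have := ProbabilityTheory.isProbabilityMeasure_expMeasure (M.lam_pos i)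
  have := ProbabilityTheory.isProbabilityMeasure_expMeasure (M.switch_pos i)
  rw [← integral_prod_mul, noiseLaw, ← (measurePreserving_prodAssoc _ _ _).integral_comp']
  rfl

theorem noiseLaw_integrable_mul (i : WorldState) {f g : ℝ × ℝ → ℝ}
    (hf : Integrable f ((ProbabilityTheory.expMeasure (M.lam i)).prod
        (ProbabilityTheory.expMeasure (M.switch i))))
    (hg : Integrable g ((M.F i).prod (volume.restrict (Icc (0 : ℝ) 1)))) :
    Integrable (fun z : Noise => f (z.1, z.2.1) * g z.2.2) (M.noiseLaw i) := by
  have := ProbabilityTheory.isProbabilityMeasure_expMeasure (M.lam_pos i)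
  have := ProbabilityTheory.isProbabilityMeasure_expMeasure (M.switch_pos i)
  rw [noiseLaw, ← (measurePreserving_prodAssoc _ _ _).integrable_comp_emb
    MeasurableEquiv.prodAssoc.measurableEmbedding]
  exact hf.mul_prod hg

theorem noiseLaw_ae_nonneg (i : WorldState) : ∀ᵐ z ∂M.noiseLaw i, 0 ≤ z.1 ∧ 0 ≤ z.2.1 := by
  have := ProbabilityTheory.isProbabilityMeasure_expMeasure (M.lam_pos i)
  have := ProbabilityTheory.isProbabilityMeasure_expMeasure (M.switch_pos i)
  rw [noiseLaw]
  have h1 := (Measure.quasiMeasurePreserving_fst (μ := ProbabilityTheory.expMeasure (M.lam i))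
    (ν := (ProbabilityTheory.expMeasure (M.switch i)).prod
      ((M.F i).prod (volume.restrict (Icc (0 : ℝ) 1))))).ae
      (expMeasure_ae_nonneg (M.lam_pos i))
  have h2 := (Measure.quasiMeasurePreserving_snd (μ := ProbabilityTheory.expMeasure (M.lam i))
    (ν := (ProbabilityTheory.expMeasure (M.switch i)).prod
      ((M.F i).prod (volume.restrict (Icc (0 : ℝ) 1))))).ae
      ((Measure.quasiMeasurePreserving_fst (μ := ProbabilityTheory.expMeasure (M.switch i))
        (ν := (M.F i).prod (volume.restrict (Icc (0 : ℝ) 1)))).ae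
        (expMeasure_ae_nonneg (M.switch_pos i)))
  filter_upwards [h1, h2] with z h3 h4 using ⟨h3, h4⟩

/-- The indicator of the event that the request comes before the change of the world state. -/
noncomputable def requestFirst : ℝ × ℝ → ℝ := indicator {p | p.1 < p.2} 1

theorem measurable_requestFirst : Measurable requestFirst :=
  measurable_const.indicator (measurableSet_lt measurable_fst measurable_snd)

theorem integrable_requestFirst (i : WorldState) :
    Integrable requestFirst ((ProbabilityTheory.expMeasure (M.lam i)).prod
        (ProbabilityTheory.expMeasure (M.switch i))) := by
  have := ProbabilityTheory.isProbabilityMeasure_expMeasure (M.lam_pos i)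
  have := ProbabilityTheory.isProbabilityMeasure_expMeasure (M.switch_pos i)
  exact (integrable_const (1 : ℝ)).indicator (measurableSet_lt measurable_fst measurable_snd)

theorem integral_requestFirst (i : WorldState) :
    ∫ p, requestFirst p ∂((ProbabilityTheory.expMeasure (M.lam i)).prod
        (ProbabilityTheory.expMeasure (M.switch i))) = M.lam i / (M.lam i + M.switch i) := by
  have h1 := M.lam_pos i
  have h2 := M.switch_pos i
  rw [requestFirst, integral_indicator_one (measurableSet_lt measurable_fst measurable_snd),
    measureReal_def, expMeasure_prod_lt h1 h2, ENNReal.toReal_ofReal (by positivity)]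

theorem integrable_min_clocks (i : WorldState) :
    Integrable (fun p : ℝ × ℝ => min p.1 p.2) ((ProbabilityTheory.expMeasure (M.lam i)).prod
        (ProbabilityTheory.expMeasure (M.switch i))) ∧
    ∫ p, min p.1 p.2 ∂((ProbabilityTheory.expMeasure (M.lam i)).prod
        (ProbabilityTheory.expMeasure (M.switch i))) = 1 / (M.lam i + M.switch i) := by
  have h1 := M.lam_pos i
  have h2 := M.switch_pos i
  have := ProbabilityTheory.isProbabilityMeasure_expMeasure h1
  have := ProbabilityTheory.isProbabilityMeasure_expMeasure h2
  have h0 : 0 ≤ᵐ[(ProbabilityTheory.expMeasure (M.lam i)).prod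
      (ProbabilityTheory.expMeasure (M.switch i))] fun p => min p.1 p.2 := by
    filter_upwards [Measure.quasiMeasurePreserving_fst.ae (expMeasure_ae_nonneg h1),
      Measure.quasiMeasurePreserving_snd.ae (expMeasure_ae_nonneg h2)] with p h3 h4
    exact le_min h3 h4
  have hm : AEStronglyMeasurable (fun p : ℝ × ℝ => min p.1 p.2)
      ((ProbabilityTheory.expMeasure (M.lam i)).prod
        (ProbabilityTheory.expMeasure (M.switch i))) := by
    exact (measurable_fst.min measurable_snd).aestronglyMeasurable
  have hl := lintegral_min_expMeasure h1 h2
  refine ⟨⟨hm, ?_⟩, ?_⟩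
  · rw [hasFiniteIntegral_iff_ofReal h0, hl]
    exact ENNReal.ofReal_lt_top
  · rw [integral_eq_lintegral_of_nonneg_ae h0 hm, hl, ENNReal.toReal_ofReal (by positivity)]

theorem integral_indicator_length (i : WorldState) {s : Set ℝ} (hs : MeasurableSet s)
    {g : ℝ → ℝ} (hg : IntegrableOn g s (M.F i)) :
    Integrable (fun p : ℝ × ℝ => s.indicator g p.1)
      ((M.F i).prod (volume.restrict (Icc (0 : ℝ) 1))) ∧
    ∫ p, s.indicator g p.1 ∂((M.F i).prod (volume.restrict (Icc (0 : ℝ) 1))) =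
      ∫ τ in s, g τ ∂M.F i := by
  refine ⟨((integrable_indicator_iff hs).2 hg).comp_fst _, ?_⟩
  rw [integral_fun_fst, integral_indicator hs]
  simp [measureReal_def]

theorem epochLength_eq (σ : Policy) (i : WorldState) (z : Noise) :
    epochLength σ i z = min z.1 z.2.1 +
      requestFirst (z.1, z.2.1) * (σ i).indicator (fun τ => τ) z.2.2.1 := by
  unfold epochLength requestFirst
  by_cases h : z.1 < z.2.1
  · by_cases h' : z.2.2.1 ∈ σ i <;> simp [h, h', h.le]
  · simp [h, not_lt.1 h]

theorem epochPay_eq (w : Pricing) (σ : Policy) (i : WorldState) (z : Noise) :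
    epochPay w σ i z = requestFirst (z.1, z.2.1) * (σ i).indicator (w i) z.2.2.1 := by
  unfold epochPay requestFirst
  by_cases h : z.1 < z.2.1 <;> by_cases h' : z.2.2.1 ∈ σ i <;> simp [h, h']

/-- The set of pairs (trip length, uniform variable) that end in the other state. -/
def switchSet (s : Set ℝ) (i : WorldState) : Set (ℝ × ℝ) :=
  {p | p.1 ∈ s ∧ p.2 < M.transitionProb i p.1}

open Classical in
theorem epochNext_eq_other (σ : Policy) (i : WorldState) (z : Noise) :
    (if M.epochNext σ i z = i.other then (1 : ℝ) else 0) =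
      (1 - requestFirst (z.1, z.2.1)) +
        requestFirst (z.1, z.2.1) * (M.switchSet (σ i) i).indicator 1 z.2.2 := by
  have hi : i ≠ i.other := by cases i <;> decide
  unfold epochNext requestFirst switchSet
  by_cases h : z.1 < z.2.1
  · by_cases h' : z.2.2.1 ∈ σ i ∧ z.2.2.2 < M.transitionProb i z.2.2.1
    · simp [h, h']
    · simp [h, h', hi]
  · simp [h]

theorem measurableSet_switchSet {s : Set ℝ} (hs : MeasurableSet s) (i : WorldState) :
    MeasurableSet (M.switchSet s i) :=
  (measurable_fst hs).inter (measurableSet_lt measurable_snd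
    ((M.continuous_transitionProb i).measurable.comp measurable_fst))

theorem integral_switchSet {s : Set ℝ} (hs : MeasurableSet s) (h0 : s ⊆ Ioi 0) (i : WorldState) :
    ∫ p, (M.switchSet s i).indicator 1 p ∂((M.F i).prod (volume.restrict (Icc (0 : ℝ) 1))) =
      ∫ τ in s, M.transitionProb i τ ∂M.F i := by
  have : IsProbabilityMeasure (volume.restrict (Icc (0 : ℝ) 1)) := ⟨by simp⟩
  have hm := M.measurableSet_switchSet hs i
  have hint : Integrable ((M.switchSet s i).indicator (1 : ℝ × ℝ → ℝ))
      ((M.F i).prod (volume.restrict (Icc (0 : ℝ) 1))) :=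
    (integrable_const (1 : ℝ)).indicator hm
  rw [integral_prod _ hint, ← integral_indicator hs]
  refine integral_congr_ae (ae_of_all _ fun τ => ?_)
  by_cases h : τ ∈ s
  · have h1 : (fun u : ℝ => (M.switchSet s i).indicator (1 : ℝ × ℝ → ℝ) (τ, u)) =
        (Iio (M.transitionProb i τ)).indicator 1 := by
      ext u
      by_cases hu : u < M.transitionProb i τ <;> simp [switchSet, indicator, h, hu]
    simp only [h1]
    rw [integral_indicator_one measurableSet_Iio, measureReal_def,
      Measure.restrict_apply measurableSet_Iio, indicator_of_mem h]
    have h2 : Iio (M.transitionProb i τ) ∩ Icc 0 1 = Ico 0 (M.transitionProb i τ) := by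
      ext u
      simp only [mem_inter_iff, mem_Iio, mem_Icc, mem_Ico]
      have := M.transitionProb_le_one i τ
      constructor
      · rintro ⟨a, b, c⟩; exact ⟨b, a⟩
      · rintro ⟨a, b⟩; exact ⟨b, a, by linarith⟩
    rw [h2, Real.volume_Ico, sub_zero,
      ENNReal.toReal_ofReal (M.transitionProb_nonneg i (le_of_lt (h0 h)))]
  · have h1 : (fun u : ℝ => (M.switchSet s i).indicator (1 : ℝ × ℝ → ℝ) (τ, u)) = 0 := by
      ext u
      simp [switchSet, indicator, h]
    simp only [h1]
    simp [h]

end DynamicModel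

namespace DynamicModel

variable (M : DynamicModel)

theorem epochLength_mean {σ : Policy} (hσ : IsPolicy σ) (i : WorldState) :
    Measurable (epochLength σ i) ∧ Integrable (epochLength σ i) (M.noiseLaw i) ∧
      ∫ z, epochLength σ i z ∂M.noiseLaw i = M.meanTime i (σ i) / (M.lam i + M.switch i) := by
  have := ProbabilityTheory.isProbabilityMeasure_expMeasure (M.lam_pos i)
  have := ProbabilityTheory.isProbabilityMeasure_expMeasure (M.switch_pos i)
  have : IsProbabilityMeasure (volume.restrict (Icc (0 : ℝ) 1)) := ⟨by simp⟩
  have hs : MeasurableSet (σ i) := (hσ i).1.measurableSet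
  rw [funext (epochLength_eq σ i)]
  obtain ⟨g1, g2⟩ := M.integral_indicator_length i hs (M.integrable_id_F i).integrableOn
  obtain ⟨f1, f2⟩ := M.integrable_min_clocks i
  have hA : Integrable (fun z : Noise => min z.1 z.2.1) (M.noiseLaw i) := by
    simpa using M.noiseLaw_integrable_mul i f1 (integrable_const (1 : ℝ))
  have hB := M.noiseLaw_integrable_mul i (M.integrable_requestFirst i) g1
  refine ⟨?_, hA.add hB, ?_⟩
  · exact (measurable_fst.min (measurable_fst.comp measurable_snd)).add
      ((measurable_requestFirst.comp
        (measurable_fst.prodMk (measurable_fst.comp measurable_snd))).mul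
        ((measurable_id.indicator hs).comp
          (measurable_fst.comp (measurable_snd.comp measurable_snd))))
  · have h1 : ∫ z : Noise, min z.1 z.2.1 ∂M.noiseLaw i = 1 / (M.lam i + M.switch i) := by
      have := M.noiseLaw_integral_mul i (fun p => min p.1 p.2) (fun _ => 1)
      simpa [f2] using this
    have h2 := M.noiseLaw_integral_mul i requestFirst
      (fun p => (σ i).indicator (fun τ => τ) p.1)
    rw [M.integral_requestFirst, g2] at h2
    rw [integral_add hA hB, h1, h2, meanTime]
    ring

theorem epochPay_mean {w : Pricing} {σ : Policy} (hσ : IsPolicy σ) (i : WorldState)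
    (hc : ContinuousOn (w i) (Ioi 0)) (hw : Integrable (w i) (M.F i)) :
    Measurable (epochPay w σ i) ∧ Integrable (epochPay w σ i) (M.noiseLaw i) ∧
      ∫ z, epochPay w σ i z ∂M.noiseLaw i = M.meanPay w i (σ i) / (M.lam i + M.switch i) := by
  have hs : MeasurableSet (σ i) := (hσ i).1.measurableSet
  rw [funext (epochPay_eq w σ i)]
  obtain ⟨g1, g2⟩ := M.integral_indicator_length i hs hw.integrableOn
  refine ⟨?_, M.noiseLaw_integrable_mul i (M.integrable_requestFirst i) g1, ?_⟩
  · have hm : Measurable ((σ i).indicator (w i)) := by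
      classical
      rw [← piecewise_eq_indicator]
      exact (hc.mono (hσ i).2).measurable_piecewise continuousOn_const hs
    exact (measurable_requestFirst.comp
        (measurable_fst.prodMk (measurable_fst.comp measurable_snd))).mul
        (hm.comp (measurable_fst.comp (measurable_snd.comp measurable_snd)))
  · have h2 := M.noiseLaw_integral_mul i requestFirst (fun p => (σ i).indicator (w i) p.1)
    rw [M.integral_requestFirst, g2] at h2
    rw [h2, meanPay]
    ring

theorem switch_mean {σ : Policy} (hσ : IsPolicy σ) (i : WorldState) :
    let h : Noise → ℝ := fun z => if M.epochNext σ i z = i.other then 1 else 0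
    Measurable h ∧ Integrable h (M.noiseLaw i) ∧
      ∫ z, h z ∂M.noiseLaw i = M.meanSwitch i (σ i) / (M.lam i + M.switch i) := by
  have := ProbabilityTheory.isProbabilityMeasure_expMeasure (M.lam_pos i)
  have := ProbabilityTheory.isProbabilityMeasure_expMeasure (M.switch_pos i)
  have : IsProbabilityMeasure (volume.restrict (Icc (0 : ℝ) 1)) := ⟨by simp⟩
  have hs : MeasurableSet (σ i) := (hσ i).1.measurableSet
  have hS := M.measurableSet_switchSet hs i
  intro h
  have he : h = fun z : Noise => (1 - requestFirst (z.1, z.2.1)) +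
        requestFirst (z.1, z.2.1) * (M.switchSet (σ i) i).indicator 1 z.2.2 := by
    funext z
    rw [← M.epochNext_eq_other σ i z]
  have hR : Measurable fun z : Noise => requestFirst (z.1, z.2.1) :=
    measurable_requestFirst.comp (measurable_fst.prodMk (measurable_fst.comp measurable_snd))
  have f1 : Integrable (fun p => 1 - requestFirst p)
      ((ProbabilityTheory.expMeasure (M.lam i)).prod
        (ProbabilityTheory.expMeasure (M.switch i))) :=
    (integrable_const 1).sub (M.integrable_requestFirst i)
  have hA : Integrable (fun z : Noise => 1 - requestFirst (z.1, z.2.1)) (M.noiseLaw i) := by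
    simpa using M.noiseLaw_integrable_mul i f1 (integrable_const (1 : ℝ))
  have hB : Integrable (fun z : Noise =>
      requestFirst (z.1, z.2.1) * (M.switchSet (σ i) i).indicator 1 z.2.2) (M.noiseLaw i) :=
    M.noiseLaw_integrable_mul i (M.integrable_requestFirst i)
      ((integrable_const (1 : ℝ)).indicator hS)
  rw [he]
  refine ⟨?_, hA.add hB, ?_⟩
  · exact (measurable_const.sub hR).add (hR.mul ((measurable_const.indicator hS).comp
      (measurable_snd.comp measurable_snd)))
  · have h1 : ∫ z : Noise, (1 - requestFirst (z.1, z.2.1)) ∂M.noiseLaw i =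
        1 - M.lam i / (M.lam i + M.switch i) := by
      have h2 := M.noiseLaw_integral_mul i (fun p => 1 - requestFirst p) (fun _ => 1)
      rw [integral_sub (integrable_const 1) (M.integrable_requestFirst i),
        M.integral_requestFirst] at h2
      simpa using h2
    have h2 := M.noiseLaw_integral_mul i requestFirst ((M.switchSet (σ i) i).indicator 1)
    rw [M.integral_requestFirst, M.integral_switchSet hs (hσ i).2] at h2
    have h3 := M.lam_pos i
    have h4 := M.switch_pos i
    refine (integral_add hA hB).trans ?_
    rw [h1, h2, meanSwitch]
    field_simp
    ring

theorem surgeJump_eq (σ : Policy) (i : WorldState) (z : Noise) :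
    M.surgeJump σ i z = (if i = .nonsurge then 1 else -1) *
      (if M.epochNext σ i z = i.other then (1 : ℝ) else 0) := by
  unfold surgeJump
  cases i <;> cases h : M.epochNext σ _ z <;> simp [WorldState.other]

/-! ### The almost sure earnings rate -/

/-- The strong law of large numbers for the inputs of the successive epochs in state `i`. -/
theorem strong_law_inputs (i : WorldState) {h : Noise → ℝ} (hm : Measurable h)
    (hi : Integrable h (M.noiseLaw i)) :
    ∀ᵐ ω ∂M.P, Tendsto (fun n : ℕ => (∑ k ∈ Finset.range n, h (ω (i, k))) / n) atTop
      (𝓝 (∫ z, h z ∂M.noiseLaw i)) := by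
  have hmp : ∀ p : WorldState × ℕ, MeasurePreserving (fun ω : Ω => ω p) M.P (M.noiseLaw p.1) :=
    fun p => measurePreserving_eval_infinitePi _ p
  have hind : ProbabilityTheory.iIndepFun (fun (p : WorldState × ℕ) (ω : Ω) => h (ω p)) M.P :=
    ProbabilityTheory.iIndepFun_infinitePi (X := fun _ => h) fun _ => hm
  have key := ProbabilityTheory.strong_law_ae_real (μ := M.P) (fun k ω => h (ω (i, k)))
    ((hmp (i, 0)).integrable_comp_of_integrable hi)
    (fun j k hjk => hind.indepFun (by simpa using hjk))
    (fun k => ⟨(hm.comp (measurable_pi_apply _)).aemeasurable,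
      (hm.comp (measurable_pi_apply _)).aemeasurable, by
        rw [← Function.comp_def h, ← Function.comp_def h, ← Measure.map_map hm (hmp _).measurable,
          ← Measure.map_map hm (hmp _).measurable, (hmp (i, k)).map_eq, (hmp (i, 0)).map_eq]⟩)
  have he : ∫ ω, h (ω (i, 0)) ∂M.P = ∫ z, h z ∂M.noiseLaw i := by
    rw [← (hmp (i, 0)).map_eq, integral_map (hmp _).measurable.aemeasurable hm.aestronglyMeasurable]
  rwa [he] at key

/-- The earnings rate in closed form: time and payments per epoch are weighted by the frequencies of
the two states among the epochs, which are inversely proportional to the switching probabilities. -/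
noncomputable def meanRate (w : Pricing) (σ : Policy) : ℝ :=
  (M.meanSwitch .surge (σ .surge) * M.meanPay w .nonsurge (σ .nonsurge) +
      M.meanSwitch .nonsurge (σ .nonsurge) * M.meanPay w .surge (σ .surge)) /
    (M.meanSwitch .surge (σ .surge) * M.meanTime .nonsurge (σ .nonsurge) +
      M.meanSwitch .nonsurge (σ .nonsurge) * M.meanTime .surge (σ .surge))

theorem tendsto_earnings_meanRate {w : Pricing} (hc : ∀ i, ContinuousOn (w i) (Ioi 0))
    (hw : ∀ i, Integrable (w i) (M.F i)) {σ : Policy} (hσ : IsPolicy σ) :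
    ∀ᵐ ω ∂M.P, Tendsto (fun t : ℝ => M.earnings w σ t ω / t) atTop (𝓝 (M.meanRate w σ)) := by
  have hmp : ∀ p : WorldState × ℕ, MeasurePreserving (fun ω : Ω => ω p) M.P (M.noiseLaw p.1) :=
    fun p => measurePreserving_eval_infinitePi _ p
  have hpos : ∀ᵐ ω ∂M.P, ∀ p : WorldState × ℕ, 0 ≤ (ω p).1 ∧ 0 ≤ (ω p).2.1 :=
    ae_all_iff.2 fun p => (hmp p).quasiMeasurePreserving.ae (M.noiseLaw_ae_nonneg p.1)
  have hlen := fun i => M.strong_law_inputs i (M.epochLength_mean hσ i).1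
    (M.epochLength_mean hσ i).2.1
  have hpay := fun i => M.strong_law_inputs i (M.epochPay_mean hσ i (hc i) (hw i)).1
    (M.epochPay_mean hσ i (hc i) (hw i)).2.1
  have hsw := fun i => M.strong_law_inputs i (M.switch_mean hσ i).1 (M.switch_mean hσ i).2.1
  filter_upwards [hpos, ae_all_iff.2 hlen, ae_all_iff.2 hpay, ae_all_iff.2 hsw]
    with ω h0 h1 h2 h3
  simp only [(M.epochLength_mean hσ _).2.2] at h1
  simp only [(M.epochPay_mean hσ _ (hc _) (hw _)).2.2] at h2
  simp only [(M.switch_mean hσ _).2.2] at h3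
  have hL : ∀ i, 0 < M.lam i + M.switch i := fun i => add_pos (M.lam_pos i) (M.switch_pos i)
  have hQ : ∀ i, 0 < M.meanSwitch i (σ i) := fun i =>
    M.meanSwitch_pos i (hσ i).1.measurableSet (hσ i).2
  have hT : ∀ i, 0 < M.meanTime i (σ i) := fun i =>
    M.meanTime_pos i (hσ i).1.measurableSet (hσ i).2
  set p : WorldState → ℝ := fun i => M.meanSwitch i (σ i) / (M.lam i + M.switch i) with hp
  have hp0 : ∀ i, 0 < p i := fun i => div_pos (hQ i) (hL i)
  obtain ⟨v1, v2⟩ := M.tendsto_visits σ ω (hp0 .nonsurge) (hp0 .surge)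
    (by simpa only [surgeJump_eq, if_true, one_mul] using h3 .nonsurge)
    (by
      refine (h3 .surge).neg.congr fun n => ?_
      simp only [surgeJump_eq, reduceCtorEq, if_false, neg_mul, one_mul, Finset.sum_neg_distrib,
        neg_div])
  let π : WorldState → ℝ := fun i => p i.other / (p .nonsurge + p .surge)
  have hv : ∀ i, Tendsto (fun n : ℕ => (M.visits σ ω n i : ℝ) / n) atTop (𝓝 (π i)) := by
    intro i
    cases i
    · exact v1
    · exact v2
  have hlen' := M.tendsto_average hv h1
  have hpay' := M.tendsto_average hv h2
  have hπ : ∀ i, 0 < π i := fun i => div_pos (hp0 _) (add_pos (hp0 _) (hp0 _))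
  have hμ : 0 < π .nonsurge * (M.meanTime .nonsurge (σ .nonsurge) /
        (M.lam .nonsurge + M.switch .nonsurge)) +
      π .surge * (M.meanTime .surge (σ .surge) / (M.lam .surge + M.switch .surge)) :=
    add_pos (mul_pos (hπ _) (div_pos (hT _) (hL _))) (mul_pos (hπ _) (div_pos (hT _) (hL _)))
  have hmono : Monotone (M.epochTime σ ω) := by
    refine monotone_nat_of_le_succ fun n => ?_
    rw [epochTime, epochTime, Finset.sum_range_succ, le_add_iff_nonneg_right]
    obtain ⟨z1, z2⟩ := h0 ((M.driverState σ ω n).1, (M.driverState σ ω n).2 (M.driverState σ ω n).1)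
    unfold epochLength
    split_ifs with ha hb
    · exact add_nonneg z1 (le_of_lt ((hσ _).2 hb))
    · exact z1
    · exact z2
  have key := tendsto_renewal_reward (T := M.epochTime σ ω)
    (x := fun n => epochPay w σ (M.stateAt σ ω n) (M.noiseAt σ ω n)) (by simp [epochTime])
    hmono hμ hlen' hpay'
  have hval : (π .nonsurge * (M.meanPay w .nonsurge (σ .nonsurge) /
        (M.lam .nonsurge + M.switch .nonsurge)) +
      π .surge * (M.meanPay w .surge (σ .surge) / (M.lam .surge + M.switch .surge))) /
      (π .nonsurge * (M.meanTime .nonsurge (σ .nonsurge) /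
        (M.lam .nonsurge + M.switch .nonsurge)) +
      π .surge * (M.meanTime .surge (σ .surge) / (M.lam .surge + M.switch .surge))) =
      M.meanRate w σ := by
    have a1 := hL .nonsurge
    have a2 := hL .surge
    have e : ∀ x y : ℝ, π .nonsurge * (x / (M.lam .nonsurge + M.switch .nonsurge)) +
        π .surge * (y / (M.lam .surge + M.switch .surge)) =
        (M.meanSwitch .surge (σ .surge) * x + M.meanSwitch .nonsurge (σ .nonsurge) * y) /
          ((M.lam .nonsurge + M.switch .nonsurge) * (M.lam .surge + M.switch .surge) *
            (p .nonsurge + p .surge)) := by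
      intro x y
      have a3 : 0 < p .nonsurge + p .surge := add_pos (hp0 _) (hp0 _)
      simp only [π, WorldState.other]
      rw [show p .surge = M.meanSwitch .surge (σ .surge) / (M.lam .surge + M.switch .surge)
        from rfl, show p .nonsurge = M.meanSwitch .nonsurge (σ .nonsurge) /
        (M.lam .nonsurge + M.switch .nonsurge) from rfl]
      field_simp
    rw [e, e, meanRate, div_div_div_cancel_right₀]
    exact ne_of_gt (mul_pos (mul_pos a1 a2) (add_pos (hp0 _) (hp0 _)))
  rw [hval] at key
  exact key

theorem earningsRate_eq_meanRate {w : Pricing} (hc : ∀ i, ContinuousOn (w i) (Ioi 0))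
    (hw : ∀ i, Integrable (w i) (M.F i)) {σ : Policy} (hσ : IsPolicy σ) :
    M.earningsRate w σ = M.meanRate w σ := by
  have : IsProbabilityMeasure M.P := by unfold P; infer_instance
  rw [earningsRate, integral_congr_ae (g := fun _ => M.meanRate w σ)]
  · simp
  · filter_upwards [M.tendsto_earnings_meanRate hc hw hσ] with ω hω
    exact hω.liminf_eq

end DynamicModel

/-! ### Roots of strictly monotone functions -/

theorem continuous_of_abs_sub_le {f : ℝ → ℝ} {L : ℝ}
    (h : ∀ x d, 0 ≤ d → |f (x + d) - f x| ≤ L * d) : Continuous f := by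
  have hL : 0 ≤ L := by simpa using (abs_nonneg _).trans (h 0 1 zero_le_one)
  refine (LipschitzWith.of_dist_le_mul (K := ⟨L, hL⟩) fun x y => ?_).continuous
  rw [Real.dist_eq, Real.dist_eq]
  change _ ≤ L * _
  rcases le_total x y with hxy | hxy
  · have := h x (y - x) (by linarith)
    rw [add_sub_cancel] at this
    rw [abs_sub_comm, abs_sub_comm x y, abs_of_nonneg (sub_nonneg.2 hxy)]
    exact this
  · have := h y (x - y) (by linarith)
    rw [add_sub_cancel] at this
    rwa [abs_of_nonneg (sub_nonneg.2 hxy)]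

theorem exists_root_of_slope_le {f : ℝ → ℝ} {m : ℝ} (hm : 0 < m) (hf : Continuous f)
    (h : ∀ x d, 0 ≤ d → f (x + d) ≤ f x - m * d) : ∃ x, f x = 0 := by
  have hd : 0 ≤ |f 0| / m := by positivity
  have hmd : m * (|f 0| / m) = |f 0| := by field_simp
  have h1 := h 0 _ hd
  have h2 := h (-(|f 0| / m)) _ hd
  rw [zero_add, hmd] at h1
  rw [neg_add_cancel, hmd] at h2
  exact mem_range_of_exists_le_of_exists_ge hf ⟨|f 0| / m, by linarith [le_abs_self (f 0)]⟩
    ⟨-(|f 0| / m), by linarith [neg_abs_le (f 0)]⟩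

/-- A function `V R κ`, decreasing in `R` and increasing in `κ` with slopes bounded away from zero
and infinity, vanishes along the graph of a continuous function `R = r κ` of positive slope. -/
theorem exists_implicit_root {V : ℝ → ℝ → ℝ} {s K L : ℝ} (hK : 0 < K) (hs : 0 < s)
    (h1 : ∀ R κ d, 0 ≤ d → V (R + d) κ ≤ V R κ - d)
    (h2 : ∀ R κ d, 0 ≤ d → V R κ - K * d ≤ V (R + d) κ)
    (h3 : ∀ R κ d, 0 ≤ d → V R κ + s * d ≤ V R (κ + d))
    (h4 : ∀ R κ d, 0 ≤ d → V R (κ + d) ≤ V R κ + L * d) :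
    ∃ r : ℝ → ℝ, Continuous r ∧ (∀ κ, V (r κ) κ = 0) ∧
      ∀ κ d, 0 ≤ d → r κ + s / K * d ≤ r (κ + d) := by
  have hex : ∀ κ, ∃ R, V R κ = 0 := fun κ => by
    refine exists_root_of_slope_le one_pos (f := fun R => V R κ) ?_ fun R d hd => ?_
    · refine continuous_of_abs_sub_le (L := K) fun R d hd => abs_le.2 ⟨?_, ?_⟩
      · linarith [h2 R κ d hd]
      · have := h1 R κ d hd
        have : 0 ≤ K * d := by positivity
        linarith
    · rw [one_mul]
      exact h1 R κ d hd
  choose r hr using hex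
  have key : ∀ κ d, 0 ≤ d → s / K * d ≤ r (κ + d) - r κ ∧ r (κ + d) - r κ ≤ L * d := by
    intro κ d hd
    have e1 := h3 (r κ) κ d hd
    have e2 := h4 (r κ) κ d hd
    rw [hr κ] at e1 e2
    have e0 : 0 ≤ s * d := by positivity
    have hge : r κ ≤ r (κ + d) := by
      by_contra hc
      have := h1 (r (κ + d)) (κ + d) (r κ - r (κ + d)) (by linarith)
      rw [add_sub_cancel, hr (κ + d)] at this
      linarith
    have e3 := h1 (r κ) (κ + d) (r (κ + d) - r κ) (by linarith)
    have e4 := h2 (r κ) (κ + d) (r (κ + d) - r κ) (by linarith)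
    rw [add_sub_cancel, hr (κ + d)] at e3 e4
    refine ⟨?_, by linarith⟩
    rw [div_mul_eq_mul_div, div_le_iff₀ hK]
    linarith
  refine ⟨r, continuous_of_abs_sub_le (L := L) fun κ d hd => ?_, hr, fun κ d hd => ?_⟩
  · obtain ⟨k1, k2⟩ := key κ d hd
    have : 0 ≤ s / K * d := by positivity
    rw [abs_of_nonneg (by linarith)]
    exact k2
  · linarith [(key κ d hd).1]

namespace DynamicModel

variable (M : DynamicModel)

/-! ### Certificates of optimality -/

/-- The advantage of accepting a trip of length `τ` in state `i`, when time is worth `R` per unit and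
being in the other state rather than in state `i` is worth `κ`. -/
noncomputable def gain (w : Pricing) (i : WorldState) (R κ τ : ℝ) : ℝ :=
  w i τ - R * τ + κ * M.transitionProb i τ

/-- The value (times `λ_i + λ_{i→j}`) of an epoch in state `i` in which the lengths in `s` are
accepted, when time costs `R` per unit and a change of state is worth `κ`. -/
noncomputable def epochValue (w : Pricing) (i : WorldState) (R κ : ℝ) (s : Set ℝ) : ℝ :=
  -R + κ * M.switch i + M.lam i * ∫ τ in s, M.gain w i R κ τ ∂M.F i

/-- The value of moving from state `i` to the other state, if the surge state is better by `κ`. -/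
def stateShift (κ : ℝ) : WorldState → ℝ
  | .nonsurge => κ
  | .surge => -κ

variable {M} {w : Pricing}

theorem integrable_gain {i : WorldState} (hw : Integrable (w i) (M.F i)) (R κ : ℝ) :
    Integrable (M.gain w i R κ) (M.F i) :=
  (hw.sub ((M.integrable_id_F i).const_mul R)).add ((M.integrable_transitionProb i).const_mul κ)

theorem continuousOn_gain {i : WorldState} (hc : ContinuousOn (w i) (Ioi 0)) (R κ : ℝ) :
    ContinuousOn (M.gain w i R κ) (Ioi 0) := by
  have := M.continuous_transitionProb i
  exact (hc.sub (by fun_prop)).add (by fun_prop)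

theorem epochValue_eq {i : WorldState} (hw : Integrable (w i) (M.F i)) (R κ : ℝ) (s : Set ℝ) :
    M.epochValue w i R κ s = M.meanPay w i s - R * M.meanTime i s + κ * M.meanSwitch i s := by
  have h1 := hw.integrableOn (s := s)
  have h2 := ((M.integrable_id_F i).const_mul R).integrableOn (s := s)
  have h3 := ((M.integrable_transitionProb i).const_mul κ).integrableOn (s := s)
  unfold epochValue gain meanPay meanTime meanSwitch
  have e : ∫ τ in s, (w i τ - R * τ + κ * M.transitionProb i τ) ∂M.F i =
      ∫ τ in s, w i τ ∂M.F i - R * ∫ τ in s, τ ∂M.F i +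
        κ * ∫ τ in s, M.transitionProb i τ ∂M.F i := by
    rw [← integral_const_mul, ← integral_const_mul, ← integral_sub h1 h2]
    exact integral_add (h1.sub h2) h3
  rw [e]
  ring

theorem meanRate_sub (hw : ∀ i, Integrable (w i) (M.F i)) {σ : Policy} (hσ : IsPolicy σ)
    (R κ : ℝ) :
    M.meanRate w σ - R =
      (M.meanSwitch .surge (σ .surge) * M.epochValue w .nonsurge R κ (σ .nonsurge) +
        M.meanSwitch .nonsurge (σ .nonsurge) * M.epochValue w .surge R (-κ) (σ .surge)) /
      (M.meanSwitch .surge (σ .surge) * M.meanTime .nonsurge (σ .nonsurge) +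
        M.meanSwitch .nonsurge (σ .nonsurge) * M.meanTime .surge (σ .surge)) := by
  have hQ : ∀ i, 0 < M.meanSwitch i (σ i) := fun i =>
    M.meanSwitch_pos i (hσ i).1.measurableSet (hσ i).2
  have hT : ∀ i, 0 < M.meanTime i (σ i) := fun i =>
    M.meanTime_pos i (hσ i).1.measurableSet (hσ i).2
  have hD := add_pos (mul_pos (hQ .surge) (hT .nonsurge)) (mul_pos (hQ .nonsurge) (hT .surge))
  rw [meanRate, epochValue_eq (hw _), epochValue_eq (hw _), sub_eq_iff_eq_add, div_add' _ _ _ hD.ne']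
  congr 1
  ring

theorem _root_.IsPolicy.update {σ : Policy} (hσ : IsPolicy σ) (i : WorldState) {s : Set ℝ}
    (hs : IsOpen s) (h0 : s ⊆ Ioi 0) : IsPolicy (Function.update σ i s) := by
  intro j
  rcases eq_or_ne j i with rfl | hj
  · simpa using ⟨hs, h0⟩
  · simpa [hj] using hσ j

/-- With time worth `R` and the surge state better by `κ`, every epoch has value at most zero, and
the epochs of `σ` have value zero. -/
def Certifies (M : DynamicModel) (w : Pricing) (σ : Policy) (R κ : ℝ) : Prop :=
  ∀ i, M.epochValue w i R (stateShift κ i) (σ i) = 0 ∧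
    ∀ s, IsOpen s → s ⊆ Ioi 0 → M.epochValue w i R (stateShift κ i) s ≤ 0

theorem Certifies.meanRate_eq (hw : ∀ i, Integrable (w i) (M.F i)) {σ : Policy} (hσ : IsPolicy σ)
    {R κ : ℝ} (h : M.Certifies w σ R κ) : M.meanRate w σ = R := by
  have h1 := (h .nonsurge).1
  have h2 := (h .surge).1
  simp only [stateShift] at h1 h2
  have := meanRate_sub hw hσ R κ
  rw [h1, h2, mul_zero, mul_zero, add_zero, zero_div] at this
  linarith

theorem Certifies.meanRate_le (hw : ∀ i, Integrable (w i) (M.F i)) {σ σ' : Policy}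
    (hσ' : IsPolicy σ') {R κ : ℝ} (h : M.Certifies w σ R κ) : M.meanRate w σ' ≤ R := by
  have h1 := (h .nonsurge).2 _ (hσ' .nonsurge).1 (hσ' .nonsurge).2
  have h2 := (h .surge).2 _ (hσ' .surge).1 (hσ' .surge).2
  simp only [stateShift] at h1 h2
  have hQ : ∀ i, 0 < M.meanSwitch i (σ' i) := fun i =>
    M.meanSwitch_pos i (hσ' i).1.measurableSet (hσ' i).2
  have hT : ∀ i, 0 < M.meanTime i (σ' i) := fun i =>
    M.meanTime_pos i (hσ' i).1.measurableSet (hσ' i).2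
  have hD := add_pos (mul_pos (hQ .surge) (hT .nonsurge)) (mul_pos (hQ .nonsurge) (hT .surge))
  have h3 := meanRate_sub hw hσ' R κ
  have h4 : M.meanRate w σ' - R ≤ 0 := by
    rw [h3]
    refine div_nonpos_of_nonpos_of_nonneg ?_ hD.le
    have := mul_nonpos_of_nonneg_of_nonpos (hQ .surge).le h1
    have := mul_nonpos_of_nonneg_of_nonpos (hQ .nonsurge).le h2
    linarith
  linarith

theorem Certifies.isOptimal (hA : M.IsAdmissible w) {σ : Policy} (hσ : IsPolicy σ) {R κ : ℝ}
    (h : M.Certifies w σ R κ) : M.IsOptimal w σ := by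
  refine ⟨hσ, fun σ' hσ' => ?_⟩
  rw [M.earningsRate_eq_meanRate hA.1 hA.2.1 hσ, M.earningsRate_eq_meanRate hA.1 hA.2.1 hσ',
    h.meanRate_eq hA.2.1 hσ]
  exact h.meanRate_le hA.2.1 hσ'

theorem stateRate_eq (i : WorldState) (s : Set ℝ) :
    M.stateRate w i s = M.meanPay w i s / M.meanTime i s := rfl

/-- Every optimal policy has a certificate: `R` is its earnings rate, and `κ` is the excess of the
earnings of an epoch in the surge state over `R`, per switch.  That `κ` is positive is where the
surge assumption enters. -/
theorem IsOptimal.exists_certifies (hA : M.IsAdmissible w) {σ : Policy} (h : M.IsOptimal w σ) :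
    ∃ κ, 0 < κ ∧ 0 ≤ M.earningsRate w σ ∧ M.Certifies w σ (M.earningsRate w σ) κ := by
  obtain ⟨hσ, hmax⟩ := h
  obtain ⟨hc, hw, s₂, hs₂, hs₂0, hsurge⟩ := hA
  have hmax' : ∀ σ', IsPolicy σ' → M.meanRate w σ' ≤ M.earningsRate w σ := fun σ' hσ' => by
    rw [← M.earningsRate_eq_meanRate hc hw hσ']
    exact hmax σ' hσ'
  have hR : M.meanRate w σ = M.earningsRate w σ := (M.earningsRate_eq_meanRate hc hw hσ).symm
  set R := M.earningsRate w σ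
  have hQ : ∀ {σ'}, IsPolicy σ' → ∀ i, 0 < M.meanSwitch i (σ' i) := fun h i =>
    M.meanSwitch_pos i (h i).1.measurableSet (h i).2
  have hT : ∀ {σ'}, IsPolicy σ' → ∀ i, 0 < M.meanTime i (σ' i) := fun h i =>
    M.meanTime_pos i (h i).1.measurableSet (h i).2
  have hD : ∀ {σ'}, IsPolicy σ' →
      0 < M.meanSwitch .surge (σ' .surge) * M.meanTime .nonsurge (σ' .nonsurge) +
        M.meanSwitch .nonsurge (σ' .nonsurge) * M.meanTime .surge (σ' .surge) := fun h =>
    add_pos (mul_pos (hQ h _) (hT h _)) (mul_pos (hQ h _) (hT h _))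
  -- the excess earnings of an epoch over the rate `R`
  let A : WorldState → Set ℝ → ℝ := fun i s => M.epochValue w i R 0 s
  have hval : ∀ i κ s, M.epochValue w i R κ s = A i s + κ * M.meanSwitch i s := by
    intro i κ s
    simp only [A]
    rw [epochValue_eq (hw i), epochValue_eq (hw i)]
    ring
  have hle : ∀ {σ'}, IsPolicy σ' →
      M.meanSwitch .surge (σ' .surge) * A .nonsurge (σ' .nonsurge) +
        M.meanSwitch .nonsurge (σ' .nonsurge) * A .surge (σ' .surge) ≤ 0 := by
    intro σ' h
    have h1 := meanRate_sub hw h R 0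
    rw [neg_zero] at h1
    have h2 := hmax' σ' h
    by_contra hc
    have := div_pos (not_le.1 hc) (hD h)
    simp only [A] at this
    linarith
  have heq : M.meanSwitch .surge (σ .surge) * A .nonsurge (σ .nonsurge) +
        M.meanSwitch .nonsurge (σ .nonsurge) * A .surge (σ .surge) = 0 := by
    have h1 := meanRate_sub hw hσ R 0
    rw [neg_zero, hR, sub_self, eq_comm, div_eq_zero_iff] at h1
    exact h1.resolve_right (hD hσ).ne'
  have hAT : ∀ i s, A i s = M.meanPay w i s - R * M.meanTime i s := by
    intro i s
    simp only [A]
    rw [epochValue_eq (hw i)]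
    ring
  have hAs : 0 < A .surge (σ .surge) := by
    by_contra hneg
    have hAn : 0 ≤ A .nonsurge (σ .nonsurge) := by
      by_contra hn
      have := mul_neg_of_pos_of_neg (hQ hσ .surge) (not_le.1 hn)
      have := mul_nonpos_of_nonneg_of_nonpos (hQ hσ .nonsurge).le (not_lt.1 hneg)
      linarith
    -- state 1 alone earns at least `R`, so that the surge policy `s₂` earns more than `R`
    have h1 : R ≤ M.stateRate w .nonsurge (σ .nonsurge) := by
      rw [stateRate_eq, le_div_iff₀ (hT hσ _)]
      linarith [hAT .nonsurge (σ .nonsurge)]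
    have h2 := h1.trans_lt (hsurge _ (hσ .nonsurge).1 (hσ .nonsurge).2)
    have hσ' := hσ.update .surge hs₂ hs₂0
    rw [stateRate_eq, lt_div_iff₀ (M.meanTime_pos _ hs₂.measurableSet hs₂0)] at h2
    have h3 : 0 < A .surge s₂ := by linarith [hAT .surge s₂]
    have h4 := hle hσ'
    have h5 := hQ hσ' .surge
    simp only [Function.update_self, Function.update_of_ne (show WorldState.nonsurge ≠ .surge by
      decide)] at h4 h5
    have := mul_nonneg h5.le hAn
    have := mul_pos (hQ hσ .nonsurge) h3
    linarith
  set κ := A .surge (σ .surge) / M.meanSwitch .surge (σ .surge) with hκ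
  have hκs : A .surge (σ .surge) = κ * M.meanSwitch .surge (σ .surge) :=
    (div_mul_cancel₀ _ (hQ hσ .surge).ne').symm
  have hκn : A .nonsurge (σ .nonsurge) = -κ * M.meanSwitch .nonsurge (σ .nonsurge) := by
    rw [hκs] at heq
    have h1 : M.meanSwitch .surge (σ .surge) *
        (A .nonsurge (σ .nonsurge) + κ * M.meanSwitch .nonsurge (σ .nonsurge)) = 0 := by linarith
    have := (mul_eq_zero.1 h1).resolve_left (hQ hσ .surge).ne'
    linarith
  refine ⟨κ, div_pos hAs (hQ hσ _), ?_, ?_⟩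
  · have h0 : IsPolicy (fun _ => ∅) := fun _ => ⟨isOpen_empty, empty_subset _⟩
    have := hmax' _ h0
    simpa [meanRate, meanPay] using this
  · intro i
    cases i
    · simp only [stateShift, hval]
      refine ⟨by rw [hκn]; ring, fun s hs hs0 => ?_⟩
      have h1 := hle (hσ.update .nonsurge hs hs0)
      simp only [Function.update_self, Function.update_of_ne (show WorldState.surge ≠ .nonsurge by
        decide)] at h1
      rw [hκs] at h1
      have h2 : M.meanSwitch .surge (σ .surge) *
        (A .nonsurge s + κ * M.meanSwitch .nonsurge s) ≤ 0 := by linarith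
      by_contra hc
      linarith [mul_pos (hQ hσ .surge) (not_le.1 hc)]
    · simp only [stateShift, hval]
      refine ⟨by rw [hκs]; ring, fun s hs hs0 => ?_⟩
      have h1 := hle (hσ.update .surge hs hs0)
      simp only [Function.update_self, Function.update_of_ne (show WorldState.nonsurge ≠ .surge by
        decide)] at h1
      rw [hκn] at h1
      have h2 : M.meanSwitch .nonsurge (σ .nonsurge) *
        (A .surge s + -κ * M.meanSwitch .surge s) ≤ 0 := by linarith
      by_contra hc
      linarith [mul_pos (hQ hσ .nonsurge) (not_le.1 hc)]

/-- The trip lengths that are strictly profitable. -/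
def gainSet (M : DynamicModel) (w : Pricing) (i : WorldState) (R κ : ℝ) : Set ℝ :=
  {τ | 0 < τ ∧ 0 < M.gain w i R κ τ}

theorem gainSet_subset (i : WorldState) (R κ : ℝ) : M.gainSet w i R κ ⊆ Ioi 0 := fun _ h => h.1

theorem isOpen_gainSet {i : WorldState} (hc : ContinuousOn (w i) (Ioi 0)) (R κ : ℝ) :
    IsOpen (M.gainSet w i R κ) :=
  (continuousOn_gain hc R κ).isOpen_inter_preimage isOpen_Ioi isOpen_Ioi

/-- The maximal value of an epoch: exactly the profitable trips are accepted. -/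
noncomputable def maxEpochValue (M : DynamicModel) (w : Pricing) (i : WorldState) (R κ : ℝ) : ℝ :=
  -R + κ * M.switch i + M.lam i * ∫ τ, max (M.gain w i R κ τ) 0 ∂M.F i

theorem epochValue_gainSet {i : WorldState} (hc : ContinuousOn (w i) (Ioi 0)) (R κ : ℝ) :
    M.epochValue w i R κ (M.gainSet w i R κ) = M.maxEpochValue w i R κ := by
  unfold epochValue maxEpochValue
  rw [← integral_indicator (isOpen_gainSet hc R κ).measurableSet]
  congr 2
  refine integral_congr_ae ?_
  filter_upwards [M.F_ae_pos i] with τ hτ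
  by_cases h : 0 < M.gain w i R κ τ
  · rw [indicator_of_mem (show τ ∈ M.gainSet w i R κ from ⟨hτ, h⟩), max_eq_left h.le]
  · rw [indicator_of_notMem (fun h' : τ ∈ M.gainSet w i R κ => h h'.2), max_eq_right (not_lt.1 h)]

theorem epochValue_le_max {i : WorldState} (hw : Integrable (w i) (M.F i)) (R κ : ℝ) {s : Set ℝ}
    (hs : MeasurableSet s) : M.epochValue w i R κ s ≤ M.maxEpochValue w i R κ := by
  unfold epochValue maxEpochValue
  have hi := integrable_gain hw R κ
  rw [← integral_indicator hs]
  have h1 : ∫ τ, s.indicator (M.gain w i R κ) τ ∂M.F i ≤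
      ∫ τ, max (M.gain w i R κ τ) 0 ∂M.F i := by
    refine integral_mono (hi.indicator hs) (hi.sup (integrable_const 0)) fun τ => ?_
    by_cases h : τ ∈ s
    · simp [h]
    · simp [h]
  have := mul_le_mul_of_nonneg_left h1 (M.lam_pos i).le
  linarith

theorem exists_root_maxEpochValue {i : WorldState} (hw : Integrable (w i) (M.F i)) :
    ∃ r : ℝ → ℝ, ∃ m : ℝ, 0 < m ∧ Continuous r ∧ (∀ κ, M.maxEpochValue w i (r κ) κ = 0) ∧
      ∀ κ d, 0 ≤ d → r κ + m * d ≤ r (κ + d) := by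
  have hi : ∀ R κ, Integrable (fun τ => max (M.gain w i R κ τ) 0) (M.F i) := fun R κ =>
    (integrable_gain hw R κ).sup (integrable_const 0)
  have hl := M.lam_pos i
  have hτ := M.integrable_id_F i
  have hmean : 0 ≤ ∫ τ, τ ∂M.F i :=
    integral_nonneg_of_ae ((M.F_ae_pos i).mono fun τ h => le_of_lt h)
  set K := 1 + M.lam i * ∫ τ, τ ∂M.F i with hK
  have hK0 : 0 < K := by
    have := mul_nonneg hl.le hmean
    linarith
  have v1 : ∀ R κ d, 0 ≤ d → M.maxEpochValue w i (R + d) κ ≤ M.maxEpochValue w i R κ - d := by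
    intro R κ d hd
    unfold maxEpochValue
    have : ∫ τ, max (M.gain w i (R + d) κ τ) 0 ∂M.F i ≤ ∫ τ, max (M.gain w i R κ τ) 0 ∂M.F i := by
      refine integral_mono_ae (hi _ _) (hi _ _) ?_
      filter_upwards [M.F_ae_pos i] with τ hτ
      refine max_le_max ?_ le_rfl
      unfold gain
      nlinarith [mul_nonneg hd hτ.le]
    linarith [mul_le_mul_of_nonneg_left this hl.le]
  have v2 : ∀ R κ d, 0 ≤ d → M.maxEpochValue w i R κ - K * d ≤ M.maxEpochValue w i (R + d) κ := by
    intro R κ d hd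
    unfold maxEpochValue
    have : ∫ τ, max (M.gain w i R κ τ) 0 ∂M.F i - d * ∫ τ, τ ∂M.F i ≤
        ∫ τ, max (M.gain w i (R + d) κ τ) 0 ∂M.F i := by
      rw [← integral_const_mul, ← integral_sub (hi _ _) (hτ.const_mul d)]
      refine integral_mono_ae ((hi _ _).sub (hτ.const_mul d)) (hi _ _) ?_
      filter_upwards [M.F_ae_pos i] with τ hτ
      have h0 := mul_nonneg hd hτ.le
      have h1 : M.gain w i (R + d) κ τ = M.gain w i R κ τ - d * τ := by unfold gain; ring
      simp only [h1]
      rcases le_total (M.gain w i R κ τ) 0 with h | h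
      · rw [max_eq_right h]
        linarith [le_max_right (M.gain w i R κ τ - d * τ) 0]
      · rw [max_eq_left h]
        exact le_max_left _ _
    have := mul_le_mul_of_nonneg_left this hl.le
    rw [hK]
    linarith
  have v3 : ∀ R κ d, 0 ≤ d → M.maxEpochValue w i R κ + M.switch i * d ≤ M.maxEpochValue w i R (κ + d) := by
    intro R κ d hd
    unfold maxEpochValue
    have : ∫ τ, max (M.gain w i R κ τ) 0 ∂M.F i ≤ ∫ τ, max (M.gain w i R (κ + d) τ) 0 ∂M.F i := by
      refine integral_mono_ae (hi _ _) (hi _ _) ?_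
      filter_upwards [M.F_ae_pos i] with τ hτ
      refine max_le_max ?_ le_rfl
      unfold gain
      nlinarith [mul_nonneg hd (M.transitionProb_nonneg i hτ.le)]
    linarith [mul_le_mul_of_nonneg_left this hl.le]
  have v4 : ∀ R κ d, 0 ≤ d → M.maxEpochValue w i R (κ + d) ≤ M.maxEpochValue w i R κ + (M.switch i + M.lam i) * d := by
    intro R κ d hd
    unfold maxEpochValue
    have : ∫ τ, max (M.gain w i R (κ + d) τ) 0 ∂M.F i ≤
        ∫ τ, max (M.gain w i R κ τ) 0 ∂M.F i + d := by
      have hc : ∫ _, d ∂M.F i = d := by simp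
      have hadd := integral_add (hi R κ) (integrable_const (μ := M.F i) d)
      rw [hc] at hadd
      rw [← hadd]
      refine integral_mono (hi _ _) ((hi _ _).add (integrable_const d)) fun τ => ?_
      have h1 : M.gain w i R (κ + d) τ = M.gain w i R κ τ + d * M.transitionProb i τ := by
        unfold gain; ring
      have h2 := mul_le_of_le_one_right hd (M.transitionProb_le_one i τ)
      refine max_le ?_ ?_
      · linarith [le_max_left (M.gain w i R κ τ) 0]
      · linarith [le_max_right (M.gain w i R κ τ) 0]
    linarith [mul_le_mul_of_nonneg_left this hl.le]
  obtain ⟨r, h1, h2, h3⟩ := exists_implicit_root hK0 (M.switch_pos i) v1 v2 v3 v4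
  exact ⟨r, _, div_pos (M.switch_pos i) hK0, h1, h2, h3⟩

/-- An optimal policy exists: the curves in the `(κ, R)`-plane along which the best epoch in state 1,
respectively state 2, has value zero are increasing, respectively decreasing, and they cross. -/
theorem exists_isOptimal (hA : M.IsAdmissible w) : ∃ σ, M.IsOptimal w σ := by
  obtain ⟨r, m, hm, hr, hr0, hslope⟩ := exists_root_maxEpochValue (hA.2.1 .nonsurge)
  obtain ⟨r', m', hm', hr', hr0', hslope'⟩ := exists_root_maxEpochValue (hA.2.1 .surge)
  obtain ⟨κ, hκ⟩ := exists_root_of_slope_le hm (f := fun κ => r' (-κ) - r κ)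
    ((hr'.comp continuous_neg).sub hr) fun κ d hd => by
      have h1 := hslope κ d hd
      have h2 := hslope' (-(κ + d)) d hd
      rw [show -(κ + d) + d = -κ by ring] at h2
      have : 0 ≤ m' * d := by positivity
      linarith
  have hκ' : r' (-κ) = r κ := sub_eq_zero.1 hκ
  have hV : ∀ i, M.maxEpochValue w i (r κ) (stateShift κ i) = 0 := by
    intro i
    cases i
    · exact hr0 κ
    · change M.maxEpochValue w .surge (r κ) (-κ) = 0
      rw [← hκ']
      exact hr0' (-κ)
  have hσ : IsPolicy fun i => M.gainSet w i (r κ) (stateShift κ i) := fun i =>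
    ⟨isOpen_gainSet (hA.1 i) _ _, gainSet_subset _ _ _⟩
  refine ⟨_, Certifies.isOptimal hA hσ (R := r κ) (κ := κ) fun i => ⟨?_, fun s hs _ => ?_⟩⟩
  · rw [epochValue_gainSet (hA.1 i), hV i]
  · rw [← hV i]
    exact epochValue_le_max (hA.2.1 i) _ _ hs.measurableSet

/-- A certified policy accepts almost all strictly profitable trips and almost no strictly
unprofitable ones. -/
theorem Certifies.ae_mem_iff (hA : M.IsAdmissible w) {σ : Policy} (hσ : IsPolicy σ) {R κ : ℝ}
    (h : M.Certifies w σ R κ) (i : WorldState) :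
    ∀ᵐ τ ∂M.F i, M.gain w i R (stateShift κ i) τ ≠ 0 →
      (τ ∈ σ i ↔ 0 < M.gain w i R (stateShift κ i) τ) := by
  set g := M.gain w i R (stateShift κ i) with hg
  have hi : Integrable g (M.F i) := integrable_gain (hA.2.1 i) _ _
  have hs : MeasurableSet (σ i) := (hσ i).1.measurableSet
  have hG : MeasurableSet (M.gainSet w i R (stateShift κ i)) :=
    (isOpen_gainSet (hA.1 i) _ _).measurableSet
  have h1 := (h i).1
  have h2 := (h i).2 (M.gainSet w i R (stateShift κ i)) (isOpen_gainSet (hA.1 i) _ _)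
    (gainSet_subset _ _ _)
  have h3 : ∫ τ in M.gainSet w i R (stateShift κ i), g τ ∂M.F i ≤ ∫ τ in σ i, g τ ∂M.F i := by
    rw [← h1] at h2
    unfold epochValue at h2
    exact le_of_mul_le_mul_left (by linarith) (M.lam_pos i)
  rw [← integral_indicator hs, ← integral_indicator hG] at h3
  have h4 : 0 ≤ᵐ[M.F i] fun τ => (M.gainSet w i R (stateShift κ i)).indicator g τ -
      (σ i).indicator g τ := by
    filter_upwards [M.F_ae_pos i] with τ hτ
    by_cases ha : 0 < g τ
    · have : τ ∈ M.gainSet w i R (stateShift κ i) := ⟨hτ, ha⟩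
      by_cases hb : τ ∈ σ i <;> simp [this, hb, ha.le]
    · have : τ ∉ M.gainSet w i R (stateShift κ i) := fun h => ha h.2
      by_cases hb : τ ∈ σ i <;> simp [this, hb, not_lt.1 ha]
  have h5 := integral_sub (hi.indicator hG) (hi.indicator hs)
  have h6 := (integral_eq_zero_iff_of_nonneg_ae h4 ((hi.indicator hG).sub (hi.indicator hs))).1
    (le_antisymm (by linarith) (integral_nonneg_of_ae h4))
  filter_upwards [h6, M.F_ae_pos i] with τ h7 hτ hne
  simp only [Pi.zero_apply] at h7
  by_cases ha : 0 < g τ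
  · have : τ ∈ M.gainSet w i R (stateShift κ i) := ⟨hτ, ha⟩
    by_cases hb : τ ∈ σ i
    · exact ⟨fun _ => ha, fun _ => hb⟩
    · simp [this, hb, hne] at h7
  · have : τ ∉ M.gainSet w i R (stateShift κ i) := fun h => ha h.2
    by_cases hb : τ ∈ σ i
    · simp [this, hb, hne] at h7
    · exact ⟨fun h => absurd h hb, fun h => absurd h ha⟩

/-- Conversely, a policy that treats almost all trips that are not break-even in this way is certified
as well, whatever it does with the break-even trips. -/
theorem Certifies.of_ae_mem_iff (hA : M.IsAdmissible w) {σ σ' : Policy} (hσ : IsPolicy σ)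
    (hσ' : IsPolicy σ') {R κ : ℝ} (h : M.Certifies w σ R κ)
    (h' : ∀ i, ∀ᵐ τ ∂M.F i, M.gain w i R (stateShift κ i) τ ≠ 0 →
      (τ ∈ σ' i ↔ 0 < M.gain w i R (stateShift κ i) τ)) : M.Certifies w σ' R κ := by
  refine fun i => ⟨?_, (h i).2⟩
  rw [← (h i).1]
  unfold epochValue
  rw [← integral_indicator (hσ i).1.measurableSet, ← integral_indicator (hσ' i).1.measurableSet]
  congr 2
  refine integral_congr_ae ?_
  filter_upwards [h' i, h.ae_mem_iff hA hσ i] with τ h1 h2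
  by_cases h0 : M.gain w i R (stateShift κ i) τ = 0
  · simp [indicator, h0]
  · simp only [indicator, h1 h0, h2 h0]

end DynamicModel

namespace DynamicModel

variable {M : DynamicModel} {w : Pricing}

/-! ### Policies whose upper endpoints all carry a positive derivative -/

theorem meanRate_sub_other (hw : ∀ i, Integrable (w i) (M.F i)) {σ : Policy} (hσ : IsPolicy σ)
    (i : WorldState) (R κ : ℝ) :
    M.meanRate w σ - R =
      (M.meanSwitch i.other (σ i.other) * M.epochValue w i R κ (σ i) +
        M.meanSwitch i (σ i) * M.epochValue w i.other R (-κ) (σ i.other)) /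
      (M.meanSwitch i.other (σ i.other) * M.meanTime i (σ i) +
        M.meanSwitch i (σ i) * M.meanTime i.other (σ i.other)) := by
  cases i
  · exact meanRate_sub hw hσ R κ
  · rw [meanRate_sub hw hσ R (-κ), neg_neg]
    simp only [WorldState.other]
    congr 1 <;> ring

/-- A loss of `y` in the value of an epoch in state `i` lowers the earnings rate by at most `y`. -/
theorem sub_le_meanRate (hw : ∀ i, Integrable (w i) (M.F i)) {σ : Policy} (hσ : IsPolicy σ)
    {i : WorldState} {R κ y : ℝ} (h : M.epochValue w i.other R (-κ) (σ i.other) = 0) (hy : 0 ≤ y)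
    (h' : -y ≤ M.epochValue w i R κ (σ i)) : R - y ≤ M.meanRate w σ := by
  have hQ : ∀ i, 0 < M.meanSwitch i (σ i) := fun i =>
    M.meanSwitch_pos i (hσ i).1.measurableSet (hσ i).2
  have hT : ∀ i, 1 ≤ M.meanTime i (σ i) := fun i =>
    M.one_le_meanTime i (hσ i).1.measurableSet (hσ i).2
  have h1 := meanRate_sub_other hw hσ i R κ
  rw [h, mul_zero, add_zero] at h1
  have h2 : M.meanSwitch i.other (σ i.other) ≤
      M.meanSwitch i.other (σ i.other) * M.meanTime i (σ i) +
        M.meanSwitch i (σ i) * M.meanTime i.other (σ i.other) := by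
    have := le_mul_of_one_le_right (hQ i.other).le (hT i)
    have := mul_nonneg (hQ i).le (zero_le_one.trans (hT i.other))
    linarith
  have h3 : -y ≤ M.meanRate w σ - R := by
    rw [h1, le_div_iff₀ ((hQ i.other).trans_le h2)]
    have := mul_le_mul_of_nonneg_left h' (hQ i.other).le
    have := mul_le_mul_of_nonneg_left h2 hy
    linarith
  linarith

theorem F_real_le {i : WorldState} {C : ℝ} (hC : ∀ τ, M.density i τ ≤ C) {s : Set ℝ}
    (hs : MeasurableSet s) (hv : volume s ≠ ⊤) : (M.F i).real s ≤ C * volume.real s := by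
  have hC0 : 0 ≤ C := (M.density_nonneg i 0).trans (hC 0)
  have h : M.F i s ≤ ENNReal.ofReal C * volume s := by
    rw [F, withDensity_apply _ hs, ← setLIntegral_const]
    exact setLIntegral_mono measurable_const fun τ _ => ENNReal.ofReal_le_ofReal (hC τ)
  have := ENNReal.toReal_mono (ENNReal.mul_ne_top ENNReal.ofReal_ne_top hv) h
  rwa [ENNReal.toReal_mul, ENNReal.toReal_ofReal hC0] at this

/-- If trips of length `u` are not profitable, then removing the trips just below `u` does not lower
the earnings rate to first order. -/
theorem not_hasDerivWithinAt_of_gain_nonpos (hA : M.IsAdmissible w) {σ : Policy} (hσ : IsPolicy σ)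
    {i : WorldState} {l u κ : ℝ} (hl : 0 ≤ l) (hlu : l < u) (hI : Ioo l u ⊆ σ i) (hu : u ∉ σ i)
    (hκ : M.epochValue w i.other (M.meanRate w σ) (-κ) (σ i.other) = 0)
    (hg : M.gain w i (M.meanRate w σ) κ u ≤ 0) {d : ℝ} (hd : 0 < d) :
    ¬ HasDerivWithinAt (fun v : ℝ =>
      M.earningsRate w (Function.update σ i (σ i \ Icc v u))) d (Iic u) u := by
  intro hder
  have hw := hA.2.1
  set R := M.meanRate w σ with hR
  set φ : ℝ → ℝ := fun v => M.earningsRate w (Function.update σ i (σ i \ Icc v u)) with hφ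
  obtain ⟨C, hC⟩ := M.density_bounded i
  have hC0 : 0 ≤ C := (M.density_nonneg i 0).trans (hC 0)
  have hlam := M.lam_pos i
  have hio : i.other ≠ i := by cases i <;> decide
  have hpol : ∀ v, IsPolicy (Function.update σ i (σ i \ Icc v u)) := fun v =>
    hσ.update i ((hσ i).1.sdiff isClosed_Icc) (sdiff_subset.trans (hσ i).2)
  have hφu : φ u = R := by
    simp only [hφ, Icc_self, sdiff_singleton_eq_self hu, Function.update_eq_self]
    rw [M.earningsRate_eq_meanRate hA.1 hw hσ]
  have hval0 : M.epochValue w i R κ (σ i) = 0 := by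
    have h1 := meanRate_sub_other hw hσ i R κ
    have hQ : ∀ i, 0 < M.meanSwitch i (σ i) := fun i =>
      M.meanSwitch_pos i (hσ i).1.measurableSet (hσ i).2
    have hT : ∀ i, 0 < M.meanTime i (σ i) := fun i =>
      M.meanTime_pos i (hσ i).1.measurableSet (hσ i).2
    rw [hκ, mul_zero, add_zero, ← hR, sub_self, eq_comm, div_eq_zero_iff] at h1
    have h2 := h1.resolve_right
      (add_pos (mul_pos (hQ _) (hT _)) (mul_pos (hQ _) (hT _))).ne'
    exact (mul_eq_zero.1 h2).resolve_left (hQ _).ne'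
  obtain ⟨ε, hε, hεd⟩ := exists_pos_mul_lt hd (M.lam i * C)
  -- the gain is below `ε` just below `u`
  have hcont : ∀ᶠ v in 𝓝[<] u, ∀ τ ∈ Ico v u, M.gain w i R κ τ ≤ ε := by
    have h1 : ContinuousAt (M.gain w i R κ) u :=
      (continuousOn_gain (hA.1 i) R κ).continuousAt (Ioi_mem_nhds (hl.trans_lt hlu))
    have h2 : ∀ᶠ τ in 𝓝 u, M.gain w i R κ τ < ε := h1.eventually_lt_const (hg.trans_lt hε)
    obtain ⟨a, b, hab, hsub⟩ := mem_nhds_iff_exists_Ioo_subset.1 h2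
    filter_upwards [Ioo_mem_nhdsLT hab.1] with v hv τ hτ
    exact (hsub ⟨hv.1.trans_le hτ.1, hτ.2.trans hab.2⟩ : M.gain w i R κ τ < ε).le
  have hslope : ∀ᶠ v in 𝓝[<] u, slope φ u v ≤ M.lam i * C * ε := by
    filter_upwards [hcont, Ioo_mem_nhdsLT hlu] with v hv hlv
    have hint := integrable_gain (M := M) (hw i) R κ
    have hIco : Ico v u ⊆ σ i := fun τ hτ => hI ⟨hlv.1.trans_le hτ.1, hτ.2⟩
    have hset : σ i \ Icc v u = σ i \ Ico v u := by
      ext τ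
      simp only [Set.mem_sdiff, mem_Icc, mem_Ico, not_and, not_le, not_lt]
      refine and_congr_right fun hτ => ⟨fun h h' => (h h').le, fun h h' => ?_⟩
      exact lt_of_le_of_ne (h h') fun h'' => hu (h'' ▸ hτ)
    have h1 : ∫ τ in Ico v u, M.gain w i R κ τ ∂M.F i ≤ C * ε * (u - v) := by
      have h2 : ∫ τ in Ico v u, M.gain w i R κ τ ∂M.F i ≤ ∫ _ in Ico v u, ε ∂M.F i :=
        setIntegral_mono_on hint.integrableOn (integrable_const ε).integrableOn
          measurableSet_Ico hv
      rw [setIntegral_const, smul_eq_mul] at h2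
      have h3 := F_real_le hC (measurableSet_Ico (a := v) (b := u)) (by simp)
      rw [Real.volume_real_Ico_of_le hlv.2.le] at h3
      have := mul_le_mul_of_nonneg_right h3 hε.le
      linarith
    have h4 : -(M.lam i * C * ε * (u - v)) ≤ M.epochValue w i R κ (σ i \ Icc v u) := by
      rw [hset]
      have h5 : ∫ τ in σ i \ Ico v u, M.gain w i R κ τ ∂M.F i =
          ∫ τ in σ i, M.gain w i R κ τ ∂M.F i - ∫ τ in Ico v u, M.gain w i R κ τ ∂M.F i :=
        setIntegral_sdiff measurableSet_Ico hint.integrableOn hIco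
      unfold epochValue at hval0 ⊢
      rw [h5]
      have := mul_le_mul_of_nonneg_left h1 hlam.le
      linarith
    have h6 : R - M.lam i * C * ε * (u - v) ≤ φ v := by
      simp only [hφ]
      rw [M.earningsRate_eq_meanRate hA.1 hw (hpol v)]
      have huv : 0 ≤ u - v := by linarith [hlv.2]
      refine sub_le_meanRate hw (hpol v) (i := i) (κ := κ) ?_ (by positivity) ?_
      · rwa [Function.update_of_ne hio]
      · rwa [Function.update_self]
    rw [slope_def_field, hφu, div_le_iff_of_neg (by linarith [hlv.2])]
    linarith
  have htend := (hasDerivWithinAt_iff_tendsto_slope.1 hder)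
  rw [Iic_sdiff_right] at htend
  exact absurd (le_of_tendsto htend hslope) (not_le.2 hεd)

theorem stateShift_other (κ : ℝ) (i : WorldState) : stateShift κ i.other = -stateShift κ i := by
  cases i <;> simp [stateShift, WorldState.other]

/-- If some `u` with `f_i(u) > 0` had a negative gain, the derivative at the upper endpoint `u` of a
slightly enlarged optimal policy would be nonpositive. -/
theorem gain_nonneg_of_upperDerivPos (hA : M.IsAdmissible w) {σ : Policy} (hσ : IsPolicy σ)
    {R κ : ℝ} (h : M.Certifies w σ R κ) {i : WorldState} (hU : M.UpperDerivPos w i) {u : ℝ}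
    (hu : 0 < u) (hf : 0 < M.density i u) : 0 ≤ M.gain w i R (stateShift κ i) u := by
  by_contra! hneg
  have hw := hA.2.1
  set g := M.gain w i R (stateShift κ i) with hg
  have hio : i.other ≠ i := by cases i <;> decide
  have hj : M.epochValue w i.other R (-stateShift κ i) (σ i.other) = 0 := by
    rw [← stateShift_other]
    exact (h i.other).1
  obtain ⟨C, hC⟩ := M.density_bounded i
  have hC0 : 0 ≤ C := (M.density_nonneg i 0).trans (hC 0)
  have hlam := M.lam_pos i
  have hcg : ContinuousOn g (Icc (u / 2) u) :=
    (continuousOn_gain (hA.1 i) _ _).mono fun τ hτ => lt_of_lt_of_le (by positivity) hτ.1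
  obtain ⟨B, hB⟩ := isCompact_Icc.exists_bound_of_continuousOn hcg
  have hB0 : 0 ≤ B := (norm_nonneg _).trans (hB u ⟨by linarith, le_rfl⟩)
  have hQ := M.meanSwitch_pos i.other (hσ i.other).1.measurableSet (hσ i.other).2
  have hT := M.meanTime_pos i.other (hσ i.other).1.measurableSet (hσ i.other).2
  set T := M.meanTime i.other (σ i.other) with hTdef
  set Q := M.meanSwitch i.other (σ i.other) with hQdef
  have hq := M.transitionProb_nonneg i hu.le
  set K := u + T / Q * M.transitionProb i u with hK
  have hK0 : 0 ≤ K := by positivity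
  obtain ⟨ε₀, hε₀, hε₀g⟩ := exists_pos_mul_lt (neg_pos.2 hneg) (M.lam i * (B * C) * K)
  set ε := min ε₀ (u / 2) with hε
  have hεpos : 0 < ε := lt_min hε₀ (by positivity)
  have hεu : ε ≤ u / 2 := min_le_right _ _
  have hεg : M.lam i * (B * C) * K * ε < -g u :=
    (mul_le_mul_of_nonneg_left (min_le_left _ _) (by positivity)).trans_lt hε₀g
  set s := σ i \ {u} ∪ Ioo (u - ε) u with hs
  have hso : IsOpen s := ((hσ i).1.sdiff isClosed_singleton).union isOpen_Ioo
  have hs0 : s ⊆ Ioi 0 := by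
    refine union_subset (sdiff_subset.trans (hσ i).2) fun τ hτ => ?_
    have := hτ.1
    exact mem_Ioi.2 (by linarith)
  have hus : u ∉ s := by simp [hs]
  have hσ' := hσ.update i hso hs0
  set σ' := Function.update σ i s with hσ'def
  have hσ'i : σ' i = s := Function.update_self ..
  have hσ'j : σ' i.other = σ i.other := Function.update_of_ne hio _ _
  -- enlarging the policy costs at most a multiple of `ε`
  have hsval : -(M.lam i * (B * C) * ε) ≤ M.epochValue w i R (stateShift κ i) s := by
    have hint := integrable_gain (M := M) (hw i) R (stateShift κ i)
    have h1 : ∫ τ in s, g τ ∂M.F i =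
        ∫ τ in σ i, g τ ∂M.F i + ∫ τ in Ioo (u - ε) u \ σ i, g τ ∂M.F i := by
      have h2 : s = σ i \ {u} ∪ (Ioo (u - ε) u \ σ i) := by
        ext τ
        simp only [hs, mem_union, Set.mem_sdiff, mem_singleton_iff, mem_Ioo]
        constructor
        · rintro (⟨a, b⟩ | ⟨a, b⟩)
          · exact Or.inl ⟨a, b⟩
          · by_cases hτ : τ ∈ σ i
            · exact Or.inl ⟨hτ, b.ne⟩
            · exact Or.inr ⟨⟨a, b⟩, hτ⟩
        · rintro (⟨a, b⟩ | ⟨⟨a, b⟩, c⟩)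
          · exact Or.inl ⟨a, b⟩
          · exact Or.inr ⟨a, b⟩
      have h3 : (σ i \ {u} : Set ℝ) =ᵐ[M.F i] σ i :=
        sdiff_null_ae_eq_self (M.F_absolutelyContinuous i (measure_singleton u))
      rw [h2, setIntegral_union (disjoint_left.2 fun τ a b => b.2 a.1)
        (measurableSet_Ioo.diff (hσ i).1.measurableSet) hint.integrableOn hint.integrableOn,
        setIntegral_congr_set h3]
    have h4 : -(B * C * ε) ≤ ∫ τ in Ioo (u - ε) u \ σ i, g τ ∂M.F i := by
      have h5 := norm_setIntegral_le_of_norm_le_const (μ := M.F i) (f := g)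
        (s := Ioo (u - ε) u \ σ i) (C := B) (measure_lt_top _ _)
        fun τ hτ => hB τ ⟨by linarith [hτ.1.1], hτ.1.2.le⟩
      have h6 : (M.F i).real (Ioo (u - ε) u \ σ i) ≤ C * ε := by
        refine (measureReal_mono sdiff_subset).trans ?_
        have := F_real_le hC (measurableSet_Ioo (a := u - ε) (b := u)) (by simp)
        rwa [Real.volume_real_Ioo_of_le (by linarith), sub_sub_cancel] at this
      have h7 := mul_le_mul_of_nonneg_left h6 hB0
      rw [Real.norm_eq_abs] at h5
      have := (abs_le.1 h5).1
      linarith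
    have h0 := (h i).1
    unfold epochValue at h0 ⊢
    rw [← hg] at h0 ⊢
    rw [h1]
    have := mul_le_mul_of_nonneg_left h4 hlam.le
    linarith
  set R' := M.meanRate w σ' with hR'
  have hRR' : R - M.lam i * (B * C) * ε ≤ R' := by
    refine sub_le_meanRate hw hσ' (i := i) (κ := stateShift κ i) ?_ (by positivity) ?_
    · rwa [hσ'j]
    · rwa [hσ'i]
  -- the value of a switch relative to the new earnings rate
  set κ' := stateShift κ i + (R - R') * (T / Q) with hκ'
  have hj' : M.epochValue w i.other R' (-κ') (σ' i.other) = 0 := by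
    rw [hσ'j]
    rw [epochValue_eq (hw _)] at hj ⊢
    rw [← hTdef, ← hQdef] at hj ⊢
    have : T / Q * Q = T := div_mul_cancel₀ _ hQ.ne'
    rw [hκ']
    linear_combination hj - (R - R') * this
  have hg' : M.gain w i R' κ' u ≤ 0 := by
    have h1 : M.gain w i R' κ' u = g u + (R - R') * K := by
      rw [hg, hK, hκ']
      unfold gain
      ring
    have h2 : (R - R') * K ≤ M.lam i * (B * C) * ε * K :=
      mul_le_mul_of_nonneg_right (by linarith) hK0
    rw [h1]
    linarith
  obtain ⟨d, hd, hder⟩ := hU σ' hσ' (u - ε) u (by linarith) (by linarith)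
    (by rw [hσ'i]; exact subset_union_right) (by rwa [hσ'i]) hf
  exact not_hasDerivWithinAt_of_gain_nonpos hA hσ' (l := u - ε) (by linarith) (by linarith)
    (by rw [hσ'i]; exact subset_union_right) (by rwa [hσ'i]) hj' hg' hd hder

/-- The gain cannot vanish at `u` either: as it is nonnegative, `(0, ∞) \ {u}` is optimal, and the
derivative at its upper endpoint `u` would be zero. -/
theorem gain_pos_of_upperDerivPos (hA : M.IsAdmissible w) {σ : Policy} (hσ : IsPolicy σ)
    {R κ : ℝ} (h : M.Certifies w σ R κ) {i : WorldState} (hU : M.UpperDerivPos w i) {u : ℝ}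
    (hu : 0 < u) (hf : 0 < M.density i u) : 0 < M.gain w i R (stateShift κ i) u := by
  by_contra hneg
  have hio : i.other ≠ i := by cases i <;> decide
  have hso : IsOpen (Ioi 0 \ {u} : Set ℝ) := isOpen_Ioi.sdiff isClosed_singleton
  have hσ' := hσ.update i hso sdiff_subset
  set σ' := Function.update σ i (Ioi 0 \ {u}) with hσ'def
  have hσ'i : σ' i = Ioi 0 \ {u} := Function.update_self ..
  have hσ'j : σ' i.other = σ i.other := Function.update_of_ne hio _ _
  have hcert : M.Certifies w σ' R κ := by
    refine h.of_ae_mem_iff hA hσ hσ' fun j => ?_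
    rcases eq_or_ne j i with rfl | hj
    · have hne : ∀ᵐ τ ∂M.F j, τ ≠ u :=
        (M.F_absolutelyContinuous j).ae_le (Measure.ae_ne volume u)
      filter_upwards [hne, M.F_ae_pos j, M.F_ae_density_pos j] with τ h1 h2 h3 h4
      have h5 := gain_nonneg_of_upperDerivPos hA hσ h hU h2 h3
      rw [hσ'i]
      exact ⟨fun _ => lt_of_le_of_ne h5 h4.symm, fun _ => ⟨h2, h1⟩⟩
    · have hj' : σ' j = σ j := Function.update_of_ne hj _ _
      rw [hj']
      exact h.ae_mem_iff hA hσ j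
  have hrate := hcert.meanRate_eq hA.2.1 hσ'
  have hI : Ioo 0 u ⊆ σ' i := by
    rw [hσ'i]
    exact fun τ hτ => ⟨hτ.1, hτ.2.ne⟩
  have hu' : u ∉ σ' i := by rw [hσ'i]; simp
  obtain ⟨d, hd, hder⟩ := hU σ' hσ' 0 u le_rfl hu hI hu' hf
  refine not_hasDerivWithinAt_of_gain_nonpos hA hσ' (κ := stateShift κ i) le_rfl hu hI hu' ?_ ?_ hd
    hder
  · rw [hrate, ← stateShift_other]
    exact (hcert i.other).1
  · rw [hrate]
    exact not_lt.1 hneg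

end DynamicModel

/-! ### Intervals of trip lengths -/

theorem tripInterval_zero_top : tripInterval 0 ⊤ = Ioi 0 := by
  ext τ
  simp [tripInterval]

theorem tripInterval_top_top : tripInterval ⊤ ⊤ = ∅ := by
  ext τ
  simp [tripInterval]

theorem tripInterval_eq_Ioo {a b : ℝ≥0∞} (ha : a ≠ ⊤) (hb : b ≠ ⊤) :
    tripInterval a b = Ioo a.toReal b.toReal := by
  ext τ
  simp only [tripInterval, mem_ofPred_eq, mem_Ioo]
  constructor
  · rintro ⟨h0, h1, h2⟩
    exact ⟨(ENNReal.lt_ofReal_iff_toReal_lt ha).1 h1, (ENNReal.ofReal_lt_iff_lt_toReal h0.le hb).1 h2⟩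
  · rintro ⟨h1, h2⟩
    have h0 : 0 < τ := ENNReal.toReal_nonneg.trans_lt h1
    exact ⟨h0, (ENNReal.lt_ofReal_iff_toReal_lt ha).2 h1,
      (ENNReal.ofReal_lt_iff_lt_toReal h0.le hb).2 h2⟩

theorem tripInterval_eq_Ioi {a : ℝ≥0∞} (ha : a ≠ ⊤) : tripInterval a ⊤ = Ioi a.toReal := by
  ext τ
  simp only [tripInterval, mem_ofPred_eq, mem_Ioi]
  constructor
  · rintro ⟨h0, h1, -⟩
    exact (ENNReal.lt_ofReal_iff_toReal_lt ha).1 h1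
  · intro h1
    exact ⟨ENNReal.toReal_nonneg.trans_lt h1, (ENNReal.lt_ofReal_iff_toReal_lt ha).2 h1,
      ENNReal.ofReal_lt_top⟩

theorem exists_lt_mem_of_isOpen {S : Set ℝ} (hS : IsOpen S) {τ : ℝ} (hτ : τ ∈ S) :
    ∃ x ∈ S, x < τ := by
  obtain ⟨a, b, hab, h⟩ := mem_nhds_iff_exists_Ioo_subset.1 (hS.mem_nhds hτ)
  obtain ⟨x, hx⟩ := exists_between hab.1
  exact ⟨x, h ⟨hx.1, hx.2.trans hab.2⟩, hx.2⟩

theorem exists_gt_mem_of_isOpen {S : Set ℝ} (hS : IsOpen S) {τ : ℝ} (hτ : τ ∈ S) :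
    ∃ x ∈ S, τ < x := by
  obtain ⟨a, b, hab, h⟩ := mem_nhds_iff_exists_Ioo_subset.1 (hS.mem_nhds hτ)
  obtain ⟨x, hx⟩ := exists_between hab.2
  exact ⟨x, h ⟨hab.1.trans hx.1, hx.2⟩, hx.1⟩

/-- Open order-connected sets of trip lengths are intervals; the endpoints are the infimum and the
supremum in `[0, ∞]`, which also covers the empty set. -/
theorem exists_eq_tripInterval {S : Set ℝ} (hS : IsOpen S) (h0 : S ⊆ Ioi 0)
    (hconn : ∀ x ∈ S, ∀ z ∈ S, ∀ y, x < y → y < z → y ∈ S) :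
    S = tripInterval (sInf (ENNReal.ofReal '' S)) (sSup (ENNReal.ofReal '' S)) := by
  ext τ
  constructor
  · intro hτ
    obtain ⟨x, hx, hxτ⟩ := exists_lt_mem_of_isOpen hS hτ
    obtain ⟨z, hz, hτz⟩ := exists_gt_mem_of_isOpen hS hτ
    have hτ0 : 0 < τ := h0 hτ
    refine ⟨hτ0, ?_, ?_⟩
    · exact (sInf_le (mem_image_of_mem _ hx)).trans_lt ((ENNReal.ofReal_lt_ofReal_iff hτ0).2 hxτ)
    · exact ((ENNReal.ofReal_lt_ofReal_iff (hτ0.trans hτz)).2 hτz).trans_le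
        (le_sSup (mem_image_of_mem _ hz))
  · rintro ⟨hτ0, h1, h2⟩
    obtain ⟨_, ⟨x, hx, rfl⟩, hx'⟩ := sInf_lt_iff.1 h1
    obtain ⟨_, ⟨z, hz, rfl⟩, hz'⟩ := lt_sSup_iff.1 h2
    exact hconn x hx z hz τ ((ENNReal.ofReal_lt_ofReal_iff hτ0).1 hx')
      ((ENNReal.ofReal_lt_ofReal_iff (h0 hz)).1 hz')

theorem exists_eq_tripInterval_zero {S : Set ℝ} (hS : IsOpen S) (h0 : S ⊆ Ioi 0)
    (hdown : ∀ z ∈ S, ∀ y, 0 < y → y < z → y ∈ S) : ∃ b, S = tripInterval 0 b := by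
  refine ⟨sSup (ENNReal.ofReal '' S), ?_⟩
  ext τ
  constructor
  · intro hτ
    obtain ⟨z, hz, hτz⟩ := exists_gt_mem_of_isOpen hS hτ
    have hτ0 : 0 < τ := h0 hτ
    exact ⟨hτ0, ENNReal.ofReal_pos.2 hτ0,
      ((ENNReal.ofReal_lt_ofReal_iff (hτ0.trans hτz)).2 hτz).trans_le
        (le_sSup (mem_image_of_mem _ hz))⟩
  · rintro ⟨hτ0, -, h2⟩
    obtain ⟨_, ⟨z, hz, rfl⟩, hz'⟩ := lt_sSup_iff.1 h2
    exact hdown z hz τ hτ0 ((ENNReal.ofReal_lt_ofReal_iff (h0 hz)).1 hz')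

theorem exists_eq_tripInterval_top {S : Set ℝ} (hS : IsOpen S) (h0 : S ⊆ Ioi 0)
    (hup : ∀ x ∈ S, ∀ y, x < y → y ∈ S) : ∃ a, S = tripInterval a ⊤ := by
  refine ⟨sInf (ENNReal.ofReal '' S), ?_⟩
  ext τ
  constructor
  · intro hτ
    obtain ⟨x, hx, hxτ⟩ := exists_lt_mem_of_isOpen hS hτ
    have hτ0 : 0 < τ := h0 hτ
    exact ⟨hτ0, (sInf_le (mem_image_of_mem _ hx)).trans_lt
      ((ENNReal.ofReal_lt_ofReal_iff hτ0).2 hxτ), ENNReal.ofReal_lt_top⟩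
  · rintro ⟨hτ0, h1, -⟩
    obtain ⟨_, ⟨x, hx, rfl⟩, hx'⟩ := sInf_lt_iff.1 h1
    exact hup x hx τ ((ENNReal.ofReal_lt_ofReal_iff hτ0).1 hx')

/-- An open set of trip lengths whose complement is order-connected is the union of its largest
initial and its largest final interval. -/
theorem exists_eq_tripInterval_union {S : Set ℝ} (hS : IsOpen S) (h0 : S ⊆ Ioi 0)
    (hconn : ∀ x, 0 < x → x ∉ S → ∀ z, z ∉ S → ∀ y, x < y → y < z → y ∉ S) :
    ∃ a b, S = tripInterval 0 a ∪ tripInterval b ⊤ := by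
  let L : Set ℝ := {τ | 0 < τ ∧ ∀ x, 0 < x → x ≤ τ → x ∈ S}
  let U : Set ℝ := {τ | 0 < τ ∧ ∀ x, τ ≤ x → x ∈ S}
  have hLS : L ⊆ S := fun τ h => h.2 τ h.1 le_rfl
  have hUS : U ⊆ S := fun τ h => h.2 τ le_rfl
  have hSLU : S = L ∪ U := by
    refine Subset.antisymm (fun τ hτ => ?_) (union_subset hLS hUS)
    by_contra hc
    rw [mem_union, not_or] at hc
    have hτ0 : 0 < τ := h0 hτ
    simp only [L, U, mem_ofPred_eq, hτ0, true_and] at hc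
    push Not at hc
    obtain ⟨⟨x, hx0, hxτ, hxS⟩, z, hτz, hzS⟩ := hc
    have hxτ' : x < τ := lt_of_le_of_ne hxτ fun h => hxS (h ▸ hτ)
    have hτz' : τ < z := lt_of_le_of_ne hτz fun h => hzS (h ▸ hτ)
    exact hconn x hx0 hxS z hzS τ hxτ' hτz' hτ
  have hL : IsOpen L := by
    rw [isOpen_iff_mem_nhds]
    intro τ hτ
    obtain ⟨a, b, hab, h⟩ := mem_nhds_iff_exists_Ioo_subset.1 (hS.mem_nhds (hLS hτ))
    filter_upwards [Ioo_mem_nhds (max_lt hab.1 hτ.1) hab.2] with y hy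
    refine ⟨(le_max_right _ _).trans_lt hy.1, fun x hx hxy => ?_⟩
    rcases le_or_gt x τ with hxτ | hxτ
    · exact hτ.2 x hx hxτ
    · exact h ⟨hab.1.trans hxτ, hxy.trans_lt hy.2⟩
  have hU : IsOpen U := by
    rw [isOpen_iff_mem_nhds]
    intro τ hτ
    obtain ⟨a, b, hab, h⟩ := mem_nhds_iff_exists_Ioo_subset.1 (hS.mem_nhds (hUS hτ))
    filter_upwards [Ioo_mem_nhds (max_lt hab.1 hτ.1) hab.2] with y hy
    refine ⟨(le_max_right _ _).trans_lt hy.1, fun x hxy => ?_⟩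
    rcases le_or_gt τ x with hxτ | hxτ
    · exact hτ.2 x hxτ
    · exact h ⟨((le_max_left _ _).trans_lt hy.1).trans_le hxy, hxτ.trans hab.2⟩
  obtain ⟨a, ha⟩ := exists_eq_tripInterval_zero hL (hLS.trans h0)
    fun z hz y hy hyz => ⟨hy, fun x hx hxy => hz.2 x hx (hxy.trans hyz.le)⟩
  obtain ⟨b, hb⟩ := exists_eq_tripInterval_top hU (hUS.trans h0)
    fun x hx y hxy => ⟨hx.1.trans hxy, fun z hz => hx.2 z (hxy.le.trans hz)⟩
  exact ⟨a, b, by rw [← ha, ← hb]; exact hSLU⟩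

/-! ### The shape of the gain of affine prices -/

/-- For affine prices, the gain is an affine function plus a saturating exponential. -/
noncomputable def affineExp (α b β θ τ : ℝ) : ℝ := α * τ + b + β * (1 - Real.exp (-(θ * τ)))

theorem affineExp_zero (α b β θ : ℝ) : affineExp α b β θ 0 = b := by simp [affineExp]

theorem neg_affineExp (α b β θ τ : ℝ) : -affineExp α b β θ τ = affineExp (-α) (-b) (-β) θ τ := by
  unfold affineExp
  ring

/-- Strict concavity, in terms of three points. -/
theorem affineExp_between {α b β θ : ℝ} (hβ : 0 < β) (hθ : 0 < θ) {x y z : ℝ} (hxy : x < y)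
    (hyz : y < z) : ∃ p q : ℝ, 0 < p ∧ 0 < q ∧
      p * affineExp α b β θ x + q * affineExp α b β θ z < affineExp α b β θ y := by
  have hzx : 0 < z - x := by linarith
  set p := (z - y) / (z - x) with hp
  set q := (y - x) / (z - x) with hq
  have hp0 : 0 < p := div_pos (by linarith) hzx
  have hq0 : 0 < q := div_pos (by linarith) hzx
  have hpq : p + q = 1 := by
    rw [hp, hq, ← add_div, div_eq_one_iff_eq hzx.ne']
    ring
  have hy : p * x + q * z = y := by
    rw [hp, hq]
    field_simp
    ring
  refine ⟨p, q, hp0, hq0, ?_⟩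
  have hne : -(θ * x) ≠ -(θ * z) := by
    intro h
    have := mul_left_cancel₀ hθ.ne' (neg_injective h)
    linarith
  have h1 := strictConvexOn_exp.2 (mem_univ (-(θ * x))) (mem_univ (-(θ * z))) hne hp0 hq0 hpq
  simp only [smul_eq_mul] at h1
  have h2 : p * -(θ * x) + q * -(θ * z) = -(θ * y) := by rw [← hy]; ring
  rw [h2] at h1
  have h3 := mul_lt_mul_of_pos_left h1 hβ
  unfold affineExp
  have h4 : q = 1 - p := by linarith
  have h5 : α * y = p * (α * x) + q * (α * z) := by rw [← hy]; ring
  rw [h5]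
  rw [h4] at h3 ⊢
  linarith

theorem finite_zeros_affineExp {α b β θ : ℝ} (hβ : β ≠ 0) (hθ : 0 < θ) :
    {τ | affineExp α b β θ τ = 0}.Finite := by
  have key : ∀ {α b β : ℝ}, 0 < β → ∀ {x y z : ℝ}, x < y → y < z → affineExp α b β θ x = 0 →
      affineExp α b β θ y = 0 → affineExp α b β θ z = 0 → False := by
    intro α b β hβ x y z hxy hyz hx hy hz
    obtain ⟨p, q, -, -, h⟩ := affineExp_between (α := α) (b := b) hβ hθ hxy hyz
    rw [hx, hy, hz] at h
    simp at h
  have key' : ∀ {x y z : ℝ}, x < y → y < z → affineExp α b β θ x = 0 →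
      affineExp α b β θ y = 0 → affineExp α b β θ z = 0 → False := by
    intro x y z hxy hyz hx hy hz
    rcases lt_or_gt_of_ne hβ with h | h
    · refine key (neg_pos.2 h) hxy hyz (α := -α) (b := -b) ?_ ?_ ?_ <;>
        rw [← neg_affineExp, neg_eq_zero] <;> assumption
    · exact key h hxy hyz hx hy hz
  set Z := {τ | affineExp α b β θ τ = 0} with hZ
  rcases Z.subsingleton_or_nontrivial with h | h
  · exact h.finite
  · obtain ⟨x, hx, y, hy, hxy⟩ := h.exists_lt
    refine (Set.toFinite {x, y}).subset fun z hz => ?_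
    by_contra hc
    simp only [mem_insert_iff, mem_singleton_iff, not_or] at hc
    rcases lt_or_gt_of_ne hc.1 with h1 | h1
    · exact key' h1 hxy hz hx hy
    · rcases lt_or_gt_of_ne hc.2 with h2 | h2
      · exact key' h1 h2 hx hz hy
      · exact key' hxy h2 hx hy hz

namespace DynamicModel

variable {M : DynamicModel} {w : Pricing}

/-- The total switching rate `λ_{1→2} + λ_{2→1}`. -/
noncomputable def totalSwitch (M : DynamicModel) : ℝ := M.switch .nonsurge + M.switch .surge

theorem totalSwitch_pos : 0 < M.totalSwitch := add_pos (M.switch_pos _) (M.switch_pos _)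

theorem gain_eq_affineExp {i : WorldState} {m b : ℝ} (h : ∀ τ, 0 < τ → w i τ = m * τ + b)
    (R κ : ℝ) {τ : ℝ} (hτ : 0 < τ) :
    M.gain w i R κ τ = affineExp (m - R) b (κ * (M.switch i / M.totalSwitch)) M.totalSwitch τ := by
  rw [gain, h τ hτ, transitionProb_eq, affineExp, totalSwitch]
  ring

theorem ae_gain_ne_zero {i : WorldState} {m b : ℝ} (h : ∀ τ, 0 < τ → w i τ = m * τ + b)
    (R : ℝ) {κ : ℝ} (hκ : κ ≠ 0) : ∀ᵐ τ ∂M.F i, M.gain w i R κ τ ≠ 0 := by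
  have hβ : κ * (M.switch i / M.totalSwitch) ≠ 0 :=
    mul_ne_zero hκ (div_pos (M.switch_pos i) totalSwitch_pos).ne'
  have hnull := (finite_zeros_affineExp (α := m - R) (b := b) hβ M.totalSwitch_pos).measure_zero
    volume
  filter_upwards [measure_eq_zero_iff_ae_notMem.1 (M.F_absolutelyContinuous i hnull), M.F_ae_pos i]
    with τ h1 hτ
  rw [gain_eq_affineExp h R κ hτ]
  exact h1

theorem stateShift_coeff_pos {κ : ℝ} (hκ : 0 < κ) :
    0 < κ * (M.switch .nonsurge / M.totalSwitch) ∧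
      0 < -(stateShift κ .surge * (M.switch .surge / M.totalSwitch)) := by
  have h1 := div_pos (M.switch_pos .nonsurge) M.totalSwitch_pos
  have h2 := div_pos (M.switch_pos .surge) M.totalSwitch_pos
  refine ⟨by positivity, ?_⟩
  simp only [stateShift, neg_mul, neg_neg]
  positivity

/-- In the non-surge state the gain is concave, so the profitable trips form an interval. -/
theorem gainSet_nonsurge_connected {m b : ℝ} (h : ∀ τ, 0 < τ → w .nonsurge τ = m * τ + b) (R : ℝ)
    {κ : ℝ} (hκ : 0 < κ) :
    ∀ x ∈ M.gainSet w .nonsurge R κ, ∀ z ∈ M.gainSet w .nonsurge R κ, ∀ y, x < y → y < z →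
      y ∈ M.gainSet w .nonsurge R κ := by
  rintro x ⟨hx0, hx⟩ z ⟨hz0, hz⟩ y hxy hyz
  have hy0 := hx0.trans hxy
  obtain ⟨p, q, hp, hq, hlt⟩ := affineExp_between (α := m - R) (b := b)
    (M.stateShift_coeff_pos hκ).1 M.totalSwitch_pos hxy hyz
  rw [← gain_eq_affineExp h R κ hx0, ← gain_eq_affineExp h R κ hz0,
    ← gain_eq_affineExp h R κ hy0] at hlt
  exact ⟨hy0, (add_pos (mul_pos hp hx) (mul_pos hq hz)).trans hlt⟩

/-- If moreover the gain is nonnegative at `0`, the interval starts at `0`. -/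
theorem gainSet_nonsurge_lower {m b : ℝ} (h : ∀ τ, 0 < τ → w .nonsurge τ = m * τ + b) (hb : 0 ≤ b)
    (R : ℝ) {κ : ℝ} (hκ : 0 < κ) :
    ∀ z ∈ M.gainSet w .nonsurge R κ, ∀ y, 0 < y → y < z → y ∈ M.gainSet w .nonsurge R κ := by
  rintro z ⟨hz0, hz⟩ y hy0 hyz
  obtain ⟨p, q, hp, hq, hlt⟩ := affineExp_between (α := m - R) (b := b)
    (M.stateShift_coeff_pos hκ).1 M.totalSwitch_pos hy0 hyz
  rw [affineExp_zero, ← gain_eq_affineExp h R κ hz0, ← gain_eq_affineExp h R κ hy0] at hlt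
  exact ⟨hy0, (add_pos_of_nonneg_of_pos (mul_nonneg hp.le hb) (mul_pos hq hz)).trans hlt⟩

/-- In the surge state the gain is convex, so the unprofitable trips form an interval. -/
theorem gainSet_surge_connected {m b : ℝ} (h : ∀ τ, 0 < τ → w .surge τ = m * τ + b) (R : ℝ)
    {κ : ℝ} (hκ : 0 < κ) :
    ∀ x, 0 < x → x ∉ M.gainSet w .surge R (stateShift κ .surge) →
      ∀ z, z ∉ M.gainSet w .surge R (stateShift κ .surge) → ∀ y, x < y → y < z →
      y ∉ M.gainSet w .surge R (stateShift κ .surge) := by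
  rintro x hx0 hx z hz y hxy hyz ⟨hy0, hy⟩
  have hz0 := hy0.trans hyz
  obtain ⟨p, q, hp, hq, hlt⟩ := affineExp_between (α := -(m - R)) (b := -b)
    (M.stateShift_coeff_pos hκ).2 M.totalSwitch_pos hxy hyz
  simp only [← neg_affineExp] at hlt
  rw [← gain_eq_affineExp h R _ hx0, ← gain_eq_affineExp h R _ hz0,
    ← gain_eq_affineExp h R _ hy0] at hlt
  have hx' : M.gain w .surge R (stateShift κ .surge) x ≤ 0 := not_lt.1 fun h => hx ⟨hx0, h⟩
  have hz' : M.gain w .surge R (stateShift κ .surge) z ≤ 0 := not_lt.1 fun h => hz ⟨hz0, h⟩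
  have := mul_nonneg hp.le (neg_nonneg.2 hx')
  have := mul_nonneg hq.le (neg_nonneg.2 hz')
  linarith

/-- If moreover the gain is nonpositive at `0`, all trips beyond a profitable one are profitable. -/
theorem gainSet_surge_upper {m b : ℝ} (h : ∀ τ, 0 < τ → w .surge τ = m * τ + b) (hb : b ≤ 0) (R : ℝ)
    {κ : ℝ} (hκ : 0 < κ) :
    ∀ x ∈ M.gainSet w .surge R (stateShift κ .surge), ∀ y, x < y →
      y ∈ M.gainSet w .surge R (stateShift κ .surge) := by
  rintro x ⟨hx0, hx⟩ y hxy
  have hy0 := hx0.trans hxy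
  refine ⟨hy0, ?_⟩
  obtain ⟨p, q, hp, hq, hlt⟩ := affineExp_between (α := -(m - R)) (b := -b)
    (M.stateShift_coeff_pos hκ).2 M.totalSwitch_pos hx0 hxy
  rw [affineExp_zero] at hlt
  simp only [← neg_affineExp] at hlt
  rw [← gain_eq_affineExp h R _ hx0, ← gain_eq_affineExp h R _ hy0] at hlt
  by_contra hc
  have := mul_nonneg hp.le (neg_nonneg.2 hb)
  have := mul_nonneg hq.le (neg_nonneg.2 (not_lt.1 hc))
  linarith

/-- In the surge state some trips are profitable: otherwise its epochs, which earn `R ≥ 0` per unit of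
time and bear the loss of a switch, would have negative value. -/
theorem Certifies.gainSet_surge_nonempty {σ : Policy} (hσ : IsPolicy σ) {R κ : ℝ} (hR : 0 ≤ R)
    (hκ : 0 < κ) (h : M.Certifies w σ R κ) :
    (M.gainSet w .surge R (stateShift κ .surge)).Nonempty := by
  by_contra hc
  rw [not_nonempty_iff_eq_empty] at hc
  have h1 := (h .surge).1
  have h2 : ∫ τ in σ .surge, M.gain w .surge R (stateShift κ .surge) τ ∂M.F .surge ≤ 0 :=
    setIntegral_nonpos (hσ .surge).1.measurableSet fun τ hτ => not_lt.1 fun h' => by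
      have : τ ∈ M.gainSet w .surge R (stateShift κ .surge) := ⟨(hσ .surge).2 hτ, h'⟩
      rw [hc] at this
      exact this
  unfold epochValue at h1
  have h3 := mul_nonpos_of_nonneg_of_nonpos (M.lam_pos .surge).le h2
  have h4 := mul_pos hκ (M.switch_pos .surge)
  simp only [stateShift] at h1 h3
  linarith

theorem Certifies.ae_eq_gainSet (hA : M.IsAdmissible w) {σ : Policy} (hσ : IsPolicy σ) {R κ : ℝ}
    (h : M.Certifies w σ R κ) {i : WorldState}
    (hne : ∀ᵐ τ ∂M.F i, M.gain w i R (stateShift κ i) τ ≠ 0) :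
    σ i =ᵐ[M.F i] M.gainSet w i R (stateShift κ i) := by
  filter_upwards [hne, h.ae_mem_iff hA hσ i, M.F_ae_pos i] with τ h1 h2 h3
  exact propext ((h2 h1).trans ⟨fun h => ⟨h3, h⟩, fun h => h.2⟩)

/-! ### The form of optimal policies -/

open Classical in
/-- The set of accepted trips with the prescribed form: all trips if all upper endpoints carry a
positive derivative, and the strictly profitable trips otherwise. -/
def formSet (M : DynamicModel) (w : Pricing) (R κ : ℝ) : Policy := fun i =>
  if M.UpperDerivPos w i then Ioi 0 else M.gainSet w i R (stateShift κ i)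

theorem isPolicy_formSet (hA : M.IsAdmissible w) (R κ : ℝ) : IsPolicy (M.formSet w R κ) := by
  intro i
  unfold formSet
  split_ifs
  · exact ⟨isOpen_Ioi, Subset.rfl⟩
  · exact ⟨isOpen_gainSet (hA.1 i) _ _, gainSet_subset _ _ _⟩

theorem Certifies.formSet_ae (hA : M.IsAdmissible w) {σ : Policy} (hσ : IsPolicy σ) {R κ : ℝ}
    (h : M.Certifies w σ R κ) (i : WorldState) :
    ∀ᵐ τ ∂M.F i, τ ∈ M.formSet w R κ i ↔ 0 < M.gain w i R (stateShift κ i) τ := by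
  filter_upwards [M.F_ae_pos i, M.F_ae_density_pos i] with τ hτ hf
  unfold formSet
  split_ifs with hU
  · exact ⟨fun _ => gain_pos_of_upperDerivPos hA hσ h hU hτ hf, fun _ => hτ⟩
  · exact ⟨fun h => h.2, fun h => ⟨hτ, h⟩⟩

theorem nonsurgeForm_formSet (hA : M.IsAdmissible w) (R : ℝ) {κ : ℝ} (hκ : 0 < κ) :
    M.NonsurgeForm w (M.formSet w R κ .nonsurge) := by
  by_cases hU : M.UpperDerivPos w .nonsurge
  · have : M.formSet w R κ .nonsurge = Ioi 0 := if_pos hU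
    rw [this]
    exact ⟨fun _ => ⟨⊤, tripInterval_zero_top.symm⟩, fun _ => ⟨0, ⊤, tripInterval_zero_top.symm⟩,
      fun _ => rfl⟩
  · have : M.formSet w R κ .nonsurge = M.gainSet w .nonsurge R κ := if_neg hU
    rw [this]
    have ho := isOpen_gainSet (M := M) (hA.1 .nonsurge) R κ
    have hs := gainSet_subset (M := M) (w := w) .nonsurge R κ
    refine ⟨?_, ?_, fun h => absurd h hU⟩
    · rintro (⟨m, -, hm⟩ | ⟨m, a, -, ha, hm⟩)
      · exact exists_eq_tripInterval_zero ho hs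
          (gainSet_nonsurge_lower (b := 0) (by simpa using hm) le_rfl R hκ)
      · exact exists_eq_tripInterval_zero ho hs (gainSet_nonsurge_lower hm ha.le R hκ)
    · rintro ⟨m, a, -, ha, hm⟩
      exact ⟨_, _, exists_eq_tripInterval ho hs
        (gainSet_nonsurge_connected (b := -a) (by simpa [sub_eq_add_neg] using hm) R hκ)⟩

theorem Certifies.surgeForm_formSet (hA : M.IsAdmissible w) {σ : Policy} (hσ : IsPolicy σ) {R κ : ℝ}
    (hR : 0 ≤ R) (hκ : 0 < κ) (h : M.Certifies w σ R κ) :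
    M.SurgeForm w (M.formSet w R κ .surge) := by
  by_cases hU : M.UpperDerivPos w .surge
  · have : M.formSet w R κ .surge = Ioi 0 := if_pos hU
    rw [this]
    exact ⟨fun _ => ⟨0, ENNReal.zero_ne_top, tripInterval_zero_top.symm⟩,
      fun _ => ⟨⊤, ⊤, by rw [tripInterval_zero_top, tripInterval_top_top, union_empty]⟩,
      fun _ => rfl⟩
  · have : M.formSet w R κ .surge = M.gainSet w .surge R (stateShift κ .surge) := if_neg hU
    rw [this]
    have ho := isOpen_gainSet (M := M) (hA.1 .surge) R (stateShift κ .surge)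
    have hs := gainSet_subset (M := M) (w := w) .surge R (stateShift κ .surge)
    have hne := h.gainSet_surge_nonempty hσ hR hκ
    have key : ∀ m b, b ≤ 0 → (∀ τ, 0 < τ → w .surge τ = m * τ + b) →
        ∃ t₄ : ℝ≥0∞, t₄ ≠ ⊤ ∧ M.gainSet w .surge R (stateShift κ .surge) = tripInterval t₄ ⊤ := by
      intro m b hb hm
      obtain ⟨t, ht⟩ := exists_eq_tripInterval_top ho hs (gainSet_surge_upper hm hb R hκ)
      refine ⟨t, ?_, ht⟩
      rintro rfl
      rw [ht, tripInterval_top_top] at hne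
      exact not_nonempty_empty hne
    refine ⟨?_, ?_, fun h => absurd h hU⟩
    · rintro (⟨m, -, hm⟩ | ⟨m, a, -, ha, hm⟩)
      · exact key m 0 le_rfl (by simpa using hm)
      · exact key m (-a) (by linarith) (by simpa [sub_eq_add_neg] using hm)
    · rintro ⟨m, a, -, -, hm⟩
      exact exists_eq_tripInterval_union ho hs (gainSet_surge_connected hm R hκ)

theorem exists_isOptimal_form (hA : M.IsAdmissible w) :
    ∃ σ, M.IsOptimal w σ ∧ M.NonsurgeForm w (σ .nonsurge) ∧ M.SurgeForm w (σ .surge) := by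
  obtain ⟨σ, hopt⟩ := exists_isOptimal hA
  obtain ⟨κ, hκ, hR, hcert⟩ := hopt.exists_certifies hA
  have hp := isPolicy_formSet hA (M.earningsRate w σ) κ
  refine ⟨M.formSet w (M.earningsRate w σ) κ, ?_, nonsurgeForm_formSet hA _ hκ,
    hcert.surgeForm_formSet hA hopt.1 hR hκ⟩
  refine Certifies.isOptimal hA hp (hcert.of_ae_mem_iff hA hopt.1 hp fun i => ?_)
  filter_upwards [hcert.formSet_ae hA hopt.1 i] with τ h _ using h

/-- An optimal policy agrees almost everywhere with the policy of the prescribed form wherever almost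
no trip is exactly break-even. -/
theorem Certifies.ae_eq_formSet (hA : M.IsAdmissible w) {σ : Policy} (hσ : IsPolicy σ) {R κ : ℝ}
    (h : M.Certifies w σ R κ) {i : WorldState}
    (hne : ∀ᵐ τ ∂M.F i, M.gain w i R (stateShift κ i) τ ≠ 0) :
    σ i =ᵐ[M.F i] M.formSet w R κ i := by
  filter_upwards [hne, h.ae_mem_iff hA hσ i, h.formSet_ae hA hσ i] with τ h1 h2 h3
  exact propext ((h2 h1).trans h3.symm)

theorem Certifies.ae_gain_ne_zero (hA : M.IsAdmissible w) {σ : Policy} (hσ : IsPolicy σ) {R κ : ℝ}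
    (hκ : 0 < κ) (h : M.Certifies w σ R κ) {i : WorldState}
    (hi : IsMultiplicative (w i) ∨ IsPositiveAffine (w i) ∨ IsNegativeAffine (w i) ∨
      M.UpperDerivPos w i) : ∀ᵐ τ ∂M.F i, M.gain w i R (stateShift κ i) τ ≠ 0 := by
  have hκi : stateShift κ i ≠ 0 := by
    cases i
    · exact hκ.ne'
    · exact neg_ne_zero.2 hκ.ne'
  rcases hi with ⟨m, -, hm⟩ | ⟨m, a, -, -, hm⟩ | ⟨m, a, -, -, hm⟩ | hU
  · exact DynamicModel.ae_gain_ne_zero (b := 0) (by simpa using hm) R hκi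
  · exact DynamicModel.ae_gain_ne_zero hm R hκi
  · exact DynamicModel.ae_gain_ne_zero (b := -a) (by simpa [sub_eq_add_neg] using hm) R hκi
  · filter_upwards [M.F_ae_pos i, M.F_ae_density_pos i] with τ hτ hf
    exact (gain_pos_of_upperDerivPos hA hσ h hU hτ hf).ne'

theorem IsOptimal.ae_eq_form (hA : M.IsAdmissible w) {σ : Policy} (hopt : M.IsOptimal w σ) :
    (∃ s, M.NonsurgeForm w s ∧ σ .nonsurge =ᵐ[M.F .nonsurge] s) ∧
      (∃ s, M.SurgeForm w s ∧ σ .surge =ᵐ[M.F .surge] s) := by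
  obtain ⟨κ, hκ, hR, hcert⟩ := hopt.exists_certifies hA
  constructor
  · by_cases hi : IsMultiplicative (w .nonsurge) ∨ IsPositiveAffine (w .nonsurge) ∨
      IsNegativeAffine (w .nonsurge) ∨ M.UpperDerivPos w .nonsurge
    · exact ⟨_, nonsurgeForm_formSet hA _ hκ,
        hcert.ae_eq_formSet hA hopt.1 (hcert.ae_gain_ne_zero hA hopt.1 hκ hi)⟩
    · refine ⟨σ .nonsurge, ?_, EventuallyEq.rfl⟩
      unfold NonsurgeForm
      tauto
  · by_cases hi : IsMultiplicative (w .surge) ∨ IsPositiveAffine (w .surge) ∨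
      IsNegativeAffine (w .surge) ∨ M.UpperDerivPos w .surge
    · exact ⟨_, hcert.surgeForm_formSet hA hopt.1 hR hκ,
        hcert.ae_eq_formSet hA hopt.1 (hcert.ae_gain_ne_zero hA hopt.1 hκ hi)⟩
    · refine ⟨σ .surge, ?_, EventuallyEq.rfl⟩
      unfold SurgeForm
      tauto

end DynamicModel

/-! ### A setting with exponential trip lengths -/

/-- The density of the standard exponential distribution. -/
noncomputable def expDensity : ℝ → ℝ := (Ioi 0).indicator fun τ => Real.exp (-τ)

theorem integral_mul_expDensity (g : ℝ → ℝ) :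
    ∫ τ, g τ * expDensity τ = ∫ τ in Ioi 0, g τ * Real.exp (-τ) := by
  rw [← integral_indicator measurableSet_Ioi]
  congr 1
  ext τ
  by_cases h : τ ∈ Ioi (0 : ℝ) <;> simp [expDensity, h]

theorem integral_id_mul_expDensity : ∫ τ, τ * expDensity τ = 1 := by
  rw [integral_mul_expDensity fun τ => τ]
  have h := Real.integral_rpow_mul_exp_neg_mul_Ioi (a := 2) (r := 1) (by norm_num) one_pos
  rw [Real.Gamma_two, div_one, Real.one_rpow, one_mul] at h
  rw [← h]
  refine setIntegral_congr_fun measurableSet_Ioi fun τ _ => ?_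
  norm_num

theorem integral_expDensity : ∫ τ, expDensity τ = 1 := by
  have h := integral_mul_expDensity fun _ => 1
  simp only [one_mul] at h
  rw [h, integral_exp_neg_Ioi, neg_zero, Real.exp_zero]

theorem expDensity_nonneg (τ : ℝ) : 0 ≤ expDensity τ :=
  indicator_nonneg (fun _ _ => (Real.exp_pos _).le) τ

/-- Both states have standard exponential trip lengths and switching rate `1`; requests arrive at
rate `1` in state 1 and at rate `10` in state 2.  The high rate in state 2 makes it unattractive to
spend the surge on short trips. -/
noncomputable def expModel : DynamicModel where
  lam i := match i with
    | .nonsurge => 1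
    | .surge => 10
  lam_pos i := by cases i <;> norm_num
  switch _ := 1
  switch_pos _ := one_pos
  density _ := expDensity
  density_measurable _ := Measurable.indicator (by fun_prop) measurableSet_Ioi
  density_nonneg _ := expDensity_nonneg
  density_bounded _ := ⟨1, fun τ => by
    by_cases h : τ ∈ Ioi (0 : ℝ)
    · rw [expDensity, indicator_of_mem h]
      exact Real.exp_le_one_iff.2 (neg_nonpos.2 (le_of_lt h))
    · rw [expDensity, indicator_of_notMem h]
      exact zero_le_one⟩
  density_eq_zero _ τ hτ := indicator_of_notMem (not_lt.2 hτ) _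
  lintegral_density _ := by
    rw [← ofReal_integral_eq_lintegral_ofReal (integrable_of_integral_eq_one integral_expDensity)
      (ae_of_all _ expDensity_nonneg), integral_expDensity, ENNReal.ofReal_one]
  integrable_length _ := integrable_of_integral_eq_one integral_id_mul_expDensity
  init := .nonsurge

/-- Per unit of time, the driver earns `1/4` in state 1 and `1` in state 2, up to constants `b₁`, `b₂`
per trip.  The low price in state 1 keeps `R` above it, so that long trips are rejected there, and
bounds the influence of state 1 on `R` and `κ`. -/
noncomputable def expPricing (b₁ b₂ : ℝ) : Pricing := fun i τ =>
  match i with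
  | .nonsurge => 1 / 4 * τ + b₁
  | .surge => 1 * τ + b₂

namespace ExpModel

open DynamicModel

theorem density_pos (i : WorldState) (τ : ℝ) (hτ : 0 < τ) : 0 < expModel.density i τ := by
  change 0 < expDensity τ
  rw [expDensity, indicator_of_mem (mem_Ioi.2 hτ)]
  exact Real.exp_pos _

theorem integral_length (i : WorldState) : ∫ τ, τ ∂expModel.F i = 1 := by
  rw [integral_F]
  exact integral_id_mul_expDensity

theorem transitionProb_eq (i : WorldState) (τ : ℝ) :
    expModel.transitionProb i τ = 1 / 2 * (1 - Real.exp (-(2 * τ))) := by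
  rw [DynamicModel.transitionProb_eq]
  simp only [expModel]
  norm_num

theorem integral_transitionProb (i : WorldState) :
    ∫ τ, expModel.transitionProb i τ ∂expModel.F i = 1 / 3 := by
  have h3 : Integrable (fun τ => Real.exp (-(2 * τ))) (expModel.F i) := by
    have h := (integrable_const (1 : ℝ)).sub
      ((expModel.integrable_transitionProb i).const_mul 2)
    refine h.congr (ae_of_all _ fun τ => ?_)
    simp only [Pi.sub_apply, transitionProb_eq]
    ring
  have h4 : ∫ τ, Real.exp (-(2 * τ)) ∂expModel.F i = 1 / 3 := by
    rw [integral_F]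
    change ∫ τ, Real.exp (-(2 * τ)) * expDensity τ = 1 / 3
    rw [integral_mul_expDensity]
    have h5 := integral_exp_mul_Ioi (a := -3) (by norm_num) 0
    rw [mul_zero, Real.exp_zero] at h5
    rw [show (1 : ℝ) / 3 = -1 / -3 by norm_num, ← h5]
    refine setIntegral_congr_fun measurableSet_Ioi fun τ _ => ?_
    rw [← Real.exp_add]
    congr 1
    ring
  simp only [transitionProb_eq]
  rw [integral_const_mul, integral_sub (integrable_const 1) h3, h4]
  simp
  norm_num

theorem transitionProb_le (i : WorldState) (τ : ℝ) : expModel.transitionProb i τ ≤ τ := by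
  rw [transitionProb_eq]
  linarith [Real.add_one_le_exp (-(2 * τ))]

theorem transitionProb_le_half (i : WorldState) (τ : ℝ) :
    expModel.transitionProb i τ ≤ 1 / 2 := by
  rw [transitionProb_eq]
  linarith [Real.exp_pos (-(2 * τ))]

theorem le_transitionProb (i : WorldState) {τ : ℝ} (hτ : 0 ≤ τ) :
    τ - τ ^ 2 ≤ expModel.transitionProb i τ := by
  rw [transitionProb_eq]
  have h1 := Real.quadratic_le_exp_of_nonneg (x := 2 * τ) (by positivity)
  have h2 : Real.exp (-(2 * τ)) * Real.exp (2 * τ) = 1 := by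
    rw [← Real.exp_add, neg_add_cancel, Real.exp_zero]
  have h3 := Real.exp_pos (-(2 * τ))
  -- `(1 - x + x²/2) (1 + x + x²/2) ≥ 1` with `x = 2 τ`
  have h4 : Real.exp (-(2 * τ)) ≤ 1 - 2 * τ + 2 * τ ^ 2 := by
    have h5 : Real.exp (-(2 * τ)) * (1 + 2 * τ + (2 * τ) ^ 2 / 2) ≤ 1 := by
      exact (mul_le_mul_of_nonneg_left h1 h3.le).trans_eq h2
    have h6 : 0 < 1 + 2 * τ + (2 * τ) ^ 2 / 2 := by positivity
    refine le_of_mul_le_mul_right (h5.trans ?_) h6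
    nlinarith [sq_nonneg (τ ^ 2)]
  linarith

variable {b₁ b₂ : ℝ}

theorem integrable_pricing (b₁ b₂ : ℝ) (i : WorldState) :
    Integrable (expPricing b₁ b₂ i) (expModel.F i) := by
  have h := expModel.integrable_id_F i
  cases i
  · exact (h.const_mul _).add (integrable_const b₁)
  · exact (h.const_mul _).add (integrable_const b₂)

theorem isAdmissible (h₁ : b₁ ≤ 1 / 2) (h₂ : -(1 / 10) ≤ b₂) :
    expModel.IsAdmissible (expPricing b₁ b₂) := by
  refine ⟨fun i => ?_, integrable_pricing b₁ b₂, Ioi 0, isOpen_Ioi, Subset.rfl,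
    fun s hs hs0 => ?_⟩
  · cases i <;> unfold expPricing <;> fun_prop
  · have hi := expModel.integrable_id_F
    have e1 : expModel.stateRate (expPricing b₁ b₂) .surge (Ioi 0) = 10 * (1 + b₂) / 11 := by
      unfold stateRate
      rw [expModel.setIntegral_F_Ioi, expModel.setIntegral_F_Ioi, integral_length]
      have : ∫ τ, expPricing b₁ b₂ .surge τ ∂expModel.F .surge = 1 * 1 + b₂ := by
        unfold expPricing
        rw [integral_add ((hi _).const_mul _) (integrable_const _), integral_const_mul,
          integral_length]
        simp
      rw [this]
      simp only [expModel]
      norm_num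
    have e2 : ∫ τ in s, expPricing b₁ b₂ .nonsurge τ ∂expModel.F .nonsurge =
        1 / 4 * ∫ τ in s, τ ∂expModel.F .nonsurge + (expModel.F .nonsurge).real s * b₁ := by
      unfold expPricing
      rw [integral_add ((hi _).const_mul _).integrableOn (integrable_const _).integrableOn,
        integral_const_mul, setIntegral_const, smul_eq_mul]
    have hX : 0 ≤ ∫ τ in s, τ ∂expModel.F .nonsurge :=
      setIntegral_nonneg hs.measurableSet fun τ hτ => le_of_lt (hs0 hτ)
    have hp : 0 ≤ (expModel.F .nonsurge).real s := measureReal_nonneg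
    have hp1 : (expModel.F .nonsurge).real s ≤ 1 := measureReal_le_one
    rw [e1]
    unfold stateRate
    rw [e2]
    change 1 * _ / (1 + 1 * _) < _
    rw [div_lt_div_iff₀ (by linarith) (by norm_num)]
    have : (expModel.F .nonsurge).real s * b₁ ≤ 1 / 2 := by
      calc _ ≤ (expModel.F .nonsurge).real s * (1 / 2) := mul_le_mul_of_nonneg_left h₁ hp
        _ ≤ _ := by linarith
    nlinarith

/-! ### The optimal thresholds with exponential trip lengths -/

theorem gain_nonsurge (b₁ b₂ R κ τ : ℝ) : expModel.gain (expPricing b₁ b₂) .nonsurge R κ τ =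
    (1 / 4 - R) * τ + b₁ + κ * expModel.transitionProb .nonsurge τ := by
  unfold gain expPricing
  ring

theorem gain_surge (b₁ b₂ R κ τ : ℝ) :
    expModel.gain (expPricing b₁ b₂) .surge R (stateShift κ .surge) τ =
    (1 - R) * τ + b₂ - κ * expModel.transitionProb .surge τ := by
  unfold gain expPricing stateShift
  ring

theorem epochValue_surge_Ioi (b₁ b₂ R κ : ℝ) :
    expModel.epochValue (expPricing b₁ b₂) .surge R (stateShift κ .surge) (Ioi 0) =
      10 * (1 + b₂) - 11 * R - 13 / 3 * κ := by
  have hi := expModel.integrable_id_F .surge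
  have hq := expModel.integrable_transitionProb .surge
  unfold epochValue
  rw [setIntegral_F_Ioi]
  have : ∫ τ, expModel.gain (expPricing b₁ b₂) .surge R (stateShift κ .surge) τ
      ∂expModel.F .surge = (1 - R) + b₂ - κ * (1 / 3) := by
    have h1 : Integrable (fun τ => (1 - R) * τ + b₂) (expModel.F .surge) :=
      (hi.const_mul _).add (integrable_const _)
    simp only [gain_surge]
    rw [integral_sub h1 (hq.const_mul κ), integral_add (hi.const_mul _) (integrable_const _),
      integral_const_mul, integral_const_mul, integral_length, integral_transitionProb]
    simp
  rw [this]
  simp only [expModel, stateShift]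
  ring

section Optimal

variable {σ : Policy} {R κ : ℝ}

/-- Obtained by accepting nothing in state 1. -/
theorem le_rate (h : expModel.Certifies (expPricing b₁ b₂) σ R κ) : κ ≤ R := by
  have := (h .nonsurge).2 ∅ isOpen_empty (empty_subset _)
  unfold epochValue at this
  simp only [Measure.restrict_empty, integral_zero_measure, stateShift] at this
  change -R + κ * 1 + _ ≤ 0 at this
  linarith

/-- Obtained by accepting everything in state 2. -/
theorem surge_ineq (h : expModel.Certifies (expPricing b₁ b₂) σ R κ) :
    10 * (1 + b₂) ≤ 11 * R + 13 / 3 * κ := by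
  have := (h .surge).2 (Ioi 0) isOpen_Ioi Subset.rfl
  rw [epochValue_surge_Ioi] at this
  linarith

theorem half_lt_rate (h₂ : -(1 / 10) ≤ b₂)
    (h : expModel.Certifies (expPricing b₁ b₂) σ R κ) : 1 / 2 < R := by
  have h1 := le_rate h
  have h2 := surge_ineq h
  linarith

theorem nonsurge_eq (h : expModel.Certifies (expPricing b₁ b₂) σ R κ) :
    R - κ = ∫ τ in σ .nonsurge, expModel.gain (expPricing b₁ b₂) .nonsurge R κ τ
      ∂expModel.F .nonsurge := by
  have := (h .nonsurge).1
  unfold epochValue at this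
  simp only [stateShift] at this
  change -R + κ * 1 + 1 * _ = 0 at this
  linarith

theorem surge_eq (h : expModel.Certifies (expPricing b₁ b₂) σ R κ) :
    R + κ = 10 * ∫ τ in σ .surge,
      expModel.gain (expPricing b₁ b₂) .surge R (stateShift κ .surge) τ ∂expModel.F .surge := by
  have := (h .surge).1
  unfold epochValue at this
  change -R + -κ * 1 + 10 * _ = 0 at this
  linarith

/-- If time were worth at least the price `1` of state 2, trips would gain at most the tiny constant. -/
theorem rate_lt_one (h₂ : b₂ ≤ 1 / 1000) (hσ : IsPolicy σ) (hκ : 0 < κ)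
    (h : expModel.Certifies (expPricing b₁ b₂) σ R κ) : R < 1 := by
  by_contra! hR
  have h1 := surge_eq h
  have hm := (hσ .surge).1.measurableSet
  have h2 : ∫ τ in σ .surge,
      expModel.gain (expPricing b₁ b₂) .surge R (stateShift κ .surge) τ ∂expModel.F .surge ≤
      ∫ _ in σ .surge, 1 / 1000 ∂expModel.F .surge := by
    refine setIntegral_mono_on (integrable_gain (integrable_pricing b₁ b₂ _) _ _).integrableOn
      (integrable_const _).integrableOn hm fun τ hτ => ?_
    have hτ0 : 0 < τ := (hσ .surge).2 hτ
    rw [gain_surge]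
    have := mul_nonneg hκ.le (expModel.transitionProb_nonneg .surge hτ0.le)
    have := mul_nonneg (sub_nonneg.2 hR) hτ0.le
    linarith
  rw [setIntegral_const, smul_eq_mul] at h2
  have h3 : (expModel.F .surge).real (σ .surge) ≤ 1 := measureReal_le_one
  linarith

theorem gain_nonsurge_le (hκ : 0 < κ) (h : expModel.Certifies (expPricing b₁ b₂) σ R κ) {τ : ℝ}
    (hτ : 0 < τ) : expModel.gain (expPricing b₁ b₂) .nonsurge R κ τ ≤ 1 / 4 * τ + b₁ := by
  rw [gain_nonsurge]
  have h1 := mul_le_mul_of_nonneg_left (transitionProb_le .nonsurge τ) hκ.le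
  have h2 := mul_le_mul_of_nonneg_right (le_rate h) hτ.le
  linarith

/-- As `κ ≤ R`, the gain in state 1 is at most `τ/4`, whose mean is `1/4`. -/
theorem rate_le (h₁ : b₁ ≤ 0) (hσ : IsPolicy σ) (hκ : 0 < κ)
    (h : expModel.Certifies (expPricing b₁ b₂) σ R κ) : R ≤ κ + 1 / 4 := by
  have hi := (expModel.integrable_id_F .nonsurge).const_mul (1 / 4)
  have h1 : ∫ τ in σ .nonsurge, expModel.gain (expPricing b₁ b₂) .nonsurge R κ τ
      ∂expModel.F .nonsurge ≤ ∫ τ in σ .nonsurge, 1 / 4 * τ ∂expModel.F .nonsurge := by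
    refine setIntegral_mono_on (integrable_gain (integrable_pricing b₁ b₂ _) _ _).integrableOn
      hi.integrableOn (hσ .nonsurge).1.measurableSet fun τ hτ => ?_
    linarith [gain_nonsurge_le hκ h ((hσ .nonsurge).2 hτ)]
  have h2 : ∫ τ in σ .nonsurge, 1 / 4 * τ ∂expModel.F .nonsurge ≤
      ∫ τ, 1 / 4 * τ ∂expModel.F .nonsurge := by
    refine setIntegral_le_integral hi ?_
    filter_upwards [expModel.F_ae_pos .nonsurge] with τ hτ
    change 0 ≤ 1 / 4 * τ
    positivity
  rw [integral_const_mul _ (fun τ : ℝ => τ) (μ := expModel.F .nonsurge), integral_length] at h2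
  linarith [nonsurge_eq h]

/-- Some trips are profitable in state 1: otherwise `κ = R`, and the gain `τ/4 - O(τ²) + b₁` is positive
at `τ = 1/8`. -/
theorem gainSet_nonsurge_nonempty (h₁ : -(1 / 100) ≤ b₁) (h₂ : b₂ ≤ 1 / 1000) (hσ : IsPolicy σ)
    (hκ : 0 < κ) (h : expModel.Certifies (expPricing b₁ b₂) σ R κ) :
    (expModel.gainSet (expPricing b₁ b₂) .nonsurge R κ).Nonempty := by
  by_contra hc
  rw [not_nonempty_iff_eq_empty] at hc
  have hle : ∀ τ, 0 < τ → expModel.gain (expPricing b₁ b₂) .nonsurge R κ τ ≤ 0 :=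
    fun τ hτ => not_lt.1 fun h' => by
      have : τ ∈ expModel.gainSet (expPricing b₁ b₂) .nonsurge R κ := ⟨hτ, h'⟩
      rw [hc] at this
      exact this
  have h1 : ∫ τ in σ .nonsurge, expModel.gain (expPricing b₁ b₂) .nonsurge R κ τ
      ∂expModel.F .nonsurge ≤ 0 :=
    setIntegral_nonpos (hσ .nonsurge).1.measurableSet fun τ hτ => hle τ ((hσ .nonsurge).2 hτ)
  have h2 := nonsurge_eq h
  have h3 := le_rate h
  have h4 := rate_lt_one h₂ hσ hκ h
  have h5 := hle (1 / 8) (by norm_num)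
  rw [gain_nonsurge] at h5
  have h6 := mul_le_mul_of_nonneg_left
    (le_transitionProb .nonsurge (τ := 1 / 8) (by norm_num)) hκ.le
  linarith

theorem gain_nonsurge_nonpos_of_le (h₁ : b₁ ≤ 1 / 2) (h₂ : -(1 / 10) ≤ b₂) (h₂' : b₂ ≤ 1 / 1000)
    (hσ : IsPolicy σ) (hκ : 0 < κ) (h : expModel.Certifies (expPricing b₁ b₂) σ R κ) {τ : ℝ}
    (hτ : 8 ≤ τ) : expModel.gain (expPricing b₁ b₂) .nonsurge R κ τ ≤ 0 := by
  rw [gain_nonsurge]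
  have h1 := half_lt_rate h₂ h
  have h2 := rate_lt_one h₂' hσ hκ h
  have h3 := le_rate h
  have h4 := mul_le_mul_of_nonneg_left (transitionProb_le_half .nonsurge τ) hκ.le
  nlinarith

/-- Some trips are unprofitable in state 2: otherwise all are accepted, which determines `R` and `κ` up
to the small earnings in state 1, and the gain at `τ = 1/10` is then negative. -/
theorem exists_gain_surge_neg (h₁ : b₁ ≤ 0) (h₂' : b₂ ≤ 1 / 1000)
    (hσ : IsPolicy σ) (hκ : 0 < κ) (h : expModel.Certifies (expPricing b₁ b₂) σ R κ) :
    ∃ τ, 0 < τ ∧ expModel.gain (expPricing b₁ b₂) .surge R (stateShift κ .surge) τ < 0 := by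
  by_contra! hc
  have h1 : expModel.epochValue (expPricing b₁ b₂) .surge R (stateShift κ .surge) (σ .surge) ≤
      expModel.epochValue (expPricing b₁ b₂) .surge R (stateShift κ .surge) (Ioi 0) := by
    unfold epochValue
    have hint := integrable_gain (M := expModel) (integrable_pricing b₁ b₂ .surge) R
      (stateShift κ .surge)
    have : ∫ τ in σ .surge, expModel.gain (expPricing b₁ b₂) .surge R (stateShift κ .surge) τ
        ∂expModel.F .surge ≤ ∫ τ in Ioi 0,
        expModel.gain (expPricing b₁ b₂) .surge R (stateShift κ .surge) τ ∂expModel.F .surge := by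
      rw [setIntegral_F_Ioi]
      refine setIntegral_le_integral hint ?_
      filter_upwards [expModel.F_ae_pos .surge] with τ hτ using hc τ hτ
    have := mul_le_mul_of_nonneg_left this (expModel.lam_pos .surge).le
    linarith
  rw [(h .surge).1, epochValue_surge_Ioi] at h1
  have h2 := surge_ineq h
  have h3 := rate_le h₁ hσ hκ h
  have h4 := le_rate h
  have h5 := rate_lt_one h₂' hσ hκ h
  have h6 := hc (1 / 10) (by norm_num)
  rw [gain_surge] at h6
  have h7 := mul_le_mul_of_nonneg_left
    (le_transitionProb .surge (τ := 1 / 10) (by norm_num)) hκ.le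
  linarith

end Optimal

/-- In state 1 the accepted trips form a bounded interval. -/
theorem exists_Ioo_nonsurge (h₁ : -(1 / 100) ≤ b₁) (h₁' : b₁ ≤ 1 / 2) (h₂ : -(1 / 10) ≤ b₂)
    (h₂' : b₂ ≤ 1 / 1000) {σ : Policy} (hopt : expModel.IsOptimal (expPricing b₁ b₂) σ) :
    ∃ s t : ℝ, 0 ≤ s ∧ s < t ∧ (0 ≤ b₁ → s = 0) ∧ (b₁ = -(1 / 100) → 0 < s) ∧
      σ .nonsurge =ᵐ[expModel.F .nonsurge] Ioo s t := by
  have hA := isAdmissible h₁' h₂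
  obtain ⟨κ, hκ, -, h⟩ := hopt.exists_certifies hA
  set R := expModel.earningsRate (expPricing b₁ b₂) σ
  have hform : ∀ τ, 0 < τ → expPricing b₁ b₂ .nonsurge τ = 1 / 4 * τ + b₁ := fun _ _ => rfl
  have hae := h.ae_eq_gainSet hA hopt.1 (i := .nonsurge)
    (DynamicModel.ae_gain_ne_zero hform R hκ.ne')
  change _ =ᵐ[_] expModel.gainSet (expPricing b₁ b₂) .nonsurge R κ at hae
  set S := expModel.gainSet (expPricing b₁ b₂) .nonsurge R κ with hS
  have ho : IsOpen S := isOpen_gainSet (hA.1 .nonsurge) _ _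
  have hs0 : S ⊆ Ioi 0 := gainSet_subset _ _ _
  obtain ⟨z, hz⟩ := gainSet_nonsurge_nonempty h₁ h₂' hopt.1 hκ h
  have h8 : ∀ τ, 8 ≤ τ → τ ∉ S := fun τ hτ hmem =>
    not_lt.2 (gain_nonsurge_nonpos_of_le h₁' h₂ h₂' hopt.1 hκ h hτ) hmem.2
  obtain ⟨a, b, hab, ha0⟩ : ∃ a b, S = tripInterval a b ∧ (0 ≤ b₁ → a = 0) := by
    rcases le_or_gt 0 b₁ with hb | hb
    · obtain ⟨b, hb'⟩ := exists_eq_tripInterval_zero ho hs0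
        (gainSet_nonsurge_lower hform hb R hκ)
      exact ⟨0, b, hb', fun _ => rfl⟩
    · exact ⟨_, _, exists_eq_tripInterval ho hs0 (gainSet_nonsurge_connected hform R hκ),
        fun h => absurd h (not_le.2 hb)⟩
  have hz' : z ∈ tripInterval a b := hab ▸ hz
  have haT : a ≠ ⊤ := ne_top_of_lt hz'.2.1
  have hbT : b ≠ ⊤ := by
    rintro rfl
    refine h8 (max 8 z) (le_max_left _ _) ?_
    rw [hab]
    exact ⟨lt_max_of_lt_left (by norm_num),
      hz'.2.1.trans_le (ENNReal.ofReal_le_ofReal (le_max_right _ _)), ENNReal.ofReal_lt_top⟩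
  have hIoo := tripInterval_eq_Ioo haT hbT
  rw [hIoo] at hz'
  refine ⟨a.toReal, b.toReal, ENNReal.toReal_nonneg, hz'.1.trans hz'.2, fun hb => by simp [ha0 hb],
    fun hb => ?_, by rw [← hIoo, ← hab]; exact hae⟩
  -- trips of length at most `1/100` cost more than they gain
  have hsmall : ∀ τ, 0 < τ → τ ≤ 1 / 100 → τ ∉ S := fun τ hτ hle hmem => by
    have := gain_nonsurge_le hκ h hτ
    have := hmem.2
    linarith
  by_contra hc
  have ha : a.toReal = 0 := le_antisymm (not_lt.1 hc) ENNReal.toReal_nonneg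
  have hz0 : 0 < z := hs0 hz
  refine hsmall (min z (1 / 100)) (lt_min hz0 (by norm_num)) (min_le_right _ _) ?_
  rw [hab, hIoo, ha]
  exact ⟨lt_min hz0 (by norm_num), (min_le_left _ _).trans_lt hz'.2⟩

/-- In state 2, prices without a positive constant lead to a positive finite lower threshold. -/
theorem exists_Ioi_surge (h₁' : b₁ ≤ 1 / 2) (h₂ : -(1 / 10) ≤ b₂) (h₂' : b₂ ≤ 0) {σ : Policy}
    (hopt : expModel.IsOptimal (expPricing b₁ b₂) σ) (hb : b₁ ≤ 0 ∧ b₂ = 0 ∨ b₂ = -(1 / 10)) :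
    ∃ t : ℝ, 0 < t ∧ σ .surge =ᵐ[expModel.F .surge] Ioi t := by
  have hA := isAdmissible h₁' h₂
  obtain ⟨κ, hκ, hR, h⟩ := hopt.exists_certifies hA
  set R := expModel.earningsRate (expPricing b₁ b₂) σ
  have hform : ∀ τ, 0 < τ → expPricing b₁ b₂ .surge τ = 1 * τ + b₂ := fun _ _ => rfl
  have hae := h.ae_eq_gainSet hA hopt.1 (i := .surge)
    (DynamicModel.ae_gain_ne_zero hform R (neg_ne_zero.2 hκ.ne'))
  set S := expModel.gainSet (expPricing b₁ b₂) .surge R (stateShift κ .surge) with hS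
  have ho : IsOpen S := isOpen_gainSet (hA.1 .surge) _ _
  have hs0 : S ⊆ Ioi 0 := gainSet_subset _ _ _
  obtain ⟨z, hz⟩ := h.gainSet_surge_nonempty hopt.1 hR hκ
  obtain ⟨a, ha⟩ := exists_eq_tripInterval_top ho hs0 (gainSet_surge_upper hform h₂' R hκ)
  have hz' : z ∈ tripInterval a ⊤ := ha ▸ hz
  have haT : a ≠ ⊤ := ne_top_of_lt hz'.2.1
  obtain ⟨y, hy0, hy⟩ : ∃ τ, 0 < τ ∧
      expModel.gain (expPricing b₁ b₂) .surge R (stateShift κ .surge) τ < 0 := by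
    rcases hb with ⟨hb₁, hb₂⟩ | hb₂
    · exact exists_gain_surge_neg hb₁ (by linarith) hopt.1 hκ h
    · refine ⟨1 / 10, by norm_num, ?_⟩
      rw [gain_surge]
      have := mul_nonneg hκ.le (expModel.transitionProb_nonneg .surge (τ := 1 / 10) (by norm_num))
      linarith [half_lt_rate h₂ h]
  refine ⟨a.toReal, ?_, by rw [← tripInterval_eq_Ioi haT, ← ha]; exact hae⟩
  by_contra hc
  have ha0 : a.toReal = 0 := le_antisymm (not_lt.1 hc) ENNReal.toReal_nonneg
  have hyS : y ∈ S := by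
    rw [ha, tripInterval_eq_Ioi haT, ha0]
    exact hy0
  exact lt_asymm hy hyS.2

/-- In state 2, a small positive constant leads to the rejection of intermediate trips. -/
theorem exists_union_surge (h₁' : b₁ ≤ 0) {σ : Policy}
    (hopt : expModel.IsOptimal (expPricing b₁ (1 / 1000)) σ) :
    ∃ s t : ℝ, 0 < s ∧ s < t ∧ σ .surge =ᵐ[expModel.F .surge] (Ioo 0 s ∪ Ioi t : Set ℝ) := by
  have hA : expModel.IsAdmissible (expPricing b₁ (1 / 1000)) :=
    isAdmissible (by linarith) (by norm_num)
  obtain ⟨κ, hκ, hR, h⟩ := hopt.exists_certifies hA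
  set R := expModel.earningsRate (expPricing b₁ (1 / 1000)) σ
  have hform : ∀ τ, 0 < τ → expPricing b₁ (1 / 1000) .surge τ = 1 * τ + 1 / 1000 := fun _ _ => rfl
  have hae := h.ae_eq_gainSet hA hopt.1 (i := .surge)
    (DynamicModel.ae_gain_ne_zero hform R (neg_ne_zero.2 hκ.ne'))
  set S := expModel.gainSet (expPricing b₁ (1 / 1000)) .surge R (stateShift κ .surge) with hS
  have ho : IsOpen S := isOpen_gainSet (hA.1 .surge) _ _
  have hs0 : S ⊆ Ioi 0 := gainSet_subset _ _ _
  have hR1 := rate_lt_one le_rfl hopt.1 hκ h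
  have hκR := le_rate h
  obtain ⟨a, b, hab⟩ := exists_eq_tripInterval_union ho hs0 (gainSet_surge_connected hform R hκ)
  obtain ⟨y, hy0, hy⟩ :=
    exists_gain_surge_neg h₁' le_rfl hopt.1 hκ h
  -- a second unprofitable length `y' < y` separates the two thresholds
  obtain ⟨y', ⟨hy'0, hy'⟩, hyy'⟩ := exists_lt_mem_of_isOpen
    (S := {τ | τ ∈ Ioi (0 : ℝ) ∧
      expModel.gain (expPricing b₁ (1 / 1000)) .surge R (stateShift κ .surge) τ < 0})
    ((continuousOn_gain (hA.1 .surge) R (stateShift κ .surge)).isOpen_inter_preimage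
      isOpen_Ioi isOpen_Iio) ⟨hy0, hy⟩
  have hnot : ∀ τ, expModel.gain (expPricing b₁ (1 / 1000)) .surge R (stateShift κ .surge) τ < 0 →
      τ ∉ tripInterval 0 a ∪ tripInterval b ⊤ := fun τ hτ hmem =>
    lt_asymm hτ ((hab ▸ hmem : τ ∈ S)).2
  have hay : a ≤ ENNReal.ofReal y' := not_lt.1 fun hlt =>
    hnot y' hy' (Or.inl ⟨hy'0, ENNReal.ofReal_pos.2 hy'0, hlt⟩)
  have hyb : ENNReal.ofReal y ≤ b := not_lt.1 fun hlt =>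
    hnot y hy (Or.inr ⟨hy0, hlt, ENNReal.ofReal_lt_top⟩)
  have hltab : a < b :=
    (hay.trans_lt ((ENNReal.ofReal_lt_ofReal_iff hy0).2 hyy')).trans_le hyb
  have haT : a ≠ ⊤ := ne_top_of_lt hltab
  -- short trips are profitable because of the constant, long trips because `R < 1`
  have hshort : ∀ τ, 0 < τ → τ ≤ 1 / 2000 → τ ∈ S := fun τ hτ hle => by
    refine ⟨hτ, ?_⟩
    rw [gain_surge]
    have h1 := mul_le_mul_of_nonneg_left (transitionProb_le .surge τ) hκ.le
    have h2 := mul_pos (sub_pos.2 hR1) hτ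
    nlinarith
  have hlong : ∀ τ, 1 / (1 - R) ≤ τ → τ ∈ S := fun τ hle => by
    have h0 : 0 < 1 - R := by linarith
    have h1 : 1 ≤ (1 - R) * τ := by
      rw [div_le_iff₀ h0] at hle
      linarith
    refine ⟨lt_of_lt_of_le (by positivity) hle, ?_⟩
    rw [gain_surge]
    have h2 := mul_le_mul_of_nonneg_left (transitionProb_le_half .surge τ) hκ.le
    linarith
  have ha0 : 0 < a := by
    have hx : min (y / 2) (1 / 2000) ∈ tripInterval 0 a ∪ tripInterval b ⊤ :=
      hab ▸ hshort _ (lt_min (by positivity) (by norm_num)) (min_le_right _ _)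
    rcases hx with hx | hx
    · exact hx.2.1.trans hx.2.2
    · exfalso
      have h1 := hyb.trans_lt hx.2.1
      rw [ENNReal.ofReal_lt_ofReal_iff hx.1] at h1
      linarith [min_le_left (y / 2) (1 / 2000 : ℝ)]
  have hbT : b ≠ ⊤ := by
    have hx : max y (1 / (1 - R)) ∈ tripInterval 0 a ∪ tripInterval b ⊤ :=
      hab ▸ hlong _ (le_max_right _ _)
    rcases hx with hx | hx
    · exfalso
      have h1 := (hx.2.2.trans_le hay).trans ((ENNReal.ofReal_lt_ofReal_iff hy0).2 hyy')
      rw [ENNReal.ofReal_lt_ofReal_iff hy0] at h1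
      exact not_lt.2 (le_max_left _ _) h1
    · exact ne_top_of_lt hx.2.1
  refine ⟨a.toReal, b.toReal, ENNReal.toReal_pos ha0.ne' haT,
    (ENNReal.toReal_lt_toReal haT hbT).2 hltab, ?_⟩
  have h1 : tripInterval 0 a = Ioo 0 a.toReal := by
    simpa using tripInterval_eq_Ioo ENNReal.zero_ne_top haT
  rw [← h1, ← tripInterval_eq_Ioi hbT, ← hab]
  exact hae

theorem isRegularSetting (h₁ : b₁ ≤ 1 / 2) (h₂ : -(1 / 10) ≤ b₂) :
    expModel.IsRegularSetting (expPricing b₁ b₂) :=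
  ⟨density_pos, isAdmissible h₁ h₂, exists_isOptimal (isAdmissible h₁ h₂)⟩

theorem not_ae_eq_Ioi {i : WorldState} {s : Set ℝ} {a b : ℝ} (ha : 0 ≤ a) (hab : a < b)
    (hs : Disjoint s (Ioo a b)) : ¬ (Ioi 0 : Set ℝ) =ᵐ[expModel.F i] s := by
  intro h
  have h1 : expModel.F i (Ioo a b) = 0 := by
    refine measure_mono_null (t := Ioi 0 \ s) (fun τ hτ => ⟨ha.trans_lt hτ.1, fun hτs => ?_⟩)
      (ae_le_set.1 h.le)
    exact disjoint_left.1 hs hτs hτ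
  have h2 := expModel.volume_eq_zero_of_F (density_pos i) (fun τ hτ => ha.trans_lt hτ.1) h1
  rw [Real.volume_Ioo, ENNReal.ofReal_eq_zero] at h2
  linarith

theorem multiplicative_thresholds {σ : Policy} (hσ : expModel.IsOptimal (expPricing 0 0) σ) :
    ∃ t₁ t₄ : ℝ, 0 < t₁ ∧ 0 < t₄ ∧ σ .nonsurge =ᵐ[expModel.F .nonsurge] Ioo 0 t₁ ∧
      σ .surge =ᵐ[expModel.F .surge] Ioi t₄ := by
  obtain ⟨s, t, hs, hst, hs0, -, h1⟩ := exists_Ioo_nonsurge (by norm_num) (by norm_num)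
    (by norm_num) (by norm_num) hσ
  obtain ⟨t₄, ht₄, h2⟩ := exists_Ioi_surge (by norm_num) (by norm_num) le_rfl hσ
    (Or.inl ⟨le_rfl, rfl⟩)
  have := hs0 le_rfl
  subst this
  exact ⟨t, t₄, hst, ht₄, h1, h2⟩

theorem multiplicative_not_isIC (i : WorldState) :
    ¬ expModel.IsICInState (expPricing 0 0) i := by
  rintro ⟨σ, hσ, hi⟩
  obtain ⟨t₁, t₄, h1, h4, e1, e4⟩ := multiplicative_thresholds hσ
  cases i
  · rw [hi] at e1
    refine not_ae_eq_Ioi h1.le (lt_add_one t₁) ?_ e1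
    exact disjoint_left.2 fun τ a b => lt_asymm a.2 b.1
  · rw [hi] at e4
    refine not_ae_eq_Ioi le_rfl h4 ?_ e4
    exact disjoint_left.2 fun τ a b => lt_asymm a b.2

end ExpModel

theorem mainTheorem2 :
    -- structure of optimal policies
    (∀ (M : DynamicModel) (w : Pricing), M.IsAdmissible w →
      -- the earnings rate is the almost sure limit of the earnings per unit time
      (∀ σ, IsPolicy σ → ∀ᵐ ω ∂M.P,
        Tendsto (fun t : ℝ => M.earnings w σ t ω / t) atTop (𝓝 (M.earningsRate w σ))) ∧
      -- there is an optimal policy of the given form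
      (∃ σ, M.IsOptimal w σ ∧ M.NonsurgeForm w (σ .nonsurge) ∧ M.SurgeForm w (σ .surge)) ∧
      -- up to null sets, only policies of the given form are optimal
      (∀ σ, M.IsOptimal w σ →
        (∃ s, M.NonsurgeForm w s ∧ σ .nonsurge =ᵐ[M.F .nonsurge] s) ∧
        (∃ s, M.SurgeForm w s ∧ σ .surge =ᵐ[M.F .surge] s))) ∧
    -- multiplicative pricing need not be incentive compatible in either state
    (∃ (M : DynamicModel) (w : Pricing), M.IsRegularSetting w ∧
      IsMultiplicative (w .nonsurge) ∧ IsMultiplicative (w .surge) ∧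
      (∀ σ, M.IsOptimal w σ → ∃ t₁ t₄ : ℝ, 0 < t₁ ∧ 0 < t₄ ∧
        σ .nonsurge =ᵐ[M.F .nonsurge] Ioo 0 t₁ ∧ σ .surge =ᵐ[M.F .surge] Ioi t₄) ∧
      ∀ i, ¬ M.IsICInState w i) ∧
    -- positive finite thresholds: positive affine in non-surge, negative affine in surge
    (∃ (M : DynamicModel) (w : Pricing), M.IsRegularSetting w ∧
      IsPositiveAffine (w .nonsurge) ∧ IsNegativeAffine (w .surge) ∧
      ∀ σ, M.IsOptimal w σ → ∃ t₁ t₄ : ℝ, 0 < t₁ ∧ 0 < t₄ ∧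
        σ .nonsurge =ᵐ[M.F .nonsurge] Ioo 0 t₁ ∧ σ .surge =ᵐ[M.F .surge] Ioi t₄) ∧
    -- positive finite thresholds: negative affine in non-surge, positive affine in surge
    (∃ (M : DynamicModel) (w : Pricing), M.IsRegularSetting w ∧
      IsNegativeAffine (w .nonsurge) ∧ IsPositiveAffine (w .surge) ∧
      ∀ σ, M.IsOptimal w σ → ∃ t₂ t₃ t₅ t₆ : ℝ, 0 < t₂ ∧ t₂ < t₃ ∧ 0 < t₅ ∧ t₅ < t₆ ∧
        σ .nonsurge =ᵐ[M.F .nonsurge] Ioo t₂ t₃ ∧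
        σ .surge =ᵐ[M.F .surge] (Ioo 0 t₅ ∪ Ioi t₆ : Set ℝ)) := by
  refine ⟨fun M w hA => ⟨fun σ hσ => ?_, DynamicModel.exists_isOptimal_form hA,
    fun σ hσ => hσ.ae_eq_form hA⟩, ?_, ?_, ?_⟩
  · rw [M.earningsRate_eq_meanRate hA.1 hA.2.1 hσ]
    exact M.tendsto_earnings_meanRate hA.1 hA.2.1 hσ
  · exact ⟨expModel, expPricing 0 0, ExpModel.isRegularSetting (by norm_num) (by norm_num),
      ⟨1 / 4, by norm_num, fun τ _ => add_zero _⟩, ⟨1, by norm_num, fun τ _ => add_zero _⟩,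
      fun σ hσ => ExpModel.multiplicative_thresholds hσ, ExpModel.multiplicative_not_isIC⟩
  · refine ⟨expModel, expPricing (1 / 2) (-(1 / 10)),
      ExpModel.isRegularSetting le_rfl le_rfl, ⟨1 / 4, 1 / 2, by norm_num, by norm_num,
        fun τ _ => rfl⟩, ⟨1, 1 / 10, by norm_num, by norm_num,
        fun τ _ => (sub_eq_add_neg _ _).symm⟩, fun σ hσ => ?_⟩
    obtain ⟨s, t, -, hst, hs0, -, h1⟩ := ExpModel.exists_Ioo_nonsurge (by norm_num) le_rfl le_rfl
      (by norm_num) hσ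
    obtain ⟨t₄, ht₄, h2⟩ := ExpModel.exists_Ioi_surge le_rfl le_rfl (by norm_num) hσ (Or.inr rfl)
    have := hs0 (by norm_num)
    subst this
    exact ⟨t, t₄, hst, ht₄, h1, h2⟩
  · refine ⟨expModel, expPricing (-(1 / 100)) (1 / 1000),
      ExpModel.isRegularSetting (by norm_num) (by norm_num), ⟨1 / 4, 1 / 100, by norm_num,
        by norm_num, fun τ _ => (sub_eq_add_neg _ _).symm⟩, ⟨1, 1 / 1000, by norm_num, by norm_num,
        fun τ _ => rfl⟩, fun σ hσ => ?_⟩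
    obtain ⟨s, t, -, hst, -, hs0, h1⟩ := ExpModel.exists_Ioo_nonsurge le_rfl (by norm_num)
      (by norm_num) le_rfl hσ
    obtain ⟨t₅, t₆, h5, h56, h2⟩ := ExpModel.exists_union_surge (by norm_num) hσ
    exact ⟨s, t, t₅, t₆, hs0 rfl, hst, h5, h56, h1, h2⟩
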